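/- **Setting.** For $n\in\mathbb N$ and $p,q\in[0,1]$ let $\mathcal G(n,p,q)$ be the random $\pm1$-labelled graph on $n$ vertices in which the labels $\sigma_u$ are independent and uniform on $\{\pm1\}$ and, given the labels, each pair $\{u,v\}$ is an edge independently, with probability $p$ if $\sigma_u=\sigma_v$ and $q$ if $\sigma_u\neq\sigma_v$. Let $p_n,q_n\in[0,1]$, $a_n=np_n$, $b_n=nq_n$, $\hat p_n=\frac{p_n+q_n}{2}$, let $\mathbb P_n$ be the law $\mathcal G(n,p_n,q_n)$ and $\mathbb P_n'$ the (Erdős–Rényi) law $\mathcal G(n,\hat p_n,\hat p_n)$. Assume that $\hat p_n$ is bounded away from $1$, i.e. $\limsup_n\hat p_n<1$. With $x_{i,j}$ the indicator of the edge $\{i,j\}$, the signed cycle of length $k$ is $$C_{n,k}(G)=\left(\frac{1}{\sqrt{n p_{n,\mathrm{av}}(1-p_{n,\mathrm{av}})}}\right)^{k}\sum_{i_0,\dots,i_{k-1}\ \text{distinct}}(x_{i_0,i_1}-p_{n,\mathrm{av}})\cdots(x_{i_{k-1},i_0}-p_{n,\mathrm{av}}),\qquad p_{n,\mathrm{av}}=\frac{1}{n(n-1)}\sum_{i\ne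 j}\mathbb E[x_{i,j}]$$ (for both $\mathbb P_n$ and $\mathbb P_n'$ one has $p_{n,\mathrm{av}}=\hat p_n$). **Proposition.** Fix $l$, and let $3\le k_1<\dots<k_l$ be integers that may depend on $n$. (i) If $G\sim\mathbb P_n'$, $n(p_n+q_n)\to\infty$ and $k_l=o(\log(n\hat p_n))$, then $$\left(\frac{C_{n,k_1}(G)}{\sqrt{2k_1}},\dots,\frac{C_{n,k_l}(G)}{\sqrt{2k_l}}\right)\xrightarrow{d}N_l(0,I_l).$$ (ii) If $G\sim\mathbb P_n$, $np_n\to\infty$, $c=c_n=\frac{(a_n-b_n)^2}{a_n+b_n}=\Theta(1)$ and $k_l=o\big(\min(\log(n\hat p_n),\sqrt{\log n})\big)$, then $$\left(\frac{C_{n,k_1}(G)-\mu_1}{\sqrt{2k_1}},\dots,\frac{C_{n,k_l}(G)-\mu_l}{\sqrt{2k_l}}\right)\xrightarrow{d}N_l(0,I_l),\qquad \mu_i=\left(\operatorname{sgn}(p_n-q_n)\sqrt{\frac{c}{2(1-\hat p_n)}}\right)^{k_i};$$ in particular $\mu_i=\left(\frac{c}{2(1-\hat p_n)}\right)^{k_i/2}$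 when $p_n>q_n$ or $k_i$ is even. -/

import Mathlib

open MeasureTheory ProbabilityTheory Filter Asymptotics Topology unitInterval

namespace SignedCycles

/-- A `±1`-labelled graph on the vertex set `Fin n`. -/
abbrev LabelledGraph (n : ℕ) : Type := (Fin n → ℤˣ) × SimpleGraph (Fin n)

/-- Given the labels `τ`, the probability that a pair of vertices is joined: `p` if the two labels
agree and `q` if they differ. -/
def edgeProb {V : Type*} (p q : I) (τ : V → ℤˣ) : Sym2 V → I :=
  Sym2.lift ⟨fun u v => if τ u = τ v then p else q, fun u v => by simp only [eq_comm]⟩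

/-- The law of the graph given the labels `τ`: all pairs of vertices are tossed independently, the
pair `e` being an edge with probability `edgeProb p q τ e` (`fromEdgeSet` ignores the outcomes on
the diagonal of `Sym2 V`, so that the graph has no loops). -/
noncomputable def graphLaw {V : Type*} [Fintype V] (p q : I) (τ : V → ℤˣ) :
    Measure (SimpleGraph V) :=
  (Measure.pi fun e : Sym2 V => bernoulliMeasure True False (edgeProb p q τ e)).map
    fun E => SimpleGraph.fromEdgeSet {e | E e}

/-- The stochastic block model `𝒢(n, p, q)`: the labels are independent and uniform on `{±1}`,
i.e. the labelling is uniform on `{±1}ⁿ`, and given the labels the graph has law `graphLaw`. -/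
noncomputable def sbm (n : ℕ) (p q : I) : Measure (LabelledGraph n) :=
  ((2 : ENNReal) ^ n)⁻¹ • ∑ τ : Fin n → ℤˣ, (Measure.dirac τ).prod (graphLaw p q τ)

instance {V : Type*} [Fintype V] (p q : I) (τ : V → ℤˣ) :
    IsProbabilityMeasure (graphLaw p q τ) := by
  unfold graphLaw
  refine Measure.isProbabilityMeasure_map (Measurable.aemeasurable ?_)
  exact SimpleGraph.measurable_fromEdgeSet.comp MeasurableEquiv.setOfPred.measurable

instance (n : ℕ) (p q : I) : IsProbabilityMeasure (sbm n p q) := by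
  constructor
  simp only [sbm, Measure.smul_apply, Measure.finsetSum_apply, measure_univ, Finset.sum_const,
    Finset.card_univ, Fintype.card_pi, Fintype.card_units_int, Finset.prod_const, Fintype.card_fin,
    smul_eq_mul, nsmul_eq_mul, mul_one]
  push_cast
  exact ENNReal.inv_mul_cancel (by simp) (by finiteness)

/-- The average `(p + q) / 2` of two probabilities. -/
noncomputable def avgProb (p q : I) : I :=
  ⟨((p : ℝ) + q) / 2, by
    have hp := p.2.1
    have hp' := p.2.2
    have hq := q.2.1
    have hq' := q.2.2
    constructor <;> linarith⟩

open Classical in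
/-- The edge indicator `x_{u,v}` of a graph. -/
noncomputable def edgeInd {V : Type*} (G : SimpleGraph V) (u v : V) : ℝ :=
  if G.Adj u v then 1 else 0

/-- The average connection probability `1 / (n (n - 1)) * ∑_{i ≠ j} E[x_{i,j}]` of a random
labelled graph with law `P`. -/
noncomputable def avgConnProb {n : ℕ} (P : Measure (LabelledGraph n)) : ℝ :=
  1 / ((n : ℝ) * ((n : ℝ) - 1)) *
    ∑ i : Fin n, ∑ j ∈ Finset.univ.erase i, ∫ ω, edgeInd ω.2 i j ∂P

/-- The signed cycle count of length `k` of the graph `G` on `n` vertices, with centering `r`: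
`(1 / √(n r (1 - r)))ᵏ * ∑ (x_{i₀,i₁} - r) ⋯ (x_{i_{k-1},i₀} - r)`, the sum ranging over all tuples
`i₀, …, i_{k-1}` of distinct vertices. Here `finRotate k` is `j ↦ j + 1` modulo `k`. -/
noncomputable def signedCycleCount {n : ℕ} (r : ℝ) (k : ℕ) (G : SimpleGraph (Fin n)) : ℝ :=
  (1 / √(n * r * (1 - r))) ^ k *
    ∑ i : Fin k ↪ Fin n, ∏ j : Fin k, (edgeInd G (i j) (i (finRotate k j)) - r)

/-- The signed cycle `C_{n,k}` as a random variable on the space of labelled graphs with law `P`,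
centered and scaled by the average connection probability of `P`. -/
noncomputable def signedCycle {n : ℕ} (P : Measure (LabelledGraph n)) (k : ℕ)
    (ω : LabelledGraph n) : ℝ :=
  signedCycleCount (avgConnProb P) k ω.2

/-- `c = (a - b)² / (a + b)` for `a = n p` and `b = n q`. -/
noncomputable def signal (n : ℕ) (p q : I) : ℝ :=
  ((n : ℝ) * p - n * q) ^ 2 / (n * p + n * q)

/-- The centering `(sgn(p - q) √(c / (2 (1 - p̂))))ᵏ` of the signed cycle of length `k` under
`𝒢(n, p, q)`, where `p̂ = (p + q) / 2`. -/
noncomputable def cycleMean (n : ℕ) (p q : I) (k : ℕ) : ℝ :=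
  (Real.sign ((p : ℝ) - q) * √(signal n p q / (2 * (1 - (avgProb p q : ℝ))))) ^ k

end SignedCycles

/-!
Given the labels, the standardized indicator of an edge is a centered noise of variance close to
one plus a deterministic signal, equal to `θ / √n` up to the product of the labels of the two ends,
where `cycleMean n p q k = θ ^ k`. The labels cancel around a cycle, so that the pure signal part
of a signed cycle of length `k` is close to `θ ^ k`, whatever the labels. The terms that mix noise
and signal are centered, and their second moment is small because two cycles through the same noise
edges have few free vertices left. The pure noise part is the Erdős–Rényi case.

The noise part is Gaussian by Stein's method for characteristic functions: cycles correlate only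
through common edges, hence everything reduces to the law of large numbers for the overlaps of pairs
of cycles, and to second order statistics of edge-connected quadruples of cycles in which no edge
occurs only once. Exploring the cycles of a quadruple one after the other by a random walk which
prefers the edges and vertices seen before shows that quadruples of total length `K` contribute at
most `C ^ K K ^ 4 / √(n p̂)`. This tends to zero as soon as `K = o(log (n p̂))`.
-/

namespace SignedCycles

/-! ### Exploring a graph along walks -/

section Exploration

lemma sum_ite_inv_le_one {α : Type*} [Fintype α] (s : α → Prop) [DecidablePred s] {c : ℕ}
    (hc : (Finset.univ.filter s).card ≤ c) : ∑ x, (if s x then (c : ℝ)⁻¹ else 0) ≤ 1 := by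
  rw [← Finset.sum_filter, Finset.sum_const, nsmul_eq_mul, ← div_eq_mul_inv]
  exact div_le_one_of_le₀ (by exact_mod_cast hc) (Nat.cast_nonneg c)

lemma le_mul_inv_card_mul {α : Type*} {s : Finset α} {x : α} (hx : x ∈ s) {c r : ℝ}
    (hc : (s.card : ℝ) ≤ c) (hr : 0 ≤ r) : r ≤ c * (s.card : ℝ)⁻¹ * r := by
  have hs : (0 : ℝ) < s.card := by exact_mod_cast Finset.card_pos.2 ⟨x, hx⟩
  exact le_mul_of_one_le_left hr ((one_le_div hs).2 hc)

section Potential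

variable {V : Type*} [Fintype V]

/-- The potential of the state of an exploration that has seen the vertices `U` and the edges `H`.
A step multiplies it by at most a constant times the weight of the step, so that the weight of a
family of walks is bounded below in terms of the numbers of vertices and edges it covers. -/
noncomputable def potential (K : ℝ) (U : Finset V) (H : Finset (Sym2 V)) : ℝ :=
  (K / Fintype.card V) ^ U.card * K⁻¹ ^ H.card

lemma potential_nonneg {K : ℝ} (hK : 0 ≤ K) (U : Finset V) (H : Finset (Sym2 V)) :
    0 ≤ potential K U H := by
  unfold potential; positivity

lemma potential_anti_right {K : ℝ} (hK : 1 ≤ K) (U : Finset V) {H H' : Finset (Sym2 V)}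
    (h : H ⊆ H') : potential K U H' ≤ potential K U H :=
  mul_le_mul_of_nonneg_left
    (pow_le_pow_of_le_one (by positivity) (inv_le_one_of_one_le₀ hK) (Finset.card_le_card h))
    (by positivity)

end Potential

variable {V : Type*} [DecidableEq V]

/-- The edges of the walk that starts at a vertex and then visits the vertices of a list. -/
def walkEdges : V → List V → Finset (Sym2 V)
  | _, [] => ∅
  | y, x :: l => insert s(y, x) (walkEdges x l)

lemma exists_eq_of_mem_walkEdges_ofFn {k : ℕ} (g : Fin (k + 1) → V) {e : Sym2 V}
    (he : e ∈ walkEdges (g 0) (List.ofFn fun i : Fin k => g i.succ)) :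
    ∃ i : Fin k, e = s(g i.castSucc, g i.succ) := by
  induction k with
  | zero => simp [walkEdges] at he
  | succ k ih =>
    rw [List.ofFn_succ, walkEdges, Finset.mem_insert] at he
    rcases he with rfl | he
    · exact ⟨0, rfl⟩
    · obtain ⟨i, hi⟩ := ih (fun i => g i.succ) he
      exact ⟨i.succ, hi⟩

variable [Fintype V]

/-- The neighbours of the vertex `y` in the graph with edge set `H`. -/
def nbrs (H : Finset (Sym2 V)) (y : V) : Finset V := {z | s(y, z) ∈ H}

lemma mem_nbrs {H : Finset (Sym2 V)} {y z : V} : z ∈ nbrs H y ↔ s(y, z) ∈ H := by simp [nbrs]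

lemma nbrs_mono {H H' : Finset (Sym2 V)} (h : H ⊆ H') (y : V) : nbrs H y ⊆ nbrs H' y :=
  fun _ hz => mem_nbrs.2 (h (mem_nbrs.1 hz))

/-- The weight given to `x` as the starting vertex of a new walk by an explorer who has already
seen the vertices `U`: uniform weight on `U` for the old vertices and uniform weight on all
vertices for the new ones. The total weight is at most `2`. -/
noncomputable def startWeight (U : Finset V) (x : V) : ℝ :=
  if x ∈ U then (U.card : ℝ)⁻¹ else (Fintype.card V : ℝ)⁻¹

/-- The weight given to a step from `y` to `x` by an explorer who has already seen the vertices `U`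
and the edges `H`: uniform weight on the neighbours of `y` for the old edges, uniform weight on `U`
for the new edges between old vertices, and uniform weight on all vertices for the new ones. The
total weight is at most `3`. -/
noncomputable def stepWeight (U : Finset V) (H : Finset (Sym2 V)) (y x : V) : ℝ :=
  if x ∉ U then (Fintype.card V : ℝ)⁻¹
  else if s(y, x) ∈ H then ((nbrs H y).card : ℝ)⁻¹ else (U.card : ℝ)⁻¹

/-- The product of the weights of the steps of a walk from a given vertex through a list of
vertices. -/
noncomputable def stepsWeight : Finset V → Finset (Sym2 V) → V → List V → ℝ
  | _, _, _, [] => 1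
  | U, H, y, x :: l => stepWeight U H y x * stepsWeight (insert x U) (insert s(y, x) H) x l

/-- The product of the weights of the start and of the steps of a walk. -/
noncomputable def walkWeight (U : Finset V) (H : Finset (Sym2 V)) : List V → ℝ
  | [] => 1
  | x :: l => startWeight U x * stepsWeight (insert x U) H x l

lemma startWeight_nonneg (U : Finset V) (x : V) : 0 ≤ startWeight U x := by
  unfold startWeight; split_ifs <;> positivity

lemma stepWeight_nonneg (U : Finset V) (H : Finset (Sym2 V)) (y x : V) :
    0 ≤ stepWeight U H y x := by
  unfold stepWeight; split_ifs <;> positivity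

lemma stepsWeight_nonneg (U : Finset V) (H : Finset (Sym2 V)) (y : V) (l : List V) :
    0 ≤ stepsWeight U H y l := by
  induction l generalizing U H y with
  | nil => exact zero_le_one
  | cons x l ih => exact mul_nonneg (stepWeight_nonneg _ _ _ _) (ih _ _ _)

lemma walkWeight_nonneg (U : Finset V) (H : Finset (Sym2 V)) (l : List V) :
    0 ≤ walkWeight U H l := by
  cases l with
  | nil => exact zero_le_one
  | cons x l => exact mul_nonneg (startWeight_nonneg _ _) (stepsWeight_nonneg _ _ _ _)

lemma sum_stepWeight_le (U : Finset V) (H : Finset (Sym2 V)) (y : V) :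
    ∑ x, stepWeight U H y x ≤ 3 := by
  calc ∑ x, stepWeight U H y x
      ≤ ∑ x, ((if True then (Fintype.card V : ℝ)⁻¹ else 0) +
          (if s(y, x) ∈ H then ((nbrs H y).card : ℝ)⁻¹ else 0) +
          (if x ∈ U then (U.card : ℝ)⁻¹ else 0)) := by
        refine Finset.sum_le_sum fun x _ => ?_
        have hV : (0 : ℝ) ≤ (Fintype.card V : ℝ)⁻¹ := by positivity
        have hH : (0 : ℝ) ≤ ((nbrs H y).card : ℝ)⁻¹ := by positivity
        have hU : (0 : ℝ) ≤ (U.card : ℝ)⁻¹ := by positivity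
        by_cases hxU : x ∈ U <;> by_cases hxH : s(y, x) ∈ H <;>
          simp only [stepWeight, hxU, hxH, not_true_eq_false, not_false_eq_true, if_true,
            if_false] <;> linarith
    _ ≤ 1 + 1 + 1 := by
        rw [Finset.sum_add_distrib, Finset.sum_add_distrib]
        gcongr
        · exact sum_ite_inv_le_one _ (Finset.card_le_univ _)
        · exact sum_ite_inv_le_one _ le_rfl
        · exact sum_ite_inv_le_one _ (by simp)
    _ = 3 := by norm_num

lemma sum_startWeight_le (U : Finset V) : ∑ x, startWeight U x ≤ 2 := by
  calc ∑ x, startWeight U x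
      ≤ ∑ x, ((if True then (Fintype.card V : ℝ)⁻¹ else 0) +
          (if x ∈ U then (U.card : ℝ)⁻¹ else 0)) := by
        refine Finset.sum_le_sum fun x _ => ?_
        have hV : (0 : ℝ) ≤ (Fintype.card V : ℝ)⁻¹ := by positivity
        by_cases hxU : x ∈ U <;> simp only [startWeight, hxU, if_true, if_false] <;> linarith
    _ ≤ 1 + 1 := by
        rw [Finset.sum_add_distrib]
        gcongr
        · exact sum_ite_inv_le_one _ (Finset.card_le_univ _)
        · exact sum_ite_inv_le_one _ (by simp)
    _ = 2 := by norm_num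

lemma sum_stepsWeight_le (m : ℕ) (U : Finset V) (H : Finset (Sym2 V)) (y : V) :
    ∑ f : Fin m → V, stepsWeight U H y (List.ofFn f) ≤ 3 ^ m := by
  induction m generalizing U H y with
  | zero => simp [stepsWeight]
  | succ m ih =>
    rw [← (Fin.consEquiv fun _ : Fin (m + 1) => V).sum_comp, Fintype.sum_prod_type]
    simp only [Fin.consEquiv_apply, List.ofFn_succ, Fin.cons_zero, Fin.cons_succ, stepsWeight,
      ← Finset.mul_sum]
    calc _ ≤ ∑ x, stepWeight U H y x * 3 ^ m :=
          Finset.sum_le_sum fun x _ =>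
            mul_le_mul_of_nonneg_left (ih _ _ _) (stepWeight_nonneg _ _ _ _)
      _ ≤ 3 * 3 ^ m := by
          rw [← Finset.sum_mul]
          gcongr
          exact sum_stepWeight_le U H y
      _ = 3 ^ (m + 1) := by ring

lemma sum_walkWeight_le (m : ℕ) (U : Finset V) (H : Finset (Sym2 V)) :
    ∑ f : Fin m → V, walkWeight U H (List.ofFn f) ≤ 3 ^ m := by
  cases m with
  | zero => simp [walkWeight]
  | succ m =>
    rw [← (Fin.consEquiv fun _ : Fin (m + 1) => V).sum_comp, Fintype.sum_prod_type]
    simp only [Fin.consEquiv_apply, List.ofFn_succ, Fin.cons_zero, Fin.cons_succ, walkWeight,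
      ← Finset.mul_sum]
    calc _ ≤ ∑ x, startWeight U x * 3 ^ m :=
          Finset.sum_le_sum fun x _ =>
            mul_le_mul_of_nonneg_left (sum_stepsWeight_le _ _ _ _) (startWeight_nonneg _ _)
      _ ≤ 3 * 3 ^ m := by
          rw [← Finset.sum_mul]
          gcongr
          linarith [sum_startWeight_le U]
      _ = 3 ^ (m + 1) := by ring

lemma sum_embedding_walkWeight_le (m : ℕ) (U : Finset V) (H : Finset (Sym2 V)) :
    ∑ f : Fin m ↪ V, walkWeight U H (List.ofFn f) ≤ 3 ^ m := by
  calc _ = ∑ f ∈ Finset.univ.image fun f : Fin m ↪ V => (f : Fin m → V),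
        walkWeight U H (List.ofFn f) :=
        (Finset.sum_image fun _ _ _ _ h => DFunLike.coe_injective h).symm
    _ ≤ _ := Finset.sum_le_sum_of_subset_of_nonneg (Finset.subset_univ _)
        fun _ _ _ => walkWeight_nonneg _ _ _
    _ ≤ 3 ^ m := sum_walkWeight_le m U H

lemma potential_insert_le_of_start {U : Finset V} (H : Finset (Sym2 V)) (x : V) {K : ℝ}
    (hUK : (U.card : ℝ) ≤ K) :
    potential K (insert x U) H ≤ K * startWeight U x * potential K U H := by
  have hK : 0 ≤ K := (Nat.cast_nonneg _).trans hUK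
  by_cases hx : x ∈ U
  · rw [startWeight, if_pos hx, Finset.insert_eq_of_mem hx]
    exact le_mul_inv_card_mul hx hUK (potential_nonneg hK U H)
  · rw [startWeight, if_neg hx, potential, potential, Finset.card_insert_of_notMem hx, pow_succ]
    apply le_of_eq
    ring

lemma potential_insert_le_of_step {U : Finset V} {H : Finset (Sym2 V)} (y x : V) {K D : ℝ}
    (hD : 1 ≤ D) (hHU : ∀ e ∈ H, ∀ z ∈ e, z ∈ U) (hUK : (U.card : ℝ) ≤ K) (hK : 0 < K)
    (hdeg : ((nbrs H y).card : ℝ) ≤ D) :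
    potential K (insert x U) (insert s(y, x) H) ≤ D * stepWeight U H y x * potential K U H := by
  have hpos := potential_nonneg hK.le U H
  by_cases hxU : x ∈ U
  · rw [Finset.insert_eq_of_mem hxU]
    by_cases hxH : s(y, x) ∈ H
    · rw [Finset.insert_eq_of_mem hxH, stepWeight, if_neg (not_not.2 hxU), if_pos hxH]
      exact le_mul_inv_card_mul (mem_nbrs.2 hxH) hdeg hpos
    · rw [stepWeight, if_neg (not_not.2 hxU), if_neg hxH]
      calc potential K U (insert s(y, x) H) = K⁻¹ * potential K U H := by
            rw [potential, potential, Finset.card_insert_of_notMem hxH]; ring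
        _ ≤ D * (U.card : ℝ)⁻¹ * potential K U H := by
            have hU : (0 : ℝ) < U.card := by exact_mod_cast Finset.card_pos.2 ⟨x, hxU⟩
            gcongr
            exact (inv_anti₀ hU hUK).trans (le_mul_of_one_le_left (by positivity) hD)
  · have hxH : s(y, x) ∉ H := fun h => hxU (hHU _ h x (by simp))
    rw [stepWeight, if_pos hxU]
    calc potential K (insert x U) (insert s(y, x) H)
        = 1 * (Fintype.card V : ℝ)⁻¹ * potential K U H := by
          rw [potential, potential, Finset.card_insert_of_notMem hxU,
            Finset.card_insert_of_notMem hxH]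
          linear_combination (K / Fintype.card V) ^ U.card * K⁻¹ ^ H.card *
            (Fintype.card V : ℝ)⁻¹ * mul_inv_cancel₀ hK.ne'
      _ ≤ D * (Fintype.card V : ℝ)⁻¹ * potential K U H := by gcongr

lemma potential_le_stepsWeight (l : List V) {U : Finset V} {H H' : Finset (Sym2 V)} {y : V}
    {K D : ℝ} (hD : 1 ≤ D) (hHU : ∀ e ∈ H, ∀ z ∈ e, z ∈ U) (hy : y ∈ U)
    (hUK : ((U ∪ l.toFinset).card : ℝ) ≤ K) (hH' : H ∪ walkEdges y l ⊆ H')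
    (hdeg : ∀ z, ((nbrs H' z).card : ℝ) ≤ D) :
    potential K (U ∪ l.toFinset) (H ∪ walkEdges y l) ≤
      D ^ l.length * stepsWeight U H y l * potential K U H := by
  induction l generalizing U H y with
  | nil => simp [walkEdges, stepsWeight]
  | cons x l ih =>
    have hU : U ∪ (x :: l).toFinset = insert x U ∪ l.toFinset := by ext; simp
    have hH : H ∪ walkEdges y (x :: l) = insert s(y, x) H ∪ walkEdges x l := by
      ext; simp [walkEdges]
    rw [hU] at hUK ⊢
    rw [hH] at hH' ⊢
    have hHU' : ∀ e ∈ insert s(y, x) H, ∀ z ∈ e, z ∈ insert x U := by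
      intro e he z hz
      rcases Finset.mem_insert.1 he with rfl | he
      · rcases Sym2.mem_iff.1 hz with rfl | rfl <;> simp [hy]
      · exact Finset.mem_insert_of_mem (hHU e he z hz)
    have hUK' : (U.card : ℝ) ≤ K := le_trans (by
      exact_mod_cast Finset.card_le_card fun z hz => by simp [hz]) hUK
    have hK : 0 < K := lt_of_lt_of_le (by exact_mod_cast Finset.card_pos.2 ⟨y, hy⟩) hUK'
    have hdeg' : ((nbrs H y).card : ℝ) ≤ D := le_trans (by
      exact_mod_cast Finset.card_le_card (nbrs_mono (fun e he => hH' (by simp [he])) y)) (hdeg y)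
    have hW := stepsWeight_nonneg (insert x U) (insert s(y, x) H) x l
    calc _ ≤ D ^ l.length * stepsWeight (insert x U) (insert s(y, x) H) x l *
          potential K (insert x U) (insert s(y, x) H) :=
          ih hHU' (Finset.mem_insert_self x U) hUK hH'
      _ ≤ D ^ l.length * stepsWeight (insert x U) (insert s(y, x) H) x l *
          (D * stepWeight U H y x * potential K U H) := by
          gcongr
          exact potential_insert_le_of_step y x hD hHU hUK' hK hdeg'
      _ = D ^ (x :: l).length * stepsWeight U H y (x :: l) * potential K U H := by
          rw [stepsWeight, List.length_cons]; ring

end Exploration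

/-! ### Cycles and overlapping families of cycles -/

section FinRotation

lemma fin_add_one_add_one_ne {m : ℕ} (j : Fin (m + 3)) : j + 1 + 1 ≠ j := by
  rw [add_assoc]
  intro h
  have h2 : (1 + 1 : Fin (m + 3)) = 0 := by simpa only [add_eq_left] using h
  simp only [Fin.ext_iff, Fin.val_add, Fin.val_one, Fin.val_zero] at h2
  rw [Nat.mod_eq_of_lt (by omega)] at h2
  omega

lemma forall_fin_of_add_one {k : ℕ} {P : Fin (k + 1) → Prop} {j : Fin (k + 1)} (hj : P j)
    (h : ∀ i, P i → P (i + 1)) (i : Fin (k + 1)) : P i := by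
  have hP : ∀ t : ℕ, P (j + Fin.ofNat (k + 1) t) := by
    intro t
    induction t with
    | zero => simpa using hj
    | succ t ih =>
      have ht : Fin.ofNat (k + 1) (t + 1) = Fin.ofNat (k + 1) t + 1 := by
        ext; simp [Fin.val_add]
      rw [ht, ← add_assoc]
      exact h _ ih
  simpa using hP (i - j).val

end FinRotation

section Cycles

variable {V : Type*} {m : ℕ}

/-- The `j`-th edge of the closed walk `f 0, f 1, …, f (m + 2), f 0`. Cycles have length at least
three, and their vertices are indexed by `Fin (m + 3)` so that successors are taken cyclically. -/
def cycleEdge (f : Fin (m + 3) → V) (j : Fin (m + 3)) : Sym2 V := s(f j, f (j + 1))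

lemma cycleEdge_injective {f : Fin (m + 3) → V} (hf : Function.Injective f) :
    Function.Injective (cycleEdge f) := by
  intro i j h
  rcases Sym2.eq_iff.1 h with ⟨h, -⟩ | ⟨hij, hji⟩
  · exact hf h
  · have hji' := hf hji
    rw [hf hij] at hji'
    exact absurd hji' (fin_add_one_add_one_ne j)

variable [DecidableEq V]

/-- The set of edges of a cycle. -/
def cycleEdges (f : Fin (m + 3) → V) : Finset (Sym2 V) := Finset.univ.image (cycleEdge f)

/-- The set of vertices of a cycle. -/
def cycleVerts (f : Fin (m + 3) → V) : Finset V := Finset.univ.image f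

lemma mem_cycleEdges {f : Fin (m + 3) → V} {e : Sym2 V} :
    e ∈ cycleEdges f ↔ ∃ j, s(f j, f (j + 1)) = e := by
  simp [cycleEdges, cycleEdge]

lemma mem_cycleVerts {f : Fin (m + 3) → V} {x : V} : x ∈ cycleVerts f ↔ ∃ j, f j = x := by
  simp [cycleVerts]

lemma mk_succ_mem_cycleEdges (f : Fin (m + 3) → V) (j) : s(f j, f (j + 1)) ∈ cycleEdges f :=
  mem_cycleEdges.2 ⟨j, rfl⟩

lemma mk_pred_mem_cycleEdges (f : Fin (m + 3) → V) (j) : s(f j, f (j - 1)) ∈ cycleEdges f :=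
  mem_cycleEdges.2 ⟨j - 1, by rw [sub_add_cancel, Sym2.eq_swap]⟩

lemma card_cycleEdges {f : Fin (m + 3) → V} (hf : Function.Injective f) :
    (cycleEdges f).card = m + 3 := by
  rw [cycleEdges, Finset.card_image_of_injective _ (cycleEdge_injective hf), Finset.card_fin]

lemma mem_cycleVerts_of_mem_cycleEdges {f : Fin (m + 3) → V} {e : Sym2 V}
    (he : e ∈ cycleEdges f) {x : V} (hx : x ∈ e) : x ∈ cycleVerts f := by
  obtain ⟨j, rfl⟩ := mem_cycleEdges.1 he
  rcases Sym2.mem_iff.1 hx with rfl | rfl <;> simp [mem_cycleVerts]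

lemma not_isDiag_of_mem_cycleEdges {f : Fin (m + 3) → V} (hf : Function.Injective f) {e : Sym2 V}
    (he : e ∈ cycleEdges f) : ¬ e.IsDiag := by
  obtain ⟨j, rfl⟩ := mem_cycleEdges.1 he
  intro h
  simpa using hf (Sym2.mk_isDiag_iff.1 h)

lemma eq_or_eq_of_mem_cycleEdges {f : Fin (m + 3) → V} (hf : Function.Injective f)
    {j : Fin (m + 3)} {y : V} (h : s(f j, y) ∈ cycleEdges f) : y = f (j + 1) ∨ y = f (j - 1) := by
  obtain ⟨i, hi⟩ := mem_cycleEdges.1 h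
  rcases Sym2.eq_iff.1 hi with ⟨hij, rfl⟩ | ⟨rfl, hij⟩
  · exact Or.inl (by rw [hf hij])
  · exact Or.inr (by rw [← hf hij, add_sub_cancel_right])

lemma eq_of_cycleEdges_eq {f g : Fin (m + 3) → V} (hf : Function.Injective f)
    (hg : Function.Injective g) (h : cycleEdges f = cycleEdges g) (h0 : f 0 = g 0)
    (h1 : f 1 = g 1) : f = g := by
  have hfg : ∀ i, f i = g i ∧ f (i + 1) = g (i + 1) := by
    refine forall_fin_of_add_one (j := 0) ⟨h0, by simpa using h1⟩ ?_
    rintro i ⟨hi, hi'⟩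
    refine ⟨hi', ?_⟩
    have hm : s(g (i + 1), f (i + 1 + 1)) ∈ cycleEdges g := by
      rw [← hi', ← h]; exact mk_succ_mem_cycleEdges f (i + 1)
    refine (eq_or_eq_of_mem_cycleEdges hg hm).resolve_right fun hback => ?_
    rw [add_sub_cancel_right, ← hi] at hback
    exact fin_add_one_add_one_ne i (hf hback)
  exact funext fun i => (hfg i).1

variable [Fintype V]

lemma two_le_card_nbrs {f : Fin (m + 3) → V} (hf : Function.Injective f) {H : Finset (Sym2 V)}
    (hH : cycleEdges f ⊆ H) {y : V} (hy : y ∈ cycleVerts f) : 2 ≤ (nbrs H y).card := by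
  obtain ⟨j, rfl⟩ := mem_cycleVerts.1 hy
  have hne : f (j + 1) ≠ f (j - 1) := fun h => by
    have := fin_add_one_add_one_ne (j - 1)
    rw [sub_add_cancel] at this
    exact this (hf h)
  rw [← Finset.card_pair hne]
  refine Finset.card_le_card fun z hz => mem_nbrs.2 (hH ?_)
  rcases Finset.mem_insert.1 hz with rfl | hz
  · exact mk_succ_mem_cycleEdges f j
  · rw [Finset.mem_singleton.1 hz]
    exact mk_pred_mem_cycleEdges f j

lemma mem_cycleEdges_of_card_nbrs_le_two {f : Fin (m + 3) → V} (hf : Function.Injective f)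
    {H : Finset (Sym2 V)} (hH : cycleEdges f ⊆ H) (hdeg : ∀ y, (nbrs H y).card ≤ 2) {y z : V}
    (hy : y ∈ cycleVerts f) (hz : s(y, z) ∈ H) : s(y, z) ∈ cycleEdges f := by
  have h : nbrs (cycleEdges f) y = nbrs H y :=
    Finset.eq_of_subset_of_card_le (nbrs_mono hH y)
      ((hdeg y).trans (two_le_card_nbrs hf subset_rfl hy))
  exact mem_nbrs.1 (h ▸ mem_nbrs.2 hz)

lemma cycleEdges_subset_of_card_nbrs_le_two {m' : ℕ} {f : Fin (m + 3) → V}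
    (hf : Function.Injective f) {g : Fin (m' + 3) → V} {H : Finset (Sym2 V)}
    (hfH : cycleEdges f ⊆ H) (hgH : cycleEdges g ⊆ H) (hdeg : ∀ y, (nbrs H y).card ≤ 2)
    (hfg : ¬ Disjoint (cycleEdges f) (cycleEdges g)) : cycleEdges g ⊆ cycleEdges f := by
  obtain ⟨e, hef, heg⟩ := Finset.not_disjoint_iff.1 hfg
  obtain ⟨j, rfl⟩ := mem_cycleEdges.1 heg
  have hmem : ∀ i, g i ∈ cycleVerts f → s(g i, g (i + 1)) ∈ cycleEdges f := fun i hi =>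
    mem_cycleEdges_of_card_nbrs_le_two hf hfH hdeg hi (hgH (mk_succ_mem_cycleEdges g i))
  have hverts : ∀ i, g i ∈ cycleVerts f :=
    forall_fin_of_add_one (j := j) (mem_cycleVerts_of_mem_cycleEdges hef (by simp))
      fun i hi => mem_cycleVerts_of_mem_cycleEdges (hmem i hi) (by simp)
  intro e he
  obtain ⟨i, rfl⟩ := mem_cycleEdges.1 he
  exact hmem i (hverts i)

lemma cycleEdges_eq_of_card_nbrs_le_two {m' : ℕ} {f : Fin (m + 3) → V}
    (hf : Function.Injective f) {g : Fin (m' + 3) → V} (hg : Function.Injective g)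
    {H : Finset (Sym2 V)} (hfH : cycleEdges f ⊆ H) (hgH : cycleEdges g ⊆ H)
    (hdeg : ∀ y, (nbrs H y).card ≤ 2) (hfg : ¬ Disjoint (cycleEdges f) (cycleEdges g)) :
    cycleEdges f = cycleEdges g :=
  (cycleEdges_subset_of_card_nbrs_le_two hg hgH hfH hdeg fun h => hfg h.symm).antisymm
    (cycleEdges_subset_of_card_nbrs_le_two hf hfH hgH hdeg hfg)

lemma potential_le_walkWeight (f : Fin (m + 3) → V) {U : Finset V} {H H' : Finset (Sym2 V)}
    {K D : ℝ} (hK : 1 ≤ K) (hD : 1 ≤ D) (hHU : ∀ e ∈ H, ∀ x ∈ e, x ∈ U)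
    (hUK : ((U ∪ cycleVerts f).card : ℝ) ≤ K) (hH' : H ∪ cycleEdges f ⊆ H')
    (hdeg : ∀ y, ((nbrs H' y).card : ℝ) ≤ D) :
    potential K (U ∪ cycleVerts f) (H ∪ cycleEdges f) ≤
      K * D ^ (m + 3) * walkWeight U H (List.ofFn f) * potential K U H := by
  rw [List.ofFn_succ, walkWeight]
  set l := List.ofFn fun i : Fin (m + 2) => f i.succ with hl
  have hwalk : H ∪ walkEdges (f 0) l ⊆ H ∪ cycleEdges f := by
    refine Finset.union_subset_union_right fun e he => ?_
    obtain ⟨i, rfl⟩ := exists_eq_of_mem_walkEdges_ofFn f he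
    simpa only [Fin.coeSucc_eq_succ] using mk_succ_mem_cycleEdges f i.castSucc
  have hverts : insert (f 0) U ∪ l.toFinset = U ∪ cycleVerts f := by
    ext z
    simp only [Finset.mem_union, Finset.mem_insert, List.mem_toFinset, hl, List.mem_ofFn,
      mem_cycleVerts, Fin.exists_fin_succ (P := fun i => f i = z)]
    tauto
  have hW := stepsWeight_nonneg (insert (f 0) U) H (f 0) l
  calc potential K (U ∪ cycleVerts f) (H ∪ cycleEdges f)
      ≤ potential K (insert (f 0) U ∪ l.toFinset) (H ∪ walkEdges (f 0) l) := by
        rw [hverts]; exact potential_anti_right hK _ hwalk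
    _ ≤ D ^ l.length * stepsWeight (insert (f 0) U) H (f 0) l * potential K (insert (f 0) U) H :=
        potential_le_stepsWeight l hD
          (fun e he x hx => Finset.mem_insert_of_mem (hHU e he x hx)) (by simp)
          (by rwa [hverts]) (hwalk.trans hH') hdeg
    _ ≤ D ^ (m + 3) * stepsWeight (insert (f 0) U) H (f 0) l *
          (K * startWeight U (f 0) * potential K U H) := by
        gcongr
        · exact potential_nonneg (by positivity) _ _
        · simp [hl]
        · refine potential_insert_le_of_start H (f 0) (le_trans ?_ hUK)
          exact_mod_cast Finset.card_le_card Finset.subset_union_left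
    _ = _ := by ring

end Cycles

section Degrees

variable {V : Type*} [Fintype V] [DecidableEq V]

lemma sum_card_nbrs {H : Finset (Sym2 V)} (hH : ∀ e ∈ H, ¬ e.IsDiag) :
    ∑ y, (nbrs H y).card = 2 * H.card := by
  classical
  obtain ⟨G, hG⟩ : ∃ G, G = SimpleGraph.fromEdgeSet (H : Set (Sym2 V)) := ⟨_, rfl⟩
  have hdeg : ∀ y, (nbrs H y).card = G.degree y := by
    intro y
    rw [← SimpleGraph.card_neighborFinset_eq_degree]
    congr 1
    ext z
    rw [mem_nbrs, SimpleGraph.mem_neighborFinset, hG, SimpleGraph.fromEdgeSet_adj, Finset.mem_coe]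
    exact ⟨fun h => ⟨h, fun hyz => hH _ h (Sym2.mk_isDiag_iff.2 hyz)⟩, fun h => h.1⟩
  rw [Finset.sum_congr rfl fun y _ => hdeg y, G.sum_degrees_eq_twice_card_edges]
  congr 2
  ext e
  refine SimpleGraph.mem_edgeFinset.trans ?_
  rw [hG, SimpleGraph.edgeSet_fromEdgeSet]
  exact ⟨fun h => h.1, fun h => ⟨h, hH e h⟩⟩

lemma card_le_and_card_nbrs_le {H : Finset (Sym2 V)} {U : Finset V} (hH : ∀ e ∈ H, ¬ e.IsDiag)
    (hU : ∀ y ∈ U, 2 ≤ (nbrs H y).card) (hHU : ∀ e ∈ H, ∀ x ∈ e, x ∈ U) :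
    U.card ≤ H.card ∧ ∀ y, (nbrs H y).card ≤ 2 + 2 * (H.card - U.card) := by
  have hout : ∀ y ∉ U, (nbrs H y).card = 0 := fun y hy =>
    Finset.card_eq_zero.2 (Finset.eq_empty_of_forall_notMem fun z hz =>
      hy (hHU _ (mem_nbrs.1 hz) y (by simp)))
  have hsum : ∑ y ∈ U, (nbrs H y).card = 2 * H.card := by
    rw [← sum_card_nbrs hH]
    exact Finset.sum_subset (Finset.subset_univ _) fun y _ hy => hout y hy
  have hle : ∀ W ⊆ U, W.card * 2 ≤ ∑ y ∈ W, (nbrs H y).card := fun W hW =>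
    Finset.card_nsmul_le_sum _ _ _ fun y hy => hU y (hW hy)
  have hUH := hle U subset_rfl
  refine ⟨by omega, fun y => ?_⟩
  by_cases hy : y ∈ U
  · have hsplit := Finset.add_sum_erase U (fun y => (nbrs H y).card) hy
    have herase := hle (U.erase y) (Finset.erase_subset y U)
    rw [Finset.card_erase_of_mem hy] at herase
    have := Finset.card_pos.2 ⟨y, hy⟩
    omega
  · rw [hout y hy]
    exact Nat.zero_le _

end Degrees

section Families

variable {V : Type*}

variable (V) in
/-- A cycle of the complete graph on `V`, with a base point and an orientation. -/
abbrev RootedCycle := Σ m : ℕ, Fin (m + 3) ↪ V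

variable [DecidableEq V]

/-- The edges covered by a family of cycles, counted with multiplicity. -/
def familyEdges (l : List (RootedCycle V)) : Multiset (Sym2 V) :=
  (l.map fun c => (cycleEdges c.2).val).sum

/-- The vertices covered by a family of cycles. -/
def familyVerts : List (RootedCycle V) → Finset V
  | [] => ∅
  | c :: l => cycleVerts c.2 ∪ familyVerts l

/-- A family of cycles is edge-connected if it cannot be separated into two nonempty subfamilies
such that the cycles of the first one are edge-disjoint from those of the second one. -/
def EdgeConnected (l : List (RootedCycle V)) : Prop :=
  ∀ p : RootedCycle V → Prop,
    (∀ c ∈ l, ∀ d ∈ l, ¬ Disjoint (cycleEdges c.2) (cycleEdges d.2) → (p c ↔ p d)) →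
    ∀ c ∈ l, ∀ d ∈ l, (p c ↔ p d)

@[simp] lemma familyEdges_nil : familyEdges ([] : List (RootedCycle V)) = 0 := rfl

@[simp] lemma familyEdges_cons (c : RootedCycle V) (l : List (RootedCycle V)) :
    familyEdges (c :: l) = (cycleEdges c.2).val + familyEdges l := by
  simp [familyEdges]

lemma toFinset_familyEdges_cons (c : RootedCycle V) (l : List (RootedCycle V)) :
    (familyEdges (c :: l)).toFinset = cycleEdges c.2 ∪ (familyEdges l).toFinset := by
  rw [familyEdges_cons, Multiset.toFinset_add, Finset.val_toFinset]

lemma card_familyEdges (l : List (RootedCycle V)) :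
    Multiset.card (familyEdges l) = (l.map fun c => c.1 + 3).sum := by
  induction l with
  | nil => rfl
  | cons c l ih =>
    rw [familyEdges_cons, Multiset.card_add, Finset.card_val, card_cycleEdges c.2.injective, ih,
      List.map_cons, List.sum_cons]

lemma length_le_card_familyEdges (l : List (RootedCycle V)) :
    l.length ≤ Multiset.card (familyEdges l) := by
  rw [card_familyEdges]
  induction l with
  | nil => rfl
  | cons c l ih => rw [List.length_cons, List.map_cons, List.sum_cons]; omega

lemma mem_familyEdges {l : List (RootedCycle V)} {e : Sym2 V} :
    e ∈ familyEdges l ↔ ∃ c ∈ l, e ∈ cycleEdges c.2 := by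
  induction l with
  | nil => simp
  | cons c l ih => simp [ih]

lemma mem_familyVerts {l : List (RootedCycle V)} {x : V} :
    x ∈ familyVerts l ↔ ∃ c ∈ l, x ∈ cycleVerts c.2 := by
  induction l with
  | nil => simp [familyVerts]
  | cons c l ih => simp [familyVerts, ih]

lemma cycleEdges_subset_familyEdges {l : List (RootedCycle V)} {c : RootedCycle V} (hc : c ∈ l) :
    cycleEdges c.2 ⊆ (familyEdges l).toFinset :=
  fun _ he => Multiset.mem_toFinset.2 (mem_familyEdges.2 ⟨c, hc, he⟩)

lemma mem_familyVerts_of_mem_familyEdges {l : List (RootedCycle V)} {e : Sym2 V}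
    (he : e ∈ (familyEdges l).toFinset) {x : V} (hx : x ∈ e) : x ∈ familyVerts l := by
  obtain ⟨c, hc, he⟩ := mem_familyEdges.1 (Multiset.mem_toFinset.1 he)
  exact mem_familyVerts.2 ⟨c, hc, mem_cycleVerts_of_mem_cycleEdges he hx⟩

lemma not_isDiag_of_mem_familyEdges {l : List (RootedCycle V)} {e : Sym2 V}
    (he : e ∈ (familyEdges l).toFinset) : ¬ e.IsDiag := by
  obtain ⟨c, -, he⟩ := mem_familyEdges.1 (Multiset.mem_toFinset.1 he)
  exact not_isDiag_of_mem_cycleEdges c.2.injective he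

lemma not_disjoint_of_same_first {m m' : ℕ} {a : Fin (m + 3) → V} {b : Fin (m' + 3) → V}
    (h0 : a 0 = b 0) (h1 : a 1 = b 1) : ¬ Disjoint (cycleEdges a) (cycleEdges b) :=
  Finset.not_disjoint_iff.2 ⟨s(a 0, a 1), mem_cycleEdges.2 ⟨0, by rw [zero_add]⟩,
    mem_cycleEdges.2 ⟨0, by rw [zero_add, h0, h1]⟩⟩

lemma edgeConnected_of_pairs {a b c d : RootedCycle V}
    (hab : ¬ Disjoint (cycleEdges a.2) (cycleEdges b.2))
    (hcd : ¬ Disjoint (cycleEdges c.2) (cycleEdges d.2))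
    (h : ¬ Disjoint (cycleEdges a.2 ∪ cycleEdges b.2) (cycleEdges c.2 ∪ cycleEdges d.2)) :
    EdgeConnected [a, b, c, d] := by
  intro p hp
  have pab := hp a (by simp) b (by simp) hab
  have pcd := hp c (by simp) d (by simp) hcd
  have pac : p a ↔ p c := by
    simp only [Finset.disjoint_union_left, Finset.disjoint_union_right, not_and_or] at h
    rcases h with (h | h) | h | h
    · exact hp a (by simp) c (by simp) h
    · exact pab.trans (hp b (by simp) c (by simp) h)
    · exact (hp a (by simp) d (by simp) h).trans pcd.symm
    · exact (pab.trans (hp b (by simp) d (by simp) h)).trans pcd.symm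
  have hall : ∀ e ∈ [a, b, c, d], (p e ↔ p a) := by simp [← pcd, ← pac, ← pab]
  exact fun e he f hf => (hall e he).trans (hall f hf).symm

variable [Fintype V]

/-- The weight of the successive exploration of the cycles of a family. -/
noncomputable def familyWeight : Finset V → Finset (Sym2 V) → List (RootedCycle V) → ℝ
  | _, _, [] => 1
  | U, H, c :: l => walkWeight U H (List.ofFn c.2) *
      familyWeight (U ∪ cycleVerts c.2) (H ∪ cycleEdges c.2) l

lemma familyWeight_nonneg (U : Finset V) (H : Finset (Sym2 V)) (l : List (RootedCycle V)) :
    0 ≤ familyWeight U H l := by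
  induction l generalizing U H with
  | nil => exact zero_le_one
  | cons c l ih => exact mul_nonneg (walkWeight_nonneg _ _ _) (ih _ _)

lemma sum_familyWeight_cons_le {m : ℕ} (U : Finset V) (H : Finset (Sym2 V)) {C : ℝ} (hC : 0 ≤ C)
    {α : Type*} [Fintype α] (l : α → List (RootedCycle V))
    (h : ∀ U H, ∑ x, familyWeight U H (l x) ≤ C) :
    ∑ x : (Fin (m + 3) ↪ V) × α, familyWeight U H (⟨m, x.1⟩ :: l x.2) ≤ 3 ^ (m + 3) * C := by
  calc _ = ∑ a : Fin (m + 3) ↪ V, walkWeight U H (List.ofFn a) *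
          ∑ x, familyWeight (U ∪ cycleVerts a) (H ∪ cycleEdges a) (l x) := by
        simp only [Fintype.sum_prod_type, familyWeight, Finset.mul_sum]
    _ ≤ ∑ a : Fin (m + 3) ↪ V, walkWeight U H (List.ofFn a) * C := by
        gcongr with a
        · exact walkWeight_nonneg _ _ _
        · exact h _ _
    _ ≤ 3 ^ (m + 3) * C := by
        rw [← Finset.sum_mul]
        gcongr
        exact sum_embedding_walkWeight_le _ _ _

lemma potential_le_familyWeight (l : List (RootedCycle V)) {U : Finset V}
    {H H' : Finset (Sym2 V)} {K D : ℝ} (hK : 1 ≤ K) (hD : 1 ≤ D)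
    (hHU : ∀ e ∈ H, ∀ x ∈ e, x ∈ U) (hUK : ((U ∪ familyVerts l).card : ℝ) ≤ K)
    (hH' : H ∪ (familyEdges l).toFinset ⊆ H') (hdeg : ∀ y, ((nbrs H' y).card : ℝ) ≤ D) :
    potential K (U ∪ familyVerts l) (H ∪ (familyEdges l).toFinset) ≤
      K ^ l.length * D ^ Multiset.card (familyEdges l) * familyWeight U H l * potential K U H := by
  induction l generalizing U H with
  | nil => simp [familyVerts, familyWeight]
  | cons c l ih =>
    rw [familyVerts, ← Finset.union_assoc] at hUK ⊢
    rw [toFinset_familyEdges_cons, ← Finset.union_assoc] at hH' ⊢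
    have hHU' : ∀ e ∈ H ∪ cycleEdges c.2, ∀ x ∈ e, x ∈ U ∪ cycleVerts c.2 := by
      intro e he x hx
      rcases Finset.mem_union.1 he with he | he
      · exact Finset.mem_union_left _ (hHU e he x hx)
      · exact Finset.mem_union_right _ (mem_cycleVerts_of_mem_cycleEdges he hx)
    have hstep := potential_le_walkWeight c.2 hK hD hHU (le_trans (by
      exact_mod_cast Finset.card_le_card Finset.subset_union_left) hUK)
      (Finset.subset_union_left.trans hH') hdeg
    have hW := familyWeight_nonneg (U ∪ cycleVerts c.2) (H ∪ cycleEdges c.2) l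
    calc _ ≤ K ^ l.length * D ^ Multiset.card (familyEdges l) *
          familyWeight (U ∪ cycleVerts c.2) (H ∪ cycleEdges c.2) l *
          potential K (U ∪ cycleVerts c.2) (H ∪ cycleEdges c.2) := ih hHU' hUK hH'
      _ ≤ K ^ l.length * D ^ Multiset.card (familyEdges l) *
          familyWeight (U ∪ cycleVerts c.2) (H ∪ cycleEdges c.2) l *
          (K * D ^ (c.1 + 3) * walkWeight U H (List.ofFn c.2) * potential K U H) := by gcongr
      _ = _ := by
          rw [familyWeight, familyEdges_cons, Multiset.card_add, Finset.card_val,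
            card_cycleEdges c.2.injective, List.length_cons]
          ring

lemma two_le_card_nbrs_of_mem_familyVerts {l : List (RootedCycle V)} {y : V}
    (hy : y ∈ familyVerts l) : 2 ≤ (nbrs (familyEdges l).toFinset y).card := by
  obtain ⟨c, hc, hy⟩ := mem_familyVerts.1 hy
  exact two_le_card_nbrs c.2.injective (cycleEdges_subset_familyEdges hc) hy

lemma card_familyVerts_le_and_card_nbrs_le (l : List (RootedCycle V)) :
    (familyVerts l).card ≤ (familyEdges l).toFinset.card ∧
      ∀ y, (nbrs (familyEdges l).toFinset y).card ≤
        2 + 2 * ((familyEdges l).toFinset.card - (familyVerts l).card) :=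
  card_le_and_card_nbrs_le (fun _ => not_isDiag_of_mem_familyEdges)
    (fun _ => two_le_card_nbrs_of_mem_familyVerts)
    fun _ he _ hx => mem_familyVerts_of_mem_familyEdges he hx

lemma EdgeConnected.toFinset_familyEdges_eq {l : List (RootedCycle V)} (h : EdgeConnected l)
    (hdeg : ∀ y, (nbrs (familyEdges l).toFinset y).card ≤ 2) {c : RootedCycle V} (hc : c ∈ l) :
    (∀ d ∈ l, d.1 = c.1) ∧ (familyEdges l).toFinset = cycleEdges c.2 := by
  have hall : ∀ d ∈ l, cycleEdges d.2 = cycleEdges c.2 := fun d hd =>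
    (h (fun d => cycleEdges d.2 = cycleEdges c.2) (fun d₁ h₁ d₂ h₂ h₁₂ => by
      simp only [cycleEdges_eq_of_card_nbrs_le_two d₁.2.injective d₂.2.injective
        (cycleEdges_subset_familyEdges h₁) (cycleEdges_subset_familyEdges h₂) hdeg h₁₂])
      c hc d hd).1 rfl
  refine ⟨fun d hd => ?_, ?_⟩
  · have := congrArg Finset.card (hall d hd)
    rw [card_cycleEdges d.2.injective, card_cycleEdges c.2.injective] at this
    omega
  · ext e
    rw [Multiset.mem_toFinset, mem_familyEdges]
    exact ⟨fun ⟨d, hd, he⟩ => hall d hd ▸ he, fun he => ⟨c, hc, he⟩⟩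

omit [Fintype V] in
lemma EdgeConnected.card_lt_or_card_lt [Finite V] {l : List (RootedCycle V)}
    (h : EdgeConnected l) (hl : 3 ≤ l.length) :
    (familyVerts l).card < (familyEdges l).toFinset.card ∨
      2 * (familyEdges l).toFinset.card < Multiset.card (familyEdges l) := by
  cases nonempty_fintype V
  -- a connected family of maximal degree two repeats a single cycle
  obtain ⟨-, hdeg⟩ := card_familyVerts_le_and_card_nbrs_le l
  by_contra! hcon
  obtain ⟨hv, hE⟩ := hcon
  rw [Nat.sub_eq_zero_of_le hv] at hdeg
  obtain ⟨c, hc⟩ := List.exists_mem_of_length_pos (by omega : 0 < l.length)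
  obtain ⟨hlen, hedges⟩ := h.toFinset_familyEdges_eq hdeg hc
  have hsum : Multiset.card (familyEdges l) = l.length * (c.1 + 3) := by
    rw [card_familyEdges, List.map_congr_left fun d hd => by rw [hlen d hd], List.map_const',
      List.sum_replicate, smul_eq_mul]
  rw [hedges, card_cycleEdges c.2.injective, hsum] at hE
  have := Nat.mul_le_mul_right (c.1 + 3) hl
  omega

lemma two_add_two_mul_pow_le (x L : ℕ) : (2 + 2 * (x : ℝ)) ^ L ≤ 2 ^ L * (2 ^ L) ^ x := by
  have hx : (1 : ℝ) + x ≤ 2 ^ x := by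
    exact_mod_cast (by rw [add_comm]; exact Nat.lt_two_pow_self : 1 + x ≤ 2 ^ x)
  calc (2 + 2 * (x : ℝ)) ^ L = (2 * (1 + x)) ^ L := by ring
    _ ≤ (2 * 2 ^ x) ^ L := by gcongr
    _ = 2 ^ L * (2 ^ L) ^ x := by ring

lemma inv_card_pow_familyVerts_le {l : List (RootedCycle V)} {L : ℕ} (hl : 0 < l.length)
    (hL : L = Multiset.card (familyEdges l))
    (hE : 2 * (familyEdges l).toFinset.card ≤ L) {x : ℕ}
    (hx : (familyEdges l).toFinset.card = (familyVerts l).card + x) :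
    (Fintype.card V : ℝ)⁻¹ ^ (familyVerts l).card ≤
      familyWeight ∅ ∅ l * (L ^ l.length * 2 ^ L) * (L * 2 ^ L) ^ x := by
  have hdeg := (card_familyVerts_le_and_card_nbrs_le l).2
  have hL1 : 1 ≤ L := hL ▸ hl.trans_le (length_le_card_familyEdges l)
  have hL0 : (0 : ℝ) < L := by exact_mod_cast hL1
  have hW := familyWeight_nonneg ∅ ∅ l
  rw [hx, Nat.add_sub_cancel_left] at hdeg
  have hpot := potential_le_familyWeight l (U := ∅) (H := ∅) (K := L) (D := 2 + 2 * (x : ℝ))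
    (by exact_mod_cast hL1) (by linarith [x.cast_nonneg (α := ℝ)]) (by simp)
    (by rw [Finset.empty_union]; exact_mod_cast (by omega)) subset_rfl
    (fun y => by rw [Finset.empty_union]; exact_mod_cast hdeg y)
  rw [Finset.empty_union, Finset.empty_union, ← hL] at hpot
  simp only [potential, Finset.card_empty, pow_zero, mul_one, hx] at hpot
  calc (Fintype.card V : ℝ)⁻¹ ^ (familyVerts l).card
      = (L / Fintype.card V : ℝ) ^ (familyVerts l).card * (L : ℝ)⁻¹ ^ ((familyVerts l).card + x) *
          L ^ x := by
        rw [pow_add, div_eq_mul_inv, mul_pow]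
        have hcancel : (L : ℝ) ^ ((familyVerts l).card + x) * (L : ℝ)⁻¹ ^ ((familyVerts l).card + x)
            = 1 := by rw [← mul_pow, mul_inv_cancel₀ hL0.ne', one_pow]
        linear_combination (-(Fintype.card V : ℝ)⁻¹ ^ (familyVerts l).card) * hcancel
    _ ≤ (L ^ l.length * (2 ^ L * (2 ^ L) ^ x) * familyWeight ∅ ∅ l) * L ^ x := by
        gcongr ?_ * _
        refine hpot.trans ?_
        gcongr
        exact two_add_two_mul_pow_le x L
    _ = familyWeight ∅ ∅ l * (L ^ l.length * 2 ^ L) * (L * 2 ^ L) ^ x := by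
        rw [mul_pow]; ring

/-- The contribution of an edge-connected family is compared with its exploration weight: a
repeated edge loses a factor `w⁻¹`, which is outweighed by the loss of a vertex. -/
lemma EdgeConnected.mul_inv_pow_le {l : List (RootedCycle V)} (h : EdgeConnected l)
    (hl : 3 ≤ l.length) {L : ℕ} (hL : L = Multiset.card (familyEdges l))
    (hE : 2 * (familyEdges l).toFinset.card ≤ L) {w : ℝ} (hw : 0 < w) (hw1 : w ≤ 1)
    (hN : 1 ≤ √(Fintype.card V) * w) (hLn : (L : ℝ) * 2 ^ L ≤ √(Fintype.card V)) :
    (√(Fintype.card V))⁻¹ ^ L * w⁻¹ ^ (L - 2 * (familyEdges l).toFinset.card) ≤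
      familyWeight ∅ ∅ l * (L ^ l.length * 2 ^ L * (√(Fintype.card V) * w)⁻¹) := by
  obtain ⟨x, hx⟩ := Nat.exists_eq_add_of_le (card_familyVerts_le_and_card_nbrs_le l).1
  obtain ⟨y, hy⟩ := Nat.exists_eq_add_of_le hE
  have hxy : 1 ≤ x + y := by rcases h.card_lt_or_card_lt hl with h | h <;> omega
  have hweight := inv_card_pow_familyVerts_le (by omega) hL hE hx
  have hW := familyWeight_nonneg ∅ ∅ l
  rw [show L - 2 * (familyEdges l).toFinset.card = y by omega]
  rw [← Real.sq_sqrt (Fintype.card V).cast_nonneg] at hweight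
  set u := √(Fintype.card V : ℝ)
  set W := familyWeight ∅ ∅ l
  have hu : 0 < u := pos_of_mul_pos_left (zero_lt_one.trans_le hN) hw.le
  have hxu : (L : ℝ) * 2 ^ L * (u ^ 2)⁻¹ ≤ (u * w)⁻¹ := by
    calc (L : ℝ) * 2 ^ L * (u ^ 2)⁻¹ ≤ u * (u ^ 2)⁻¹ := by gcongr
      _ = u⁻¹ := by field_simp
      _ ≤ (u * w)⁻¹ := inv_anti₀ (by positivity) (mul_le_of_le_one_right hu.le hw1)
  calc u⁻¹ ^ L * w⁻¹ ^ y
      = (u ^ 2)⁻¹ ^ (familyVerts l).card * ((u ^ 2)⁻¹ ^ x * (u * w)⁻¹ ^ y) := by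
        rw [hy, hx, pow_add, pow_mul, mul_inv, mul_pow, pow_add, inv_pow u 2]; ring
    _ ≤ W * (L ^ l.length * 2 ^ L) * (L * 2 ^ L) ^ x * ((u ^ 2)⁻¹ ^ x * (u * w)⁻¹ ^ y) := by
        gcongr
    _ = W * (L ^ l.length * 2 ^ L) * ((L * 2 ^ L * (u ^ 2)⁻¹) ^ x * (u * w)⁻¹ ^ y) := by
        rw [mul_pow _ (u ^ 2)⁻¹]; ring
    _ ≤ W * (L ^ l.length * 2 ^ L) * ((u * w)⁻¹ ^ x * (u * w)⁻¹ ^ y) := by gcongr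
    _ ≤ W * (L ^ l.length * 2 ^ L) * (u * w)⁻¹ ^ 1 := by
        rw [← pow_add]
        gcongr ?_ * ?_
        exact pow_le_pow_of_le_one (by positivity) (inv_le_one_of_one_le₀ hN) hxy
    _ = W * (L ^ l.length * 2 ^ L * (u * w)⁻¹) := by ring

end Families

/-! ### Stein's method for characteristic functions -/

section Stein

lemma norm_one_sub_exp_sub_le (u : ℝ) :
    ‖1 - Complex.exp (-(Complex.I * u)) - Complex.I * u‖ ≤ 3 * u ^ 2 := by
  have norm_arg : ‖-(Complex.I * (u : ℂ))‖ = |u| := by simp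
  rcases le_or_gt |u| 1 with hu | hu
  · rw [← norm_neg]
    calc _ = ‖Complex.exp (-(Complex.I * u)) - 1 - -(Complex.I * u)‖ := by ring_nf
      _ ≤ u ^ 2 := by
        simpa only [norm_arg, sq_abs] using
          Complex.norm_exp_sub_one_sub_id_le (norm_arg.trans_le hu)
      _ ≤ 3 * u ^ 2 := by nlinarith [sq_nonneg u]
  · have norm_exp : ‖Complex.exp (-(Complex.I * (u : ℂ)))‖ = 1 := by
      simpa using Complex.norm_exp_I_mul_ofReal (-u)
    calc _ ≤ ‖(1 : ℂ)‖ + ‖Complex.exp (-(Complex.I * u))‖ + ‖Complex.I * (u : ℂ)‖ :=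
          (norm_sub_le _ _).trans (by gcongr; exact norm_sub_le _ _)
      _ = 1 + 1 + |u| := by rw [norm_exp, ← norm_neg (Complex.I * _), norm_arg, norm_one]
      _ ≤ 3 * u ^ 2 := by rw [← sq_abs]; nlinarith

lemma norm_sub_gaussian_le {g g' : ℝ → ℂ} {v ε : ℝ} (hv : 0 ≤ v) (h0 : g 0 = 1)
    (hg : ∀ s, HasDerivAt g (g' s) s)
    (h : ∀ s ∈ Set.Icc (0 : ℝ) 1, ‖g' s + s * v * g s‖ ≤ ε) :
    ‖g 1 - Complex.exp (-v / 2)‖ ≤ ε := by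
  set F : ℝ → ℂ := fun s => Complex.exp ((s ^ 2 * v / 2 : ℝ)) * g s with hF
  have hF' (s : ℝ) : HasDerivAt F (Complex.exp ((s ^ 2 * v / 2 : ℝ)) * (g' s + s * v * g s)) s := by
    have hsq : HasDerivAt (fun s : ℝ => s ^ 2 * v / 2) (s * v) s :=
      (((hasDerivAt_pow 2 s).mul_const v).div_const 2).congr_deriv (by push_cast; ring)
    exact (hsq.ofReal_comp.cexp.mul (hg s)).congr_deriv (by push_cast; ring)
  have hF_sub : ‖F 1 - F 0‖ ≤ Real.exp (v / 2) * ε := by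
    refine norm_image_sub_le_of_norm_deriv_le_segment_01'
      (fun s _ => (hF' s).hasDerivWithinAt) fun s hs => ?_
    rw [norm_mul, Complex.norm_exp_ofReal]
    have hs1 : s ^ 2 ≤ 1 := pow_le_one₀ hs.1 hs.2.le
    gcongr
    · exact mul_le_of_le_one_left hv hs1
    · exact h s ⟨hs.1, hs.2.le⟩
  have hF1 : F 1 = Complex.exp (v / 2 : ℝ) * g 1 := by simp [hF]
  have hF0 : F 0 = 1 := by simp [hF, h0]
  have hexp : Complex.exp (-(v / 2) : ℝ) * Complex.exp (v / 2 : ℝ) = 1 := by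
    rw [← Complex.exp_add]; simp
  calc ‖g 1 - Complex.exp (-v / 2)‖ = ‖Complex.exp (-(v / 2) : ℝ) * (F 1 - F 0)‖ := by
        rw [hF1, hF0, mul_sub, ← mul_assoc, hexp]
        push_cast
        ring_nf
    _ ≤ Real.exp (-(v / 2)) * (Real.exp (v / 2) * ε) := by
        rw [norm_mul, Complex.norm_exp_ofReal]; gcongr
    _ = ε := by rw [← mul_assoc, ← Real.exp_add]; simp

/-- The error made by replacing `f = ∑ x a` with `s v` in the first order expansion of
`exp (i s (f - y a))` around `exp (i s f)`. -/
lemma norm_stein_error_le {A : Type*} [Fintype A] {s : ℝ} (hs : s ∈ Set.Icc (0 : ℝ) 1)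
    (x y : A → ℝ) (v : ℝ) :
    ‖Complex.I * (∑ a, x a : ℝ) * Complex.exp (Complex.I * (s * ∑ a, x a : ℝ))
        + s * v * Complex.exp (Complex.I * (s * ∑ a, x a : ℝ))
        - ∑ a, Complex.I * (x a * Complex.exp (Complex.I * (s * (∑ a, x a - y a) : ℝ)))‖ ≤
      |∑ a, x a * y a - v| + 3 * ∑ a, |x a| * y a ^ 2 := by
  set f := ∑ a, x a with hf
  set E := Complex.exp (Complex.I * (s * f : ℝ)) with hE
  have hE1 : ‖E‖ = 1 := Complex.norm_exp_I_mul_ofReal _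
  let taylor (u : ℝ) : ℂ := 1 - Complex.exp (-(Complex.I * u)) - Complex.I * u
  have expand (a : A) : Complex.I * (x a * Complex.exp (Complex.I * (s * (f - y a) : ℝ))) =
      Complex.I * x a * E + s * (x a * y a : ℝ) * E - Complex.I * x a * E * taylor (s * y a) := by
    have : Complex.exp (Complex.I * (s * (f - y a) : ℝ)) =
        E * Complex.exp (-(Complex.I * (s * y a : ℝ))) := by
      rw [hE, ← Complex.exp_add]; congr 1; push_cast; ring
    rw [this]
    simp only [taylor]
    push_cast
    linear_combination (-(x a * E * s * y a : ℂ)) * Complex.I_sq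
  have taylor_le (a : A) : ‖Complex.I * x a * E * taylor (s * y a)‖ ≤ 3 * (|x a| * y a ^ 2) := by
    rw [norm_mul, norm_mul, norm_mul, hE1, Complex.norm_I, one_mul, mul_one, Complex.norm_real,
      Real.norm_eq_abs]
    calc _ ≤ |x a| * (3 * (s * y a) ^ 2) := by gcongr; exact norm_one_sub_exp_sub_le _
      _ = s ^ 2 * (3 * (|x a| * y a ^ 2)) := by ring
      _ ≤ _ := mul_le_of_le_one_left (by positivity) (pow_le_one₀ hs.1 hs.2)
  calc _ = ‖-(s : ℂ) * ((∑ a, x a * y a - v : ℝ)) * E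
        + ∑ a, Complex.I * x a * E * taylor (s * y a)‖ := by
        simp only [expand, Finset.sum_sub_distrib, Finset.sum_add_distrib, ← Finset.sum_mul,
          ← Finset.mul_sum, ← Complex.ofReal_sum, ← hf]
        push_cast
        ring_nf
    _ ≤ |∑ a, x a * y a - v| + ∑ a, 3 * (|x a| * y a ^ 2) := by
        refine norm_add_le_of_le ?_ (norm_sum_le_of_le _ fun a _ => taylor_le a)
        rw [norm_mul, norm_mul, hE1, mul_one, norm_neg, Complex.norm_real, Complex.norm_real,
          Real.norm_eq_abs, Real.norm_eq_abs, abs_of_nonneg hs.1]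
        exact mul_le_of_le_one_left (abs_nonneg _) hs.2
    _ = _ := by rw [Finset.mul_sum]

variable {Ω : Type*} [MeasurableSpace Ω] {P : Measure Ω}

lemma integral_abs_le_sqrt [IsProbabilityMeasure P] {f : Ω → ℝ} (hf : MemLp f 2 P) :
    ∫ ω, |f ω| ∂P ≤ √(∫ ω, f ω ^ 2 ∂P) := by
  have hvar := variance_nonneg (fun ω => |f ω|) P
  rw [variance_eq_sub (show MemLp (fun ω => |f ω|) 2 P from hf.abs)] at hvar
  simp only [Pi.pow_def, sq_abs] at hvar
  exact Real.le_sqrt_of_sq_le (by linarith)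

lemma integrable_cexp_I_mul [IsFiniteMeasure P] {F : Ω → ℝ} (hF : AEStronglyMeasurable F P) :
    Integrable (fun ω => Complex.exp (Complex.I * (F ω : ℝ))) P :=
  .of_bound (Complex.continuous_exp.comp_aestronglyMeasurable
    (aestronglyMeasurable_const.mul (Complex.continuous_ofReal.comp_aestronglyMeasurable hF))) 1
    (.of_forall fun _ => (Complex.norm_exp_I_mul_ofReal _).le)

lemma integrable_mul_cexp_I_mul {X F : Ω → ℝ} (hX : Integrable X P)
    (hF : AEStronglyMeasurable F P) :
    Integrable (fun ω => (X ω : ℂ) * Complex.exp (Complex.I * (F ω : ℝ))) P :=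
  hX.ofReal.mul_bdd (c := 1) (Complex.continuous_exp.comp_aestronglyMeasurable
    (aestronglyMeasurable_const.mul (Complex.continuous_ofReal.comp_aestronglyMeasurable hF)))
    (.of_forall fun _ => (Complex.norm_exp_I_mul_ofReal _).le)

lemma hasDerivAt_integral_cexp [IsFiniteMeasure P] {F : Ω → ℝ} (hF : Integrable F P) (s : ℝ) :
    HasDerivAt (fun s : ℝ => ∫ ω, Complex.exp (Complex.I * (s * F ω : ℝ)) ∂P)
      (∫ ω, Complex.I * F ω * Complex.exp (Complex.I * (s * F ω : ℝ)) ∂P) s := by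
  refine (hasDerivAt_integral_of_dominated_loc_of_deriv_le 
    (F' := fun s ω => Complex.I * F ω * Complex.exp (Complex.I * (s * F ω : ℝ)))
    (bound := fun ω => ‖F ω‖) Filter.univ_mem
    (.of_forall fun s => (integrable_cexp_I_mul (hF.1.const_mul s)).1)
    (integrable_cexp_I_mul (hF.1.const_mul s)) ?_ (.of_forall fun ω t _ => ?_) hF.norm
    (.of_forall fun ω t _ => ?_)).2
  · simpa only [mul_assoc] using
      ((integrable_mul_cexp_I_mul hF (hF.1.const_mul s)).const_mul Complex.I).1
  · rw [norm_mul, norm_mul, Complex.norm_exp_I_mul_ofReal, Complex.norm_I, Complex.norm_real,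
      one_mul, mul_one]
  · have := ((hasDerivAt_id t).mul_const (F ω)).ofReal_comp.const_mul Complex.I
    exact this.cexp.congr_deriv (by simp; ring)

lemma integral_stein_error_eq {A : Type*} [Fintype A] {X Y : A → Ω → ℝ} {F : Ω → ℝ}
    [IsFiniteMeasure P] (hF : Integrable F P) (hX : ∀ a, Integrable (X a) P)
    (hY : ∀ a, AEStronglyMeasurable (Y a) P) {s : ℝ}
    (hzero : ∀ a, ∫ ω, (X a ω : ℂ) * Complex.exp (Complex.I * (s * (F ω - Y a ω) : ℝ)) ∂P = 0)
    (c : ℂ) :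
    ∫ ω, (Complex.I * F ω * Complex.exp (Complex.I * (s * F ω : ℝ))
        + c * Complex.exp (Complex.I * (s * F ω : ℝ))
        - ∑ a, Complex.I * (X a ω * Complex.exp (Complex.I * (s * (F ω - Y a ω) : ℝ)))) ∂P =
      ∫ ω, Complex.I * F ω * Complex.exp (Complex.I * (s * F ω : ℝ)) ∂P
        + c * ∫ ω, Complex.exp (Complex.I * (s * F ω : ℝ)) ∂P := by
  have hexp := (integrable_cexp_I_mul (hF.1.const_mul s)).const_mul c
  have hF_exp : Integrable
      (fun ω => Complex.I * F ω * Complex.exp (Complex.I * (s * F ω : ℝ))) P := by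
    simpa only [mul_assoc] using
      (integrable_mul_cexp_I_mul hF (hF.1.const_mul s)).const_mul Complex.I
  have hX_exp (a : A) : Integrable
      (fun ω => Complex.I * (X a ω * Complex.exp (Complex.I * (s * (F ω - Y a ω) : ℝ)))) P :=
    (integrable_mul_cexp_I_mul (hX a) ((hF.1.sub (hY a)).const_mul s)).const_mul Complex.I
  have hzero_sum : ∫ ω, ∑ a, Complex.I *
      (X a ω * Complex.exp (Complex.I * (s * (F ω - Y a ω) : ℝ))) ∂P = 0 := by
    rw [integral_finsetSum _ fun a _ => hX_exp a]
    exact Finset.sum_eq_zero fun a _ => by rw [integral_const_mul, hzero, mul_zero]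
  rw [integral_sub (hF_exp.fun_add hexp) (integrable_finsetSum _ fun a _ => hX_exp a), hzero_sum,
    sub_zero, integral_add hF_exp hexp, integral_const_mul]

/-- **Stein's method with local dependence**: `X a` need only be uncorrelated with functions
of the remainder `F - Y a`. -/
lemma norm_integral_cexp_sub_gaussian_le [IsProbabilityMeasure P] {A : Type*} [Fintype A]
    {X Y : A → Ω → ℝ} {F : Ω → ℝ} (hF : ∀ ω, F ω = ∑ a, X a ω) (hX : ∀ a, Integrable (X a) P)
    (hY : ∀ a, AEStronglyMeasurable (Y a) P) (hXY : ∀ a, Integrable (fun ω => X a ω * Y a ω) P)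
    (hXY2 : ∀ a, Integrable (fun ω => |X a ω| * Y a ω ^ 2) P)
    (hzero : ∀ a, ∀ s : ℝ,
      ∫ ω, (X a ω : ℂ) * Complex.exp (Complex.I * (s * (F ω - Y a ω) : ℝ)) ∂P = 0)
    {v : ℝ} (hv : 0 ≤ v) :
    ‖∫ ω, Complex.exp (Complex.I * F ω) ∂P - Complex.exp (-v / 2)‖ ≤
      ∫ ω, |∑ a, X a ω * Y a ω - v| ∂P + 3 * ∑ a, ∫ ω, |X a ω| * Y a ω ^ 2 ∂P := by
  have hF_int : Integrable F P := by
    rw [funext hF]; exact integrable_finsetSum _ fun a _ => hX a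
  have h_var : Integrable (fun ω => |∑ a, X a ω * Y a ω - v|) P :=
    ((integrable_finsetSum _ fun a _ => hXY a).sub (integrable_const v)).abs
  have h_third : Integrable (fun ω => 3 * ∑ a, |X a ω| * Y a ω ^ 2) P :=
    (integrable_finsetSum _ fun a _ => hXY2 a).const_mul 3
  rw [← integral_finsetSum _ fun a _ => hXY2 a, ← integral_const_mul,
    ← integral_add h_var h_third]
  have ode := norm_sub_gaussian_le (v := v) (ε := ∫ ω, (|∑ a, X a ω * Y a ω - v|
    + 3 * ∑ a, |X a ω| * Y a ω ^ 2) ∂P) hv (by simp) (hasDerivAt_integral_cexp hF_int)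
  simp only [one_mul] at ode
  refine ode fun s hs => ?_
  rw [← integral_stein_error_eq hF_int hX hY (hzero · s)]
  refine norm_integral_le_of_norm_le (h_var.fun_add h_third) (.of_forall fun ω => ?_)
  rw [hF]
  exact norm_stein_error_le hs _ _ v

end Stein

/-! ### Moments of independent noise -/

section Monomial

variable {ι Ω : Type*} {X : ι → Ω → ℝ} {ρ : ℝ}

/-- The product of the random variables `X i` over a multiset of indices. -/
def monomial (X : ι → Ω → ℝ) (s : Multiset ι) (ω : Ω) : ℝ := (s.map fun i => X i ω).prod

lemma monomial_add (s t : Multiset ι) (ω : Ω) :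
    monomial X (s + t) ω = monomial X s ω * monomial X t ω := by
  simp [monomial]

variable [DecidableEq ι]

/-- The bound for the expectation of a monomial in noise variables: each variable has to occur
at least twice, and each occurrence beyond the second one costs a factor `ρ⁻¹`. -/
noncomputable def momentBound (ρ : ℝ) (s : Multiset ι) : ℝ :=
  if 2 * s.toFinset.card ≤ s.card then
    2 ^ s.card * ρ⁻¹ ^ (s.card - 2 * s.toFinset.card) else 0

lemma momentBound_nonneg (hρ : 0 < ρ) (s : Multiset ι) : 0 ≤ momentBound ρ s := by
  unfold momentBound; split_ifs <;> positivity

lemma momentBound_mul_le_momentBound_add (hρ : 0 < ρ) (hρ1 : ρ ≤ 1) (s t : Multiset ι) :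
    momentBound ρ s * momentBound ρ t ≤ momentBound ρ (s + t) := by
  by_cases hs : 2 * s.toFinset.card ≤ s.card
  swap
  · rw [momentBound, if_neg hs, zero_mul]
    exact momentBound_nonneg hρ _
  by_cases ht : 2 * t.toFinset.card ≤ t.card
  swap
  · rw [momentBound.eq_def ρ t, if_neg ht, mul_zero]
    exact momentBound_nonneg hρ _
  have hst : (s + t).toFinset.card ≤ s.toFinset.card + t.toFinset.card := by
    rw [Multiset.toFinset_add]; exact Finset.card_union_le _ _
  have hcard := Multiset.card_add s t
  rw [momentBound, momentBound, momentBound, if_pos hs, if_pos ht, if_pos (by lia), hcard]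
  calc _ = 2 ^ (s.card + t.card) *
        ρ⁻¹ ^ ((s.card - 2 * s.toFinset.card) + (t.card - 2 * t.toFinset.card)) := by
        rw [pow_add, pow_add]; ring
    _ ≤ _ := by
        gcongr
        · exact (one_le_inv₀ hρ).2 hρ1
        · lia

end Monomial

section Noise

variable {ι Ω : Type*} [MeasurableSpace Ω] {P : Measure Ω} {X : ι → Ω → ℝ} {ρ ε : ℝ}

/-- Independent centered random variables, bounded by `ρ⁻¹` and of variance within `ε` of one;
standardized edge indicators are of this kind. -/
structure IsNoise (X : ι → Ω → ℝ) (P : Measure Ω) (ρ ε : ℝ) : Prop where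
  indep : iIndepFun X P
  integral_eq_zero : ∀ i, ∫ ω, X i ω ∂P = 0
  abs_apply_le : ∀ i ω, |X i ω| ≤ ρ⁻¹
  abs_integral_sq_sub_one_le : ∀ i, |∫ ω, X i ω ^ 2 ∂P - 1| ≤ ε
  pos : 0 < ρ
  le_one : ρ ≤ 1
  eps_le_one : ε ≤ 1

lemma IsNoise.isProbabilityMeasure (h : IsNoise X P ρ ε) : IsProbabilityMeasure P :=
  h.indep.isProbabilityMeasure

lemma IsNoise.eps_nonneg (h : IsNoise X P ρ ε) (i : ι) : 0 ≤ ε :=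
  (abs_nonneg _).trans (h.abs_integral_sq_sub_one_le i)

lemma IsNoise.abs_integral_sq_le (h : IsNoise X P ρ ε) (i : ι) : |∫ ω, X i ω ^ 2 ∂P| ≤ 2 := by
  have hvar := abs_le.1 (h.abs_integral_sq_sub_one_le i)
  have hε := h.eps_le_one
  exact abs_le.2 ⟨by linarith, by linarith⟩

variable [Finite Ω] [MeasurableSingletonClass Ω]

lemma integral_finset_prod_comp (hX : iIndepFun X P) (s : Finset ι) {f : ι → ℝ → ℝ}
    (hf : ∀ i, Measurable (f i)) :
    ∫ ω, ∏ i ∈ s, f i (X i ω) ∂P = ∏ i ∈ s, ∫ ω, f i (X i ω) ∂P := by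
  have hs : iIndepFun (fun i : s => X i) P := hX.precomp Subtype.val_injective
  have := hs.integral_fun_prod_comp (f := fun i : s => f i)
    (fun i => (measurable_of_finite _).aemeasurable) fun i => (hf i).aestronglyMeasurable
  simpa only [Finset.prod_coe_sort s fun i => ∫ ω, f i (X i ω) ∂P,
    fun ω => Finset.prod_coe_sort s fun i => f i (X i ω)] using this

namespace IsNoise

lemma abs_integral_pow_le (h : IsNoise X P ρ ε) (i : ι) (k : ℕ) :
    |∫ ω, X i ω ^ (k + 2) ∂P| ≤ 2 * ρ⁻¹ ^ k := by
  have := h.isProbabilityMeasure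
  have hρ := h.pos
  calc |∫ ω, X i ω ^ (k + 2) ∂P| ≤ ∫ ω, ρ⁻¹ ^ k * X i ω ^ 2 ∂P := by
        refine abs_integral_le_integral_abs.trans (integral_mono .of_finite .of_finite fun ω => ?_)
        rw [pow_add, abs_mul, abs_pow, abs_pow, sq_abs]
        gcongr
        exact h.abs_apply_le i ω
    _ = ρ⁻¹ ^ k * ∫ ω, X i ω ^ 2 ∂P := integral_const_mul _ _
    _ ≤ 2 * ρ⁻¹ ^ k := by
        rw [mul_comm 2]
        gcongr
        exact (le_abs_self _).trans (h.abs_integral_sq_le i)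

lemma integral_prod_sq (h : IsNoise X P ρ ε) (s : Finset ι) :
    ∫ ω, (∏ i ∈ s, X i ω) ^ 2 ∂P = ∏ i ∈ s, ∫ ω, X i ω ^ 2 ∂P := by
  simp only [← Finset.prod_pow]
  exact integral_finset_prod_comp h.indep s (f := fun _ x => x ^ 2) fun _ => by fun_prop

lemma integral_mul_eq_zero [Finite ι] (h : IsNoise X P ρ ε) (i : ι) {g : (ι → ℝ) → ℂ}
    (hg : Measurable g) (hgi : ∀ x y, (∀ j ≠ i, x j = y j) → g x = g y) :
    ∫ ω, (X i ω : ℂ) * g (fun j => X j ω) ∂P = 0 := by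
  have := Fintype.ofFinite ι
  classical
  let extend (y : Finset.univ.erase i → ℝ) (j : ι) : ℝ :=
    if hj : j ∈ Finset.univ.erase i then y ⟨j, hj⟩ else 0
  have hextend : Measurable extend := measurable_pi_lambda _ fun j => by
    by_cases hj : j ∈ Finset.univ.erase i <;> simp only [extend, hj, dite_true, dite_false] <;>
      fun_prop
  have hg_extend (ω : Ω) : g (fun j => X j ω) = g (extend fun j => X j ω) :=
    hgi _ _ fun j hj => by simp [extend, hj]
  have hindep := h.indep.indepFun_finset {i} (Finset.univ.erase i) (by simp)
    fun j => measurable_of_finite _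
  have key := hindep.integral_fun_comp_mul_comp
    (f := fun x => (x ⟨i, Finset.mem_singleton_self i⟩ : ℂ)) (g := g ∘ extend)
    (measurable_of_finite _).aemeasurable (measurable_of_finite _).aemeasurable
    (Complex.measurable_ofReal.comp (measurable_pi_apply _)).aestronglyMeasurable
    (hg.comp hextend).aestronglyMeasurable
  simp only [hg_extend]
  rw [show ∫ ω, (X i ω : ℂ) * g (extend fun j => X j ω) ∂P = _ from key,
    integral_complex_ofReal, h.integral_eq_zero, Complex.ofReal_zero, zero_mul]

end IsNoise

lemma cov_monomial [IsProbabilityMeasure P] (s t : Multiset ι) :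
    cov[monomial X s, monomial X t; P] =
      ∫ ω, monomial X (s + t) ω ∂P - (∫ ω, monomial X s ω ∂P) * ∫ ω, monomial X t ω ∂P := by
  rw [covariance_eq_sub .of_discrete .of_discrete]
  simp only [monomial_add, Pi.mul_apply]

variable [DecidableEq ι]

lemma integral_monomial (hX : iIndepFun X P) (s : Multiset ι) :
    ∫ ω, monomial X s ω ∂P = ∏ i ∈ s.toFinset, ∫ ω, X i ω ^ s.count i ∂P := by
  simp only [monomial, Finset.prod_multiset_map_count]
  exact integral_finset_prod_comp hX _ (f := fun i x => x ^ s.count i) fun i => by fun_prop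

lemma cov_monomial_eq_zero (hX : iIndepFun X P) {s t : Multiset ι}
    (hst : Disjoint s.toFinset t.toFinset) : cov[monomial X s, monomial X t; P] = 0 := by
  have := hX.isProbabilityMeasure
  rw [Finset.disjoint_left] at hst
  rw [cov_monomial, sub_eq_zero, integral_monomial hX, integral_monomial hX, integral_monomial hX,
    Multiset.toFinset_add, Finset.prod_union (Finset.disjoint_left.2 hst)]
  congr 1
  · refine Finset.prod_congr rfl fun i hi => ?_
    have := Multiset.count_eq_zero.2 (mt Multiset.mem_toFinset.2 (hst hi))
    rw [Multiset.count_add, this, add_zero]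
  · refine Finset.prod_congr rfl fun i hi => ?_
    have := Multiset.count_eq_zero.2 (mt Multiset.mem_toFinset.2 fun hs => hst hs hi)
    rw [Multiset.count_add, this, zero_add]

namespace IsNoise

lemma integral_monomial_eq_zero (h : IsNoise X P ρ ε) {s : Multiset ι} {i : ι}
    (hi : s.count i = 1) : ∫ ω, monomial X s ω ∂P = 0 := by
  rw [integral_monomial h.indep]
  refine Finset.prod_eq_zero (i := i) ?_ (by simpa only [hi, pow_one] using h.integral_eq_zero i)
  exact Multiset.mem_toFinset.2 (Multiset.count_pos.1 (by lia))

lemma abs_integral_monomial_le (h : IsNoise X P ρ ε) (s : Multiset ι) :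
    |∫ ω, monomial X s ω ∂P| ≤ momentBound ρ s := by
  by_cases hs : ∃ i, s.count i = 1
  · obtain ⟨i, hi⟩ := hs
    rw [h.integral_monomial_eq_zero hi, abs_zero]
    exact momentBound_nonneg h.pos s
  push Not at hs
  have two_le : ∀ i ∈ s.toFinset, 2 ≤ s.count i := fun i hi => by
    have := Multiset.count_pos.2 (Multiset.mem_toFinset.1 hi)
    have := hs i
    lia
  have sum_sub : ∑ i ∈ s.toFinset, (s.count i - 2) + 2 * s.toFinset.card = s.card := by
    rw [mul_comm, ← smul_eq_mul, ← Finset.sum_const, ← Finset.sum_add_distrib,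
      ← Multiset.toFinset_sum_count_eq]
    exact Finset.sum_congr rfl fun i hi => Nat.sub_add_cancel (two_le i hi)
  have hρ : 1 ≤ ρ⁻¹ := (one_le_inv₀ h.pos).2 h.le_one
  rw [integral_monomial h.indep, momentBound, if_pos (by lia), Finset.abs_prod]
  calc _ ≤ ∏ i ∈ s.toFinset, (2 * ρ⁻¹ ^ (s.count i - 2)) :=
        Finset.prod_le_prod (fun _ _ => abs_nonneg _) fun i hi => by
          simpa only [Nat.sub_add_cancel (two_le i hi)] using
            h.abs_integral_pow_le i (s.count i - 2)
    _ = 2 ^ s.toFinset.card * ρ⁻¹ ^ (s.card - 2 * s.toFinset.card) := by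
        rw [Finset.prod_mul_distrib, Finset.prod_const, Finset.prod_pow_eq_pow_sum, ← sum_sub,
          Nat.add_sub_cancel]
    _ ≤ 2 ^ s.card * ρ⁻¹ ^ (s.card - 2 * s.toFinset.card) := by
        gcongr
        · norm_num
        · exact Multiset.toFinset_card_le s

lemma abs_cov_monomial_le (h : IsNoise X P ρ ε) (s t : Multiset ι) :
    |cov[monomial X s, monomial X t; P]| ≤ 2 * momentBound ρ (s + t) := by
  have := h.isProbabilityMeasure
  rw [cov_monomial]
  calc _ ≤ |∫ ω, monomial X (s + t) ω ∂P| +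
        |∫ ω, monomial X s ω ∂P| * |∫ ω, monomial X t ω ∂P| := by
        rw [← abs_mul]; exact abs_sub _ _
    _ ≤ momentBound ρ (s + t) + momentBound ρ s * momentBound ρ t := by
        gcongr
        · exact h.abs_integral_monomial_le _
        · exact momentBound_nonneg h.pos _
        · exact h.abs_integral_monomial_le _
        · exact h.abs_integral_monomial_le _
    _ ≤ _ := by
        have := momentBound_mul_le_momentBound_add h.pos h.le_one s t
        linarith

omit [DecidableEq ι] in
lemma integral_prod_mul_prod_eq_zero (h : IsNoise X P ρ ε) {s t : Finset ι} (hst : s ≠ t) :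
    ∫ ω, (∏ i ∈ s, X i ω) * ∏ i ∈ t, X i ω ∂P = 0 := by
  classical
  obtain ⟨i, hi⟩ := Finset.symmDiff_nonempty.2 hst
  have hcount : (s.val + t.val).count i = 1 := by
    rw [Multiset.count_add, Multiset.count_eq_of_nodup s.nodup, Multiset.count_eq_of_nodup t.nodup]
    rcases Finset.mem_symmDiff.1 hi with ⟨hs, ht⟩ | ⟨ht, hs⟩ <;> simp [hs, ht]
  simpa only [monomial_add] using! h.integral_monomial_eq_zero hcount

end IsNoise

end Noise

/-! ### Normalized cycle sums -/

section FiberSums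

variable {α β κ : Type*} [DecidableEq κ]

lemma sum_fiber_mul_sum_fiber (s : Finset α) (t : Finset β) (π : α → κ) (π' : β → κ) (k : κ)
    (f : α → ℝ) (g : β → ℝ) :
    (∑ a ∈ s with π a = k, f a) * ∑ b ∈ t with π' b = k, g b =
      ∑ x ∈ {x ∈ s ×ˢ t | π x.1 = π' x.2} with π x.1 = k, f x.1 * g x.2 := by
  rw [Finset.sum_mul_sum, ← Finset.sum_product', ← Finset.filter_product, Finset.filter_filter]
  congr 1
  refine Finset.filter_congr fun x _ => ?_
  constructor
  · rintro ⟨h, h'⟩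
    exact ⟨h.trans h'.symm, h⟩
  · rintro ⟨h, h'⟩
    exact ⟨h', h.symm.trans h'⟩

lemma sum_sum_fiber_mul_sum_fiber [Fintype κ] (s : Finset α) (t : Finset β) (π : α → κ)
    (π' : β → κ) (f : α → ℝ) (g : β → ℝ) :
    ∑ k, (∑ a ∈ s with π a = k, f a) * ∑ b ∈ t with π' b = k, g b =
      ∑ x ∈ s ×ˢ t with π x.1 = π' x.2, f x.1 * g x.2 := by
  simp only [sum_fiber_mul_sum_fiber]
  exact Finset.sum_fiberwise _ (fun x : α × β => π x.1) fun x => f x.1 * g x.2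

end FiberSums

section CycleSum

variable {V : Type*} {m m' : ℕ}

variable (V) in
/-- The pairs of rooted cycles of lengths `m + 3` and `m' + 3`. -/
abbrev CyclePair (m m' : ℕ) : Type _ := (Fin (m + 3) ↪ V) × (Fin (m' + 3) ↪ V)

/-- The product of the edge weights `x` along the closed walk through `a`. -/
def cycleProd (a : Fin (m + 3) → V) (x : Sym2 V → ℝ) : ℝ := ∏ j, x (cycleEdge a j)

lemma cycleProd_rotate (a : Fin (m + 3) → V) (r : Fin (m + 3)) (x : Sym2 V → ℝ) :
    cycleProd (fun j => a (j + r)) x = cycleProd a x :=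
  Fintype.prod_equiv (Equiv.addRight r) _ _ fun j => by
    simp only [cycleEdge, Equiv.coe_addRight, add_right_comm]

lemma cycleProd_reflect (a : Fin (m + 3) → V) (r : Fin (m + 3)) (x : Sym2 V → ℝ) :
    cycleProd (fun j => a (r + 1 - j)) x = cycleProd a x :=
  Fintype.prod_equiv (Equiv.subLeft r) _ _ fun j => by
    simp only [cycleEdge, Equiv.subLeft_apply, Sym2.eq_swap (a := a (r + 1 - j)),
      add_sub_add_right_eq_sub, sub_add_eq_add_sub]

variable [DecidableEq V]

lemma cycleProd_eq_prod_cycleEdges (a : Fin (m + 3) ↪ V) (x : Sym2 V → ℝ) :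
    cycleProd a x = ∏ e ∈ cycleEdges a, x e := by
  rw [cycleProd, cycleEdges, Finset.prod_image fun _ _ _ _ h => cycleEdge_injective a.injective h]

lemma cycleProd_eq_monomial {Ω : Type*} (X : Sym2 V → Ω → ℝ) (a : Fin (m + 3) ↪ V) (ω : Ω) :
    cycleProd a (X · ω) = monomial X (cycleEdges a).val ω :=
  cycleProd_eq_prod_cycleEdges a _

lemma cycleProd_congr {a : Fin (m + 3) → V} {e : Sym2 V} (he : e ∉ cycleEdges a)
    {x y : Sym2 V → ℝ} (hxy : ∀ e' ≠ e, x e' = y e') : cycleProd a x = cycleProd a y :=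
  Finset.prod_congr rfl fun j _ => hxy _ fun hj =>
    he (hj ▸ mem_cycleEdges.2 ⟨j, rfl⟩)

lemma ite_mem_cycleEdges (a : Fin (m + 3) ↪ V) (p : V × V) (c : ℝ) :
    (if s(p.1, p.2) ∈ cycleEdges a then c else 0) =
      ∑ r, ((if (a r, a (r + 1)) = p then c else 0) +
        if (a (r + 1), a r) = p then c else 0) := by
  obtain ⟨u, v⟩ := p
  simp only [Prod.mk.injEq]
  by_cases h : s(u, v) ∈ cycleEdges a
  · obtain ⟨r, hr⟩ := mem_cycleEdges.1 h
    have unique (r' : Fin (m + 3)) (hr' : s(a r', a (r' + 1)) = s(u, v)) : r' = r :=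
      cycleEdge_injective a.injective (hr'.trans hr.symm)
    have hne : a r ≠ a (r + 1) := fun h => by simp at h
    rw [if_pos h, Finset.sum_eq_single r]
    · rcases Sym2.eq_iff.1 hr with ⟨rfl, rfl⟩ | ⟨rfl, rfl⟩ <;> simp [hne, hne.symm]
    · intro r' _ hr'
      rw [if_neg, if_neg, add_zero]
      · rintro ⟨rfl, rfl⟩
        exact hr' (unique r' Sym2.eq_swap)
      · rintro ⟨rfl, rfl⟩
        exact hr' (unique r' rfl)
    · simp
  · rw [if_neg h, eq_comm]
    refine Finset.sum_eq_zero fun r _ => ?_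
    rw [if_neg, if_neg, add_zero]
    · rintro ⟨rfl, rfl⟩
      exact h (mem_cycleEdges.2 ⟨r, Sym2.eq_swap⟩)
    · rintro ⟨rfl, rfl⟩
      exact h (mem_cycleEdges.2 ⟨r, rfl⟩)

variable [Fintype V]

/-- The normalized sum over all rooted oriented cycles of the products of the edge weights. -/
noncomputable def cycleSum (m : ℕ) (x : Sym2 V → ℝ) : ℝ :=
  (√(Fintype.card V))⁻¹ ^ (m + 3) * ∑ a : Fin (m + 3) ↪ V, cycleProd a x

/-- The part of `cycleSum` given by the cycles whose first step is `p.1 → p.2`. -/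
noncomputable def cycleSumAt (m : ℕ) (p : V × V) (x : Sym2 V → ℝ) : ℝ :=
  (√(Fintype.card V))⁻¹ ^ (m + 3) * ∑ a : Fin (m + 3) ↪ V with (a 0, a 1) = p, cycleProd a x

lemma sum_cycleSumAt (m : ℕ) (x : Sym2 V → ℝ) : ∑ p, cycleSumAt m p x = cycleSum m x := by
  simp only [cycleSumAt, ← Finset.mul_sum, cycleSum]
  rw [Finset.sum_fiberwise _ (fun a : Fin (m + 3) ↪ V => (a 0, a 1)) fun a => cycleProd a x]

lemma sum_cycleProd_step_eq (r : Fin (m + 3)) (p : V × V) (x : Sym2 V → ℝ) :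
    ∑ a : Fin (m + 3) ↪ V with (a r, a (r + 1)) = p, cycleProd a x =
      ∑ a : Fin (m + 3) ↪ V with (a 0, a 1) = p, cycleProd a x := by
  refine Finset.sum_equiv (Equiv.embeddingCongr (Equiv.addRight r).symm (Equiv.refl V))
    (fun a => ?_) fun a _ => ?_
  · simp [Equiv.embeddingCongr, add_comm 1 r]
  · rw [← cycleProd_rotate a r]
    congr 1

lemma sum_cycleProd_step_swap_eq (r : Fin (m + 3)) (p : V × V) (x : Sym2 V → ℝ) :
    ∑ a : Fin (m + 3) ↪ V with (a (r + 1), a r) = p, cycleProd a x =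
      ∑ a : Fin (m + 3) ↪ V with (a 0, a 1) = p, cycleProd a x := by
  refine Finset.sum_equiv (Equiv.embeddingCongr (Equiv.subLeft (r + 1)).symm (Equiv.refl V))
    (fun a => ?_) fun a _ => ?_
  · simp [Equiv.embeddingCongr]
  · rw [← cycleProd_reflect a r]
    congr 1

lemma sum_cycleProd_through_eq (m : ℕ) (p : V × V) (x : Sym2 V → ℝ) :
    (√(Fintype.card V))⁻¹ ^ (m + 3) *
      ∑ a ∈ ({a | s(p.1, p.2) ∈ cycleEdges a} : Finset (Fin (m + 3) ↪ V)), cycleProd a x =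
      2 * (m + 3 : ℕ) * cycleSumAt m p x := by
  simp only [Finset.sum_filter, ite_mem_cycleEdges]
  rw [Finset.sum_comm]
  simp only [Finset.sum_add_distrib, ← Finset.sum_filter, sum_cycleProd_step_eq,
    sum_cycleProd_step_swap_eq, Finset.sum_const, Finset.card_univ, Fintype.card_fin, nsmul_eq_mul,
    cycleSumAt]
  ring

/-- `2 (m + 3)` is the number of roots and orientations of a cycle: removing that multiple of
`cycleSumAt m p` removes all the cycles through the edge. -/
lemma cycleSum_sub_cycleSumAt_congr (m : ℕ) (p : V × V) {x y : Sym2 V → ℝ}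
    (hxy : ∀ e ≠ s(p.1, p.2), x e = y e) :
    cycleSum m x - 2 * (m + 3 : ℕ) * cycleSumAt m p x =
      cycleSum m y - 2 * (m + 3 : ℕ) * cycleSumAt m p y := by
  have cycleSum_sub (z : Sym2 V → ℝ) : cycleSum m z - 2 * (m + 3 : ℕ) * cycleSumAt m p z =
      (√(Fintype.card V))⁻¹ ^ (m + 3) *
        ∑ a ∈ ({a | s(p.1, p.2) ∉ cycleEdges a} : Finset (Fin (m + 3) ↪ V)), cycleProd a z := by
    rw [← sum_cycleProd_through_eq, cycleSum, ← mul_sub, sub_eq_iff_eq_add'.2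
      (Finset.sum_filter_add_sum_filter_not _ _ _).symm]
  rw [cycleSum_sub, cycleSum_sub]
  congr 1
  exact Finset.sum_congr rfl fun a ha => cycleProd_congr (Finset.mem_filter.1 ha).2 hxy

lemma exists_cycleSumAt_eq_mul (m : ℕ) (p : V × V) : ∃ g : (Sym2 V → ℝ) → ℝ, Measurable g ∧
    (∀ x y, (∀ e ≠ s(p.1, p.2), x e = y e) → g x = g y) ∧
    ∀ x, cycleSumAt m p x = x s(p.1, p.2) * g x := by
  refine ⟨fun x => (√(Fintype.card V))⁻¹ ^ (m + 3) * ∑ a : Fin (m + 3) ↪ V with (a 0, a 1) = p,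
      ∏ e ∈ (cycleEdges a).erase s(p.1, p.2), x e, by fun_prop, fun x y hxy => ?_, fun x => ?_⟩
  · refine congrArg _ ?_
    exact Finset.sum_congr rfl fun a _ => Finset.prod_congr rfl fun e he =>
      hxy e (Finset.ne_of_mem_erase he)
  · rw [cycleSumAt, mul_left_comm, Finset.mul_sum (a := x s(p.1, p.2))]
    refine congrArg _ ?_
    refine Finset.sum_congr rfl fun a ha => ?_
    have he : s(p.1, p.2) ∈ cycleEdges a := by
      rw [← (Finset.mem_filter.1 ha).2]
      exact mem_cycleEdges.2 ⟨0, by simp⟩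
    rw [cycleProd_eq_prod_cycleEdges, Finset.mul_prod_erase _ _ he]

/-- The overlap of two normalized cycle sums; it is the covariation term in Stein's method. -/
noncomputable def overlap (m m' : ℕ) (x : Sym2 V → ℝ) : ℝ :=
  ∑ p, cycleSumAt m p x * cycleSumAt m' p x

variable (V) in
/-- The pairs of cycles with a common first step. -/
noncomputable def stepPairs (m m' : ℕ) : Finset (CyclePair V m m') :=
  {q | (q.1 0, q.1 1) = (q.2 0, q.2 1)}

lemma mem_stepPairs {q : CyclePair V m m'} :
    q ∈ stepPairs V m m' ↔ q.1 0 = q.2 0 ∧ q.1 1 = q.2 1 := by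
  simp [stepPairs]

lemma overlap_eq (m m' : ℕ) (x : Sym2 V → ℝ) :
    overlap m m' x = (√(Fintype.card V))⁻¹ ^ ((m + 3) + (m' + 3)) *
      ∑ q ∈ stepPairs V m m', cycleProd q.1 x * cycleProd q.2 x := by
  simp only [overlap, cycleSumAt, mul_mul_mul_comm _ (∑ _ with _, _) (_ ^ _), ← pow_add,
    ← Finset.mul_sum, sum_sum_fiber_mul_sum_fiber, Finset.univ_product_univ, stepPairs]

lemma sum_cycleSumAt_pow_four (m : ℕ) (x : Sym2 V → ℝ) :
    ∑ p, cycleSumAt m p x ^ 4 = (√(Fintype.card V))⁻¹ ^ (4 * (m + 3)) *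
      ∑ q ∈ stepPairs V m m ×ˢ stepPairs V m m with (q.1.1 0, q.1.1 1) = (q.2.1 0, q.2.1 1),
        (cycleProd q.1.1 x * cycleProd q.1.2 x) * (cycleProd q.2.1 x * cycleProd q.2.2 x) := by
  have fiber_pow_four (p : V × V) :
      (∑ a : Fin (m + 3) ↪ V with (a 0, a 1) = p, cycleProd a x) ^ 4 =
        (∑ q ∈ stepPairs V m m with (q.1 0, q.1 1) = p, cycleProd q.1 x * cycleProd q.2 x) *
          ∑ q ∈ stepPairs V m m with (q.1 0, q.1 1) = p, cycleProd q.1 x * cycleProd q.2 x := by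
    rw [pow_succ, pow_succ, pow_two, mul_assoc, sum_fiber_mul_sum_fiber,
      Finset.univ_product_univ, stepPairs]
  simp only [cycleSumAt, mul_pow, fiber_pow_four, ← Finset.mul_sum, sum_sum_fiber_mul_sum_fiber,
    ← pow_mul, mul_comm 4]

end CycleSum

section Quadruples

variable {V : Type*} [DecidableEq V] {m₁ m₂ m₃ m₄ K : ℕ} {ρ : ℝ}

/-- The family of the four cycles of a pair of pairs of cycles. -/
abbrev quadFamily (q : CyclePair V m₁ m₂ × CyclePair V m₃ m₄) : List (RootedCycle V) :=
  [⟨m₁, q.1.1⟩, ⟨m₂, q.1.2⟩, ⟨m₃, q.2.1⟩, ⟨m₄, q.2.2⟩]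

/-- The edges of a pair of cycles, with multiplicity. -/
def pairEdges (q : CyclePair V m₁ m₂) : Multiset (Sym2 V) :=
  (cycleEdges q.1).val + (cycleEdges q.2).val

lemma familyEdges_quadFamily (q : CyclePair V m₁ m₂ × CyclePair V m₃ m₄) :
    familyEdges (quadFamily q) = pairEdges q.1 + pairEdges q.2 := by
  simp [pairEdges, add_assoc]

variable [Fintype V]

lemma EdgeConnected.momentBound_le {l : List (RootedCycle V)} (h : EdgeConnected l)
    (hl : 3 ≤ l.length) (hK : K = (familyEdges l).card) (hρ : 0 < ρ) (hρ1 : ρ ≤ 1)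
    (hN : 1 ≤ √(Fintype.card V) * ρ) (hKn : (K : ℝ) * 2 ^ K ≤ √(Fintype.card V)) :
    (√(Fintype.card V))⁻¹ ^ K * momentBound ρ (familyEdges l) ≤
      familyWeight ∅ ∅ l * (4 ^ K * K ^ l.length * (√(Fintype.card V) * ρ)⁻¹) := by
  have hW := familyWeight_nonneg ∅ ∅ l
  rw [momentBound, ← hK]
  split_ifs with hE
  · calc _ = 2 ^ K * ((√(Fintype.card V))⁻¹ ^ K *
          ρ⁻¹ ^ (K - 2 * (familyEdges l).toFinset.card)) := by ring
      _ ≤ 2 ^ K * (familyWeight ∅ ∅ l * (K ^ l.length * 2 ^ K * (√(Fintype.card V) * ρ)⁻¹)) := by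
        exact mul_le_mul_of_nonneg_left (h.mul_inv_pow_le hl hK hE hρ hρ1 hN hKn) (by positivity)
      _ = _ := by
        rw [show (4 : ℝ) = 2 * 2 by norm_num, mul_pow]; ring
  · rw [mul_zero]
    positivity

lemma sum_familyWeight_quadFamily_le (hK : K = (m₁ + 3) + (m₂ + 3) + (m₃ + 3) + (m₄ + 3)) :
    ∑ q : CyclePair V m₁ m₂ × CyclePair V m₃ m₄, familyWeight ∅ ∅ (quadFamily q) ≤ 3 ^ K := by
  have single (U : Finset V) (H : Finset (Sym2 V)) :=
    sum_familyWeight_cons_le (m := m₄) U H zero_le_one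
      (fun _ : Unit => []) (by simp [familyWeight])
  have pair (U : Finset V) (H : Finset (Sym2 V)) :=
    sum_familyWeight_cons_le (m := m₃) U H (by positivity)
      (fun x : (Fin (m₄ + 3) ↪ V) × Unit => [⟨m₄, x.1⟩]) single
  have triple (U : Finset V) (H : Finset (Sym2 V)) :=
    sum_familyWeight_cons_le (m := m₂) U H (by positivity)
      (fun x : (Fin (m₃ + 3) ↪ V) × (Fin (m₄ + 3) ↪ V) × Unit => [⟨m₃, x.1⟩, ⟨m₄, x.2.1⟩]) pair
  have quadruple := sum_familyWeight_cons_le (m := m₁) ∅ ∅ (by positivity)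
    (fun x : (Fin (m₂ + 3) ↪ V) × (Fin (m₃ + 3) ↪ V) × (Fin (m₄ + 3) ↪ V) × Unit =>
      [⟨m₂, x.1⟩, ⟨m₃, x.2.1⟩, ⟨m₄, x.2.2.1⟩]) triple
  simp only [Fintype.sum_prod_type, Finset.univ_unique, Finset.sum_singleton] at quadruple ⊢
  refine quadruple.trans_eq ?_
  rw [hK]
  ring

variable (V) in
/-- The bound on the contribution of the edge-connected quadruples of cycles of total length `K`
to the second order statistics of the normalized cycle sums. -/
noncomputable def quadBound (ρ : ℝ) (K : ℕ) : ℝ :=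
  12 ^ K * K ^ 4 * (√(Fintype.card V) * ρ)⁻¹

lemma sum_momentBound_quadFamily_le (hK : K = (m₁ + 3) + (m₂ + 3) + (m₃ + 3) + (m₄ + 3))
    (hρ : 0 < ρ) (hρ1 : ρ ≤ 1) (hN : 1 ≤ √(Fintype.card V) * ρ)
    (hKn : (K : ℝ) * 2 ^ K ≤ √(Fintype.card V))
    {S : Finset (CyclePair V m₁ m₂ × CyclePair V m₃ m₄)}
    (hS : ∀ q ∈ S, EdgeConnected (quadFamily q)) :
    (√(Fintype.card V))⁻¹ ^ K * ∑ q ∈ S, momentBound ρ (pairEdges q.1 + pairEdges q.2) ≤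
      quadBound V ρ K := by
  have hcard (q : CyclePair V m₁ m₂ × CyclePair V m₃ m₄) :
      K = (familyEdges (quadFamily q)).card := by
    rw [card_familyEdges, hK]
    simp [add_assoc]
  calc _ = ∑ q ∈ S, (√(Fintype.card V))⁻¹ ^ K *
          momentBound ρ (familyEdges (quadFamily q)) := by
        simp only [Finset.mul_sum, familyEdges_quadFamily]
    _ ≤ ∑ q ∈ S, familyWeight ∅ ∅ (quadFamily q) *
        (4 ^ K * K ^ 4 * (√(Fintype.card V) * ρ)⁻¹) := by
        exact Finset.sum_le_sum fun q hq =>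
          (hS q hq).momentBound_le (by simp) (hcard q) hρ hρ1 hN hKn
    _ ≤ 3 ^ K * (4 ^ K * K ^ 4 * (√(Fintype.card V) * ρ)⁻¹) := by
        rw [← Finset.sum_mul]
        gcongr
        exact (Finset.sum_le_univ_sum_of_nonneg fun q => familyWeight_nonneg _ _ _).trans
          (sum_familyWeight_quadFamily_le hK)
    _ = quadBound V ρ K := by
        rw [quadBound, show (12 : ℝ) = 3 * 4 by norm_num, mul_pow]; ring

end Quadruples

lemma one_sub_le_descFactorial_div {n : ℕ} (k : ℕ) (hn : 0 < n) :
    1 - (k : ℝ) ^ 2 / n ≤ (n.descFactorial k : ℝ) / n ^ k := by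
  have hn' : (0 : ℝ) < n := by exact_mod_cast hn
  induction k with
  | zero => simp
  | succ k ih =>
    have ratio_le_one : (n.descFactorial k : ℝ) / n ^ k ≤ 1 := by
      rw [div_le_one (by positivity)]
      exact_mod_cast Nat.descFactorial_le_pow n k
    have le_factor : 1 - (k : ℝ) / n ≤ ((n - k : ℕ) : ℝ) / n := by
      rw [← div_self hn'.ne', ← sub_div]
      gcongr
      rw [sub_le_iff_le_add]
      exact_mod_cast (by lia : n ≤ n - k + k)
    calc 1 - ((k + 1 : ℕ) : ℝ) ^ 2 / n ≤ (1 - (k : ℝ) ^ 2 / n) - (k : ℝ) / n := by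
          rw [sub_sub, ← add_div]
          gcongr
          push_cast
          nlinarith
      _ ≤ (n.descFactorial k : ℝ) / n ^ k - (k : ℝ) / n := by gcongr
      _ ≤ (1 - (k : ℝ) / n) * (n.descFactorial k / n ^ k) := by
          nlinarith [show 0 ≤ (k : ℝ) / n by positivity]
      _ ≤ ((n - k : ℕ) : ℝ) / n * (n.descFactorial k / n ^ k) := by gcongr
      _ = (n.descFactorial (k + 1) : ℝ) / n ^ (k + 1) := by
          rw [Nat.descFactorial_succ, Nat.cast_mul, pow_succ', mul_div_mul_comm]

lemma one_add_pow_le {x : ℝ} (h0 : 0 ≤ x) (h1 : x ≤ 1) (k : ℕ) :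
    (1 + x) ^ k ≤ 1 + x * 2 ^ k := by
  induction k with
  | zero => simpa using h0
  | succ k ih =>
    have : (1 + x) ^ k ≤ 2 ^ k := pow_le_pow_left₀ (by linarith) (by linarith) k
    calc (1 + x) ^ (k + 1) = (1 + x) ^ k + x * (1 + x) ^ k := by ring
      _ ≤ (1 + x * 2 ^ k) + x * 2 ^ k := by gcongr
      _ = 1 + x * 2 ^ (k + 1) := by ring

lemma one_sub_le_one_sub_pow {x : ℝ} (h0 : 0 ≤ x) (h1 : x ≤ 1) (k : ℕ) :
    1 - x * 2 ^ k ≤ (1 - x) ^ k := by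
  have bernoulli := one_add_mul_le_pow (a := -x) (by linarith) k
  have : (k : ℝ) * x ≤ 2 ^ k * x := by
    gcongr
    exact_mod_cast Nat.lt_two_pow_self.le
  rw [← sub_eq_add_neg] at bernoulli
  linarith

section Overlaps

variable {V Ω : Type*} [DecidableEq V] {m m' K : ℕ}

lemma edgeConnected_quadFamily [Fintype V] {m₁ m₂ m₃ m₄ : ℕ}
    {q : CyclePair V m₁ m₂ × CyclePair V m₃ m₄}
    (h₁ : q.1 ∈ stepPairs V m₁ m₂) (h₂ : q.2 ∈ stepPairs V m₃ m₄)
    (h : ¬ Disjoint (pairEdges q.1).toFinset (pairEdges q.2).toFinset) :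
    EdgeConnected (quadFamily q) := by
  rw [mem_stepPairs] at h₁ h₂
  refine edgeConnected_of_pairs (not_disjoint_of_same_first h₁.1 h₁.2)
    (not_disjoint_of_same_first h₂.1 h₂.2) ?_
  simpa only [pairEdges, Multiset.toFinset_add, Finset.val_toFinset] using h

lemma monomial_pairEdges (X : Sym2 V → Ω → ℝ) (q : CyclePair V m m') (ω : Ω) :
    monomial X (pairEdges q) ω = cycleProd q.1 (X · ω) * cycleProd q.2 (X · ω) := by
  rw [pairEdges, monomial_add, cycleProd_eq_monomial, cycleProd_eq_monomial]

lemma descFactorial_div_mul_pow [Fintype V] (m : ℕ) (c : ℝ) :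
    (Fintype.card V).descFactorial (m + 3) / (Fintype.card V : ℝ) ^ (m + 3) * c ^ (m + 3) =
      (Fintype.card V : ℝ)⁻¹ ^ (m + 3) * ∑ a : Fin (m + 3) ↪ V, ∏ _e ∈ cycleEdges a, c := by
  simp only [Finset.prod_const, card_cycleEdges (Function.Embedding.injective _),
    Finset.sum_const, Finset.card_univ, Fintype.card_embedding_eq, Fintype.card_fin,
    nsmul_eq_mul]
  rw [inv_pow]
  ring

lemma variance_overlap_eq [Fintype V] [MeasurableSpace Ω] [Finite Ω]
    [MeasurableSingletonClass Ω] {P : Measure Ω} [IsProbabilityMeasure P] (X : Sym2 V → Ω → ℝ)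
    (m m' : ℕ) :
    Var[fun ω => overlap m m' (X · ω); P] =
      (√(Fintype.card V))⁻¹ ^ ((m + 3) + (m' + 3) + (m + 3) + (m' + 3)) *
        ∑ q ∈ stepPairs V m m' ×ˢ stepPairs V m m',
          cov[monomial X (pairEdges q.1), monomial X (pairEdges q.2); P] := by
  simp only [overlap_eq, ← monomial_pairEdges]
  rw [variance_const_mul, variance_fun_sum' fun _ _ => .of_discrete, Finset.sum_product,
    ← pow_mul]
  congr 2
  ring

namespace IsNoise

variable [MeasurableSpace Ω] [Finite Ω] [MeasurableSingletonClass Ω] {P : Measure Ω}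
  {X : Sym2 V → Ω → ℝ} {ρ ε : ℝ}

lemma integral_cycleProd_mul_cycleProd_of_ne (h : IsNoise X P ρ ε) {a : Fin (m + 3) ↪ V}
    {b : Fin (m' + 3) ↪ V} (hab : cycleEdges a ≠ cycleEdges b) :
    ∫ ω, cycleProd a (X · ω) * cycleProd b (X · ω) ∂P = 0 := by
  simpa only [cycleProd_eq_prod_cycleEdges] using h.integral_prod_mul_prod_eq_zero hab

variable [Fintype V]

lemma integral_overlap_of_ne (h : IsNoise X P ρ ε) (hm : m ≠ m') :
    ∫ ω, overlap m m' (X · ω) ∂P = 0 := by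
  have := h.isProbabilityMeasure
  simp only [overlap_eq]
  rw [integral_const_mul, integral_finsetSum _ fun _ _ => .of_finite,
    Finset.sum_eq_zero, mul_zero]
  refine fun q _ => h.integral_cycleProd_mul_cycleProd_of_ne fun he => hm ?_
  have := congrArg Finset.card he
  rw [card_cycleEdges q.1.injective, card_cycleEdges q.2.injective] at this
  omega

lemma integral_overlap_self (h : IsNoise X P ρ ε) (m : ℕ) :
    ∫ ω, overlap m m (X · ω) ∂P = (Fintype.card V : ℝ)⁻¹ ^ (m + 3) *
      ∑ a : Fin (m + 3) ↪ V, ∏ e ∈ cycleEdges a, ∫ ω, X e ω ^ 2 ∂P := by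
  have := h.isProbabilityMeasure
  simp only [overlap_eq]
  rw [integral_const_mul, integral_finsetSum _ fun _ _ => .of_finite, ← two_mul, pow_mul,
    inv_pow, Real.sq_sqrt (Nat.cast_nonneg _), stepPairs, Finset.sum_filter,
    Fintype.sum_prod_type]
  refine congrArg _ (Finset.sum_congr rfl fun a _ => ?_)
  rw [Finset.sum_eq_single a]
  · simp only [if_true, ← sq, cycleProd_eq_prod_cycleEdges]
    exact h.integral_prod_sq _
  · intro b _ hb
    refine ite_eq_right_iff.2 fun hc => h.integral_cycleProd_mul_cycleProd_of_ne fun he => hb ?_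
    obtain ⟨h0, h1⟩ := Prod.mk.inj hc
    exact (DFunLike.coe_injective (eq_of_cycleEdges_eq a.injective b.injective he h0 h1)).symm
  · simp

lemma abs_integral_overlap_self_sub_one_le [Nonempty V] (h : IsNoise X P ρ ε) (m : ℕ) :
    |∫ ω, overlap m m (X · ω) ∂P - 1| ≤
      ε * 2 ^ (m + 3) + ((m + 3 : ℕ) : ℝ) ^ 2 / Fintype.card V := by
  obtain ⟨v⟩ := ‹Nonempty V›
  have hε : 0 ≤ ε := h.eps_nonneg s(v, v)
  have hε1 := h.eps_le_one
  have hn : 0 < Fintype.card V := Fintype.card_pos_iff.2 ⟨v⟩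
  have variance_mem (e : Sym2 V) : 1 - ε ≤ ∫ ω, X e ω ^ 2 ∂P ∧ ∫ ω, X e ω ^ 2 ∂P ≤ 1 + ε := by
    have := abs_le.1 (h.abs_integral_sq_sub_one_le e)
    constructor <;> linarith
  let r := (Fintype.card V).descFactorial (m + 3) / (Fintype.card V : ℝ) ^ (m + 3)
  have hr0 : 0 ≤ r := by positivity
  have hr1 : r ≤ 1 := by
    rw [div_le_one (by positivity)]
    exact_mod_cast Nat.descFactorial_le_pow _ _
  have upper : ∫ ω, overlap m m (X · ω) ∂P ≤ r * (1 + ε) ^ (m + 3) := by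
    rw [h.integral_overlap_self, descFactorial_div_mul_pow]
    gcongr with a _ e
    exact (variance_mem e).2
  have lower : r * (1 - ε) ^ (m + 3) ≤ ∫ ω, overlap m m (X · ω) ∂P := by
    rw [h.integral_overlap_self, descFactorial_div_mul_pow]
    gcongr with a _ e
    exact (variance_mem e).1
  have hlow : 1 - ((m + 3 : ℕ) : ℝ) ^ 2 / Fintype.card V ≤ r :=
    one_sub_le_descFactorial_div (m + 3) hn
  have hpow := one_add_pow_le hε hε1 (m + 3)
  have hpow' := one_sub_le_one_sub_pow hε hε1 (m + 3)
  have : 0 ≤ ε * 2 ^ (m + 3) := by positivity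
  have : 0 ≤ ((m + 3 : ℕ) : ℝ) ^ 2 / Fintype.card V := by positivity
  rw [abs_le]
  constructor <;> nlinarith

lemma variance_overlap_le (h : IsNoise X P ρ ε)
    (hK : K = (m + 3) + (m' + 3) + (m + 3) + (m' + 3))
    (hN : 1 ≤ √(Fintype.card V) * ρ) (hKn : (K : ℝ) * 2 ^ K ≤ √(Fintype.card V)) :
    Var[fun ω => overlap m m' (X · ω); P] ≤ 2 * quadBound V ρ K := by
  have := h.isProbabilityMeasure
  let S := {q ∈ stepPairs V m m' ×ˢ stepPairs V m m' |
    ¬ Disjoint (pairEdges q.1).toFinset (pairEdges q.2).toFinset}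
  have hS (q) (hq : q ∈ S) : EdgeConnected (quadFamily q) := by
    obtain ⟨hq, hdisj⟩ := Finset.mem_filter.1 hq
    exact edgeConnected_quadFamily (Finset.mem_product.1 hq).1 (Finset.mem_product.1 hq).2 hdisj
  calc _ = (√(Fintype.card V))⁻¹ ^ K *
        ∑ q ∈ S, cov[monomial X (pairEdges q.1), monomial X (pairEdges q.2); P] := by
        rw [variance_overlap_eq, ← hK, Finset.sum_filter_of_ne]
        exact fun q _ hq hdisj => hq (cov_monomial_eq_zero h.indep hdisj)
    _ ≤ (√(Fintype.card V))⁻¹ ^ K *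
        ∑ q ∈ S, 2 * momentBound ρ (pairEdges q.1 + pairEdges q.2) := by
        gcongr
        exact (le_abs_self _).trans (h.abs_cov_monomial_le _ _)
    _ = 2 * ((√(Fintype.card V))⁻¹ ^ K *
        ∑ q ∈ S, momentBound ρ (pairEdges q.1 + pairEdges q.2)) := by
        rw [← Finset.mul_sum]
        ring
    _ ≤ 2 * quadBound V ρ K := by
        gcongr
        exact sum_momentBound_quadFamily_le hK h.pos h.le_one hN hKn hS

lemma sum_integral_cycleSumAt_pow_four_le (h : IsNoise X P ρ ε)
    (hK : K = (m + 3) + (m + 3) + (m + 3) + (m + 3))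
    (hN : 1 ≤ √(Fintype.card V) * ρ) (hKn : (K : ℝ) * 2 ^ K ≤ √(Fintype.card V)) :
    ∑ p, ∫ ω, cycleSumAt m p (X · ω) ^ 4 ∂P ≤ quadBound V ρ K := by
  have := h.isProbabilityMeasure
  let S := {q ∈ stepPairs V m m ×ˢ stepPairs V m m | (q.1.1 0, q.1.1 1) = (q.2.1 0, q.2.1 1)}
  have hS (q) (hq : q ∈ S) : EdgeConnected (quadFamily q) := by
    obtain ⟨hq, hfirst⟩ := Finset.mem_filter.1 hq
    obtain ⟨h0, h1⟩ := Prod.mk.inj hfirst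
    refine edgeConnected_quadFamily (Finset.mem_product.1 hq).1 (Finset.mem_product.1 hq).2 ?_
    simp only [pairEdges, Multiset.toFinset_add, Finset.val_toFinset]
    exact fun hdisj => not_disjoint_of_same_first h0 h1
      (hdisj.mono Finset.subset_union_left Finset.subset_union_left)
  calc ∑ p, ∫ ω, cycleSumAt m p (X · ω) ^ 4 ∂P
    _ = (√(Fintype.card V))⁻¹ ^ K *
        ∑ q ∈ S, ∫ ω, monomial X (pairEdges q.1 + pairEdges q.2) ω ∂P := by
        simp only [monomial_add, monomial_pairEdges]
        rw [← integral_finsetSum _ fun _ _ => .of_finite,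
          funext fun ω => sum_cycleSumAt_pow_four m _, integral_const_mul,
          integral_finsetSum _ fun _ _ => .of_finite, hK]
        congr 2
        ring
    _ ≤ (√(Fintype.card V))⁻¹ ^ K *
        ∑ q ∈ S, momentBound ρ (pairEdges q.1 + pairEdges q.2) := by
        gcongr
        exact (le_abs_self _).trans (h.abs_integral_monomial_le _)
    _ ≤ quadBound V ρ K := sum_momentBound_quadFamily_le hK h.pos h.le_one hN hKn hS

end IsNoise

end Overlaps

section QuadBound

variable {V : Type*} [Fintype V] {ρ : ℝ}

lemma quadBound_mono (hρ : 0 < ρ) : Monotone (quadBound V ρ) := fun K K' h => by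
  unfold quadBound
  gcongr
  norm_num

lemma quadBound_pos {K : ℕ} (hK : 0 < K) (hN : 0 < √(Fintype.card V) * ρ) :
    0 < quadBound V ρ K := by
  unfold quadBound
  positivity

lemma mul_two_pow_mono : Monotone fun K : ℕ => (K : ℝ) * 2 ^ K := fun K K' h => by
  dsimp only
  gcongr
  norm_num

variable (V) in
/-- The bound for the deviation of the mean of the overlaps from the identity matrix, for cycles
of length at most `M`. -/
noncomputable def meanError (ε : ℝ) (M : ℕ) : ℝ :=
  ε * 2 ^ M + (M : ℝ) ^ 2 / Fintype.card V

end QuadBound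

namespace IsNoise

variable {V Ω : Type*} [Fintype V] [MeasurableSpace Ω] {P : Measure Ω} {X : Sym2 V → Ω → ℝ}
  {ρ ε : ℝ} {m m' M : ℕ}

lemma meanError_nonneg [Nonempty V] (h : IsNoise X P ρ ε) (M : ℕ) : 0 ≤ meanError V ε M := by
  obtain ⟨v⟩ := ‹Nonempty V›
  have hε : 0 ≤ ε := h.eps_nonneg s(v, v)
  unfold meanError
  positivity

variable [DecidableEq V] [Finite Ω] [MeasurableSingletonClass Ω]

lemma abs_integral_overlap_sub_le [Nonempty V] (h : IsNoise X P ρ ε) (hm : m + 3 ≤ M) :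
    |∫ ω, overlap m m' (X · ω) ∂P - if m = m' then 1 else 0| ≤ meanError V ε M := by
  split_ifs with hmm
  · obtain ⟨v⟩ := ‹Nonempty V›
    have hε : 0 ≤ ε := h.eps_nonneg s(v, v)
    subst hmm
    have : Nonempty V := ⟨v⟩
    refine (h.abs_integral_overlap_self_sub_one_le m).trans ?_
    unfold meanError
    gcongr
    norm_num
  · rw [h.integral_overlap_of_ne hmm, sub_zero, abs_zero]
    exact h.meanError_nonneg M

lemma integral_abs_overlap_sub_le [Nonempty V] (h : IsNoise X P ρ ε) (hm : m + 3 ≤ M)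
    (hm' : m' + 3 ≤ M) (hN : 1 ≤ √(Fintype.card V) * ρ)
    (hMn : ((4 * M : ℕ) : ℝ) * 2 ^ (4 * M) ≤ √(Fintype.card V)) :
    ∫ ω, |overlap m m' (X · ω) - if m = m' then 1 else 0| ∂P ≤
      √(2 * quadBound V ρ (4 * M)) + meanError V ε M := by
  have := h.isProbabilityMeasure
  have hK : (m + 3) + (m' + 3) + (m + 3) + (m' + 3) ≤ 4 * M := by lia
  set μ := ∫ ω, overlap m m' (X · ω) ∂P with hμ
  have fluctuation : ∫ ω, |overlap m m' (X · ω) - μ| ∂P ≤ √(2 * quadBound V ρ (4 * M)) := by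
    refine (integral_abs_le_sqrt .of_discrete).trans (Real.sqrt_le_sqrt ?_)
    rw [hμ, ← variance_eq_integral Measurable.of_discrete.aemeasurable]
    refine (h.variance_overlap_le rfl hN ((mul_two_pow_mono hK).trans hMn)).trans ?_
    gcongr
    exact quadBound_mono h.pos hK
  calc _ ≤ ∫ ω, (|overlap m m' (X · ω) - μ| + |μ - if m = m' then 1 else 0|) ∂P :=
        integral_mono .of_finite .of_finite fun ω => abs_sub_le _ _ _
    _ = ∫ ω, |overlap m m' (X · ω) - μ| ∂P + |μ - if m = m' then 1 else 0| := by
        rw [integral_add .of_finite .of_finite, integral_const, probReal_univ, one_smul]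
    _ ≤ _ := add_le_add fluctuation (h.abs_integral_overlap_sub_le hm)

lemma sum_integral_cycleSumAt_sq_le [Nonempty V] (h : IsNoise X P ρ ε) (hm : m + 3 ≤ M) :
    ∑ p, ∫ ω, cycleSumAt m p (X · ω) ^ 2 ∂P ≤ 1 + meanError V ε M := by
  have := h.isProbabilityMeasure
  have hmean := (abs_le.1 (h.abs_integral_overlap_sub_le (m' := m) hm)).2
  rw [if_pos rfl] at hmean
  rw [← integral_finsetSum _ fun _ _ => .of_finite]
  simp only [overlap, ← sq] at hmean
  linarith

lemma sum_integral_cycleSumAt_pow_four_le_of_le (h : IsNoise X P ρ ε) (hm : m + 3 ≤ M)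
    (hN : 1 ≤ √(Fintype.card V) * ρ)
    (hMn : ((4 * M : ℕ) : ℝ) * 2 ^ (4 * M) ≤ √(Fintype.card V)) :
    ∑ p, ∫ ω, cycleSumAt m p (X · ω) ^ 4 ∂P ≤ quadBound V ρ (4 * M) := by
  have hK : (m + 3) + (m + 3) + (m + 3) + (m + 3) ≤ 4 * M := by lia
  exact (h.sum_integral_cycleSumAt_pow_four_le rfl hN ((mul_two_pow_mono hK).trans hMn)).trans
    (quadBound_mono h.pos hK)

end IsNoise

section CycleForm

variable {V ι : Type*} [Fintype V] [Fintype ι] {m : ι → ℕ}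

/-- A linear combination of cycle sums. -/
noncomputable def cycleForm (α : ι → ℝ) (m : ι → ℕ) (x : Sym2 V → ℝ) : ℝ :=
  ∑ i, α i * cycleSum (m i) x

lemma measurable_cycleForm (α : ι → ℝ) (m : ι → ℕ) :
    Measurable (cycleForm α m : (Sym2 V → ℝ) → ℝ) := by
  unfold cycleForm cycleSum cycleProd
  fun_prop

variable [DecidableEq V]

/-- The part of `cycleForm` given by the cycles whose first step is `p.1 → p.2`. -/
noncomputable def cycleFormAt (α : ι → ℝ) (m : ι → ℕ) (p : V × V) (x : Sym2 V → ℝ) : ℝ :=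
  ∑ i, α i * cycleSumAt (m i) p x

lemma sum_cycleFormAt (α : ι → ℝ) (m : ι → ℕ) (x : Sym2 V → ℝ) :
    ∑ p, cycleFormAt α m p x = cycleForm α m x := by
  simp only [cycleFormAt]
  rw [Finset.sum_comm]
  simp only [← Finset.mul_sum, sum_cycleSumAt, cycleForm]

lemma sum_cycleFormAt_mul (α β : ι → ℝ) (m : ι → ℕ) (x : Sym2 V → ℝ) :
    ∑ p, cycleFormAt α m p x * cycleFormAt β m p x =
      ∑ i, ∑ j, α i * β j * overlap (m i) (m j) x := by
  simp only [cycleFormAt, Finset.sum_mul_sum, mul_mul_mul_comm (α _)]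
  rw [Finset.sum_comm]
  refine Finset.sum_congr rfl fun i _ => ?_
  rw [Finset.sum_comm]
  simp only [overlap, Finset.mul_sum]

lemma cycleFormAt_sq_le (α : ι → ℝ) (m : ι → ℕ) (p : V × V) (x : Sym2 V → ℝ) :
    cycleFormAt α m p x ^ 2 ≤ (∑ i, α i ^ 2) * ∑ i, cycleSumAt (m i) p x ^ 2 :=
  Finset.sum_mul_sq_le_sq_mul_sq _ _ _

/-- Splitting the odd power by `2 |x| ≤ c + x² / c`. -/
lemma abs_cycleFormAt_mul_sq_le (α β : ι → ℝ) (m : ι → ℕ) (p : V × V) (x : Sym2 V → ℝ) {c : ℝ}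
    (hc : 0 < c) :
    |cycleFormAt α m p x| * cycleFormAt β m p x ^ 2 ≤ (∑ i, β i ^ 2) / 2 *
      (c * (∑ i, cycleSumAt (m i) p x ^ 2) +
        (∑ i, α i ^ 2) * c⁻¹ * (Fintype.card ι * ∑ i, cycleSumAt (m i) p x ^ 4)) := by
  set S := ∑ i, cycleSumAt (m i) p x ^ 2
  have : 0 ≤ S := Finset.sum_nonneg fun _ _ => sq_nonneg _
  have hS2 : S ^ 2 ≤ Fintype.card ι * ∑ i, cycleSumAt (m i) p x ^ 4 := by
    refine (sq_sum_le_card_mul_sum_sq (s := Finset.univ)).trans_eq ?_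
    simp only [Finset.card_univ, ← pow_mul, Nat.reduceMul]
  have amgm (y : ℝ) : |y| ≤ (c + c⁻¹ * y ^ 2) / 2 := by
    have : c + c⁻¹ * y ^ 2 - 2 * |y| = c⁻¹ * (c - |y|) ^ 2 := by
      rw [sub_sq, sq_abs]
      field_simp
      ring
    linarith [show 0 ≤ c⁻¹ * (c - |y|) ^ 2 by positivity]
  calc _ ≤ (c + c⁻¹ * cycleFormAt α m p x ^ 2) / 2 * cycleFormAt β m p x ^ 2 := by
        gcongr
        exact amgm _
    _ ≤ (c + c⁻¹ * ((∑ i, α i ^ 2) * S)) / 2 * ((∑ i, β i ^ 2) * S) := by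
        gcongr <;> exact cycleFormAt_sq_le _ _ _ _
    _ = (∑ i, β i ^ 2) / 2 * (c * S + (∑ i, α i ^ 2) * c⁻¹ * S ^ 2) := by ring
    _ ≤ _ := by gcongr

lemma measurable_cycleFormAt (α : ι → ℝ) (m : ι → ℕ) (p : V × V) :
    Measurable (cycleFormAt α m p : (Sym2 V → ℝ) → ℝ) := by
  unfold cycleFormAt cycleSumAt cycleProd
  fun_prop

/-- The coefficients for which `cycleFormAt` collects all the cycles of `cycleForm α m` through an
edge: a cycle of length `k` has `2 k` roots and orientations. -/
def throughCoeff (α : ι → ℝ) (m : ι → ℕ) (i : ι) : ℝ := 2 * (m i + 3 : ℕ) * α i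

lemma cycleForm_sub_cycleFormAt_congr (α : ι → ℝ) (m : ι → ℕ) (p : V × V) {x y : Sym2 V → ℝ}
    (hxy : ∀ e ≠ s(p.1, p.2), x e = y e) :
    cycleForm α m x - cycleFormAt (throughCoeff α m) m p x =
      cycleForm α m y - cycleFormAt (throughCoeff α m) m p y := by
  have form_sub (z : Sym2 V → ℝ) : cycleForm α m z - cycleFormAt (throughCoeff α m) m p z =
      ∑ i, α i * (cycleSum (m i) z - 2 * (m i + 3 : ℕ) * cycleSumAt (m i) p z) := by
    rw [cycleForm, cycleFormAt, ← Finset.sum_sub_distrib]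
    exact Finset.sum_congr rfl fun i _ => by rw [throughCoeff]; ring
  rw [form_sub, form_sub]
  exact Finset.sum_congr rfl fun i _ => by rw [cycleSum_sub_cycleSumAt_congr (m i) p hxy]

namespace IsNoise

variable {Ω : Type*} [MeasurableSpace Ω] [Finite Ω] [MeasurableSingletonClass Ω] {P : Measure Ω}
  {X : Sym2 V → Ω → ℝ} {ρ ε : ℝ} {M : ℕ}

lemma integral_cycleFormAt_mul_cexp_eq_zero (h : IsNoise X P ρ ε) (α : ι → ℝ) (m : ι → ℕ)
    (p : V × V) (s : ℝ) :
    ∫ ω, (cycleFormAt α m p (X · ω) : ℂ) * Complex.exp (Complex.I *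
      (s * (cycleForm α m (X · ω) - cycleFormAt (throughCoeff α m) m p (X · ω)) : ℝ)) ∂P = 0 := by
  choose g hg hgi hgm using fun i => exists_cycleSumAt_eq_mul (V := V) (m i) p
  have factor (x : Sym2 V → ℝ) :
      cycleFormAt α m p x = x s(p.1, p.2) * ∑ i, α i * g i x := by
    simp only [cycleFormAt, hgm, Finset.mul_sum]
    exact Finset.sum_congr rfl fun _ _ => by ring
  have hform := measurable_cycleForm (V := V) α m
  have hformAt := measurable_cycleFormAt (throughCoeff α m) m p
  simp only [factor, Complex.ofReal_mul (X _ _), mul_assoc (X _ _ : ℂ)]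
  refine h.integral_mul_eq_zero s(p.1, p.2) (g := fun x => (∑ i, α i * g i x : ℝ) *
    Complex.exp (Complex.I *
      (s * (cycleForm α m x - cycleFormAt (throughCoeff α m) m p x) : ℝ))) (by fun_prop) ?_
  intro x y hxy
  simp only [cycleForm_sub_cycleFormAt_congr α m p hxy, hgi _ x y hxy]

lemma integral_abs_sum_cycleFormAt_mul_sub_le [Nonempty V] (h : IsNoise X P ρ ε)
    (hm : Function.Injective m) (hmM : ∀ i, m i + 3 ≤ M) (hN : 1 ≤ √(Fintype.card V) * ρ)
    (hMn : ((4 * M : ℕ) : ℝ) * 2 ^ (4 * M) ≤ √(Fintype.card V)) (α β : ι → ℝ) :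
    ∫ ω, |∑ p, cycleFormAt α m p (X · ω) * cycleFormAt β m p (X · ω) - ∑ i, α i * β i| ∂P ≤
      (∑ i, |α i|) * (∑ i, |β i|) * (√(2 * quadBound V ρ (4 * M)) + meanError V ε M) := by
  classical
  have := h.isProbabilityMeasure
  have expand (x : Sym2 V → ℝ) :
      ∑ p, cycleFormAt α m p x * cycleFormAt β m p x - ∑ i, α i * β i =
        ∑ i, ∑ j, α i * β j * (overlap (m i) (m j) x - if m i = m j then 1 else 0) := by
    simp only [sum_cycleFormAt_mul, mul_sub, Finset.sum_sub_distrib, hm.eq_iff, mul_ite, mul_one,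
      mul_zero, Finset.sum_ite_eq, Finset.mem_univ, if_true]
  calc _ ≤ ∫ ω, ∑ i, ∑ j, |α i| * |β j| *
          |overlap (m i) (m j) (X · ω) - if m i = m j then 1 else 0| ∂P := by
        refine integral_mono .of_finite .of_finite fun ω => ?_
        rw [expand]
        refine (Finset.abs_sum_le_sum_abs _ _).trans (Finset.sum_le_sum fun i _ => ?_)
        refine (Finset.abs_sum_le_sum_abs _ _).trans (Finset.sum_le_sum fun j _ => ?_)
        rw [abs_mul, abs_mul]
    _ = ∑ i, ∑ j, |α i| * |β j| *
          ∫ ω, |overlap (m i) (m j) (X · ω) - if m i = m j then 1 else 0| ∂P := by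
        simp only [integral_finsetSum _ fun _ _ => Integrable.of_finite, integral_const_mul]
    _ ≤ ∑ i, ∑ j, |α i| * |β j| * (√(2 * quadBound V ρ (4 * M)) + meanError V ε M) := by
        gcongr with i _ j _
        exact h.integral_abs_overlap_sub_le (hmM i) (hmM j) hN hMn
    _ = _ := by
        rw [Finset.sum_mul_sum]
        simp only [Finset.sum_mul]

lemma sum_integral_abs_cycleFormAt_mul_sq_le [Nonempty V] (h : IsNoise X P ρ ε)
    (hmM : ∀ i, m i + 3 ≤ M) (hN : 1 ≤ √(Fintype.card V) * ρ)
    (hMn : ((4 * M : ℕ) : ℝ) * 2 ^ (4 * M) ≤ √(Fintype.card V)) (α β : ι → ℝ) :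
    ∑ p, ∫ ω, |cycleFormAt α m p (X · ω)| * cycleFormAt β m p (X · ω) ^ 2 ∂P ≤
      (∑ i, β i ^ 2) / 2 * (Fintype.card ι * √(quadBound V ρ (4 * M)) *
        (1 + meanError V ε M + (∑ i, α i ^ 2) * Fintype.card ι)) := by
  have := h.isProbabilityMeasure
  rcases isEmpty_or_nonempty ι with hι | ⟨⟨i₀⟩⟩
  · simp [cycleFormAt]
  have hM : 0 < 4 * M := by have := hmM i₀; lia
  set Q := quadBound V ρ (4 * M)
  have hc : 0 < √Q := Real.sqrt_pos.2 (quadBound_pos hM (one_pos.trans_le hN))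
  have second : ∑ p, ∫ ω, ∑ i, cycleSumAt (m i) p (X · ω) ^ 2 ∂P ≤
      Fintype.card ι * (1 + meanError V ε M) := by
    simp only [integral_finsetSum _ fun _ _ => Integrable.of_finite]
    rw [Finset.sum_comm]
    refine (Finset.sum_le_sum fun i _ => h.sum_integral_cycleSumAt_sq_le (hmM i)).trans_eq ?_
    rw [Finset.sum_const, Finset.card_univ, nsmul_eq_mul]
  have fourth : ∑ p, ∫ ω, ∑ i, cycleSumAt (m i) p (X · ω) ^ 4 ∂P ≤ Fintype.card ι * Q := by
    simp only [integral_finsetSum _ fun _ _ => Integrable.of_finite]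
    rw [Finset.sum_comm]
    refine (Finset.sum_le_sum fun i _ =>
      h.sum_integral_cycleSumAt_pow_four_le_of_le (hmM i) hN hMn).trans_eq ?_
    rw [Finset.sum_const, Finset.card_univ, nsmul_eq_mul]
  calc _ ≤ ∑ p, ∫ ω, (∑ i, β i ^ 2) / 2 * (√Q * (∑ i, cycleSumAt (m i) p (X · ω) ^ 2) +
          (∑ i, α i ^ 2) * (√Q)⁻¹ *
            (Fintype.card ι * ∑ i, cycleSumAt (m i) p (X · ω) ^ 4)) ∂P :=
        Finset.sum_le_sum fun p _ => integral_mono .of_finite .of_finite fun ω =>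
          abs_cycleFormAt_mul_sq_le α β m p _ hc
    _ = (∑ i, β i ^ 2) / 2 * (√Q * ∑ p, ∫ ω, ∑ i, cycleSumAt (m i) p (X · ω) ^ 2 ∂P +
          (∑ i, α i ^ 2) * (√Q)⁻¹ *
            (Fintype.card ι * ∑ p, ∫ ω, ∑ i, cycleSumAt (m i) p (X · ω) ^ 4 ∂P)) := by
        simp only [integral_const_mul, integral_add Integrable.of_finite Integrable.of_finite,
          ← Finset.mul_sum, Finset.sum_add_distrib]
    _ ≤ (∑ i, β i ^ 2) / 2 * (√Q * (Fintype.card ι * (1 + meanError V ε M)) +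
          (∑ i, α i ^ 2) * (√Q)⁻¹ * (Fintype.card ι * (Fintype.card ι * Q))) := by gcongr
    _ = _ := by
        have : (√Q)⁻¹ * Q = √Q := by rw [inv_mul_eq_div, Real.div_sqrt]
        linear_combination (∑ i, β i ^ 2) / 2 * (∑ i, α i ^ 2) * Fintype.card ι ^ 2 * this

end IsNoise

end CycleForm

section GaussianCoeff

variable {ι : Type*} {m : ι → ℕ} {M : ℕ}

/-- The coefficients of the cycle sums in the linear form `t` of the normalized cycle sums. -/
noncomputable def gaussianCoeff (t : ι → ℝ) (m : ι → ℕ) (i : ι) : ℝ :=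
  t i / √(2 * (m i + 3 : ℕ))

lemma gaussianCoeff_mul_throughCoeff (t : ι → ℝ) (m : ι → ℕ) (i : ι) :
    gaussianCoeff t m i * throughCoeff (gaussianCoeff t m) m i = t i ^ 2 := by
  have : √(2 * (m i + 3 : ℕ) : ℝ) ^ 2 = 2 * (m i + 3 : ℕ) := Real.sq_sqrt (by positivity)
  rw [throughCoeff, gaussianCoeff, mul_left_comm, div_mul_div_comm, ← sq, ← sq, this]
  field_simp

lemma abs_gaussianCoeff_le (t : ι → ℝ) (m : ι → ℕ) (i : ι) : |gaussianCoeff t m i| ≤ |t i| := by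
  rw [gaussianCoeff, abs_div, abs_of_nonneg (Real.sqrt_nonneg _)]
  refine div_le_self (abs_nonneg _) (Real.one_le_sqrt.2 ?_)
  push_cast
  linarith [show (0 : ℝ) ≤ m i by positivity]

lemma abs_throughCoeff_gaussianCoeff_le (hmM : ∀ i, m i + 3 ≤ M) (t : ι → ℝ) (i : ι) :
    |throughCoeff (gaussianCoeff t m) m i| ≤ 2 * M * |t i| := by
  rw [throughCoeff, abs_mul, abs_mul, abs_two, Nat.abs_cast]
  refine mul_le_mul ?_ (abs_gaussianCoeff_le t m i) (abs_nonneg _) (by positivity)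
  gcongr
  exact hmM i

lemma throughCoeff_gaussianCoeff_sq_le (hmM : ∀ i, m i + 3 ≤ M) (t : ι → ℝ) (i : ι) :
    throughCoeff (gaussianCoeff t m) m i ^ 2 ≤ 2 * M * t i ^ 2 := by
  calc throughCoeff (gaussianCoeff t m) m i ^ 2
      = 2 * (m i + 3 : ℕ) * (gaussianCoeff t m i * throughCoeff (gaussianCoeff t m) m i) := by
        simp only [throughCoeff]
        ring
    _ ≤ 2 * M * t i ^ 2 := by
        rw [gaussianCoeff_mul_throughCoeff]
        gcongr
        exact hmM i

end GaussianCoeff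

theorem IsNoise.norm_integral_cexp_cycleForm_sub_le {V Ω ι : Type*} [Fintype V] [Nonempty V]
    [MeasurableSpace Ω] [Finite Ω] [MeasurableSingletonClass Ω] [Fintype ι] {P : Measure Ω}
    {X : Sym2 V → Ω → ℝ} {ρ ε : ℝ} {m : ι → ℕ} {M : ℕ} (h : IsNoise X P ρ ε)
    (hm : Function.Injective m) (hmM : ∀ i, m i + 3 ≤ M) (hN : 1 ≤ √(Fintype.card V) * ρ)
    (hMn : ((4 * M : ℕ) : ℝ) * 2 ^ (4 * M) ≤ √(Fintype.card V)) (t : ι → ℝ) :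
    ‖∫ ω, Complex.exp (Complex.I * cycleForm (gaussianCoeff t m) m (X · ω)) ∂P -
      Complex.exp (-(∑ i, t i ^ 2 : ℝ) / 2)‖ ≤
    2 * M * (∑ i, |t i|) ^ 2 * (√(2 * quadBound V ρ (4 * M)) + meanError V ε M) +
      3 * (M * (∑ i, t i ^ 2) * (Fintype.card ι * √(quadBound V ρ (4 * M)) *
        (1 + meanError V ε M + (∑ i, t i ^ 2) * Fintype.card ι))) := by
  classical
  have := h.isProbabilityMeasure
  have := h.meanError_nonneg M
  set α := gaussianCoeff t m
  set β := throughCoeff α m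
  refine (norm_integral_cexp_sub_gaussian_le
    (F := fun ω => cycleForm α m (X · ω)) (X := fun p ω => cycleFormAt α m p (X · ω))
    (Y := fun p ω => cycleFormAt β m p (X · ω)) (fun ω => (sum_cycleFormAt α m _).symm)
    (fun _ => .of_finite) (fun _ => .of_discrete) (fun _ => .of_finite) (fun _ => .of_finite)
    (h.integral_cycleFormAt_mul_cexp_eq_zero α m)
    (Finset.sum_nonneg fun i _ => sq_nonneg (t i))).trans (add_le_add ?_ ?_)
  · simp only [← gaussianCoeff_mul_throughCoeff t m]
    refine (h.integral_abs_sum_cycleFormAt_mul_sub_le hm hmM hN hMn α β).trans ?_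
    have hα : ∑ i, |α i| ≤ ∑ i, |t i| := Finset.sum_le_sum fun i _ => abs_gaussianCoeff_le t m i
    have hβ : ∑ i, |β i| ≤ 2 * M * ∑ i, |t i| := by
      rw [Finset.mul_sum]
      exact Finset.sum_le_sum fun i _ => abs_throughCoeff_gaussianCoeff_le hmM t i
    calc _ ≤ (∑ i, |t i|) * (2 * M * ∑ i, |t i|) *
          (√(2 * quadBound V ρ (4 * M)) + meanError V ε M) := by gcongr
      _ = _ := by ring
  · refine mul_le_mul_of_nonneg_left ?_ zero_le_three
    refine (h.sum_integral_abs_cycleFormAt_mul_sq_le hmM hN hMn α β).trans ?_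
    have hα : ∑ i, α i ^ 2 ≤ ∑ i, t i ^ 2 :=
      Finset.sum_le_sum fun i _ => sq_le_sq.2 (abs_gaussianCoeff_le t m i)
    have hβ : (∑ i, β i ^ 2) / 2 ≤ M * ∑ i, t i ^ 2 := by
      rw [div_le_iff₀ two_pos, Finset.mul_sum, Finset.sum_mul]
      exact Finset.sum_le_sum fun i _ =>
        (throughCoeff_gaussianCoeff_sq_le hmM t i).trans_eq (by ring)
    gcongr

/-! ### Adding a signal -/

section Counting

variable {V : Type*} [Fintype V] [DecidableEq V]

lemma card_walks_le {r : ℕ} (U : Finset V) (N : Fin r → V → Finset V) {d : Fin r → ℕ}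
    (hN : ∀ i y, (N i y).card ≤ d i) :
    ({f | f 0 ∈ U ∧ ∀ i : Fin r, f i.succ ∈ N i (f i.castSucc)} : Finset (Fin (r + 1) → V)).card ≤
      U.card * ∏ i, d i := by
  induction r generalizing U with
  | zero =>
    rw [Fin.prod_univ_zero, mul_one]
    refine Finset.card_le_card_of_injOn (fun f => f 0) (fun f hf => ?_) fun f _ g _ hfg => ?_
    · simp only [Finset.coe_filter, Finset.mem_univ, true_and, Set.mem_ofPred_eq] at hf
      exact hf.1
    · exact funext (Fin.forall_fin_one.2 hfg)
  | succ r ih =>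
    refine (Finset.card_le_mul_card_image_of_maps_to (f := fun f => f 0) (t := U)
      (fun f hf => (Finset.mem_filter.1 hf).2.1) (∏ i, d i) fun x hx => ?_).trans_eq (mul_comm _ _)
    rw [Fin.prod_univ_succ]
    refine ((Finset.card_le_card_of_injOn Fin.tail (fun f hf => ?_) fun f hf g hg hfg => ?_).trans
      (ih (N 0 x) (fun i => N i.succ) fun i => hN i.succ)).trans
      (Nat.mul_le_mul_right _ (hN 0 x))
    · simp only [Finset.coe_filter, Finset.mem_filter, Finset.mem_univ, true_and,
        Set.mem_ofPred_eq] at hf ⊢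
      obtain ⟨⟨-, hsteps⟩, rfl⟩ := hf
      exact ⟨hsteps 0, fun i => hsteps i.succ⟩
    · rw [← Fin.cons_self_tail f, ← Fin.cons_self_tail g, hfg]
      congr 1
      exact (Finset.mem_filter.1 hf).2.trans (Finset.mem_filter.1 hg).2.symm

variable {m : ℕ}

lemma card_nbrs_cycleEdges_le_two {f : Fin (m + 3) → V} (hf : Function.Injective f) (y : V) :
    (nbrs (cycleEdges f) y).card ≤ 2 := by
  by_cases hy : y ∈ cycleVerts f
  · obtain ⟨j, rfl⟩ := mem_cycleVerts.1 hy
    refine (Finset.card_le_card (t := {f (j + 1), f (j - 1)}) fun z hz => ?_).trans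
      Finset.card_le_two
    simpa using eq_or_eq_of_mem_cycleEdges hf (mem_nbrs.1 hz)
  · rw [Finset.card_eq_zero.2 (Finset.eq_empty_of_forall_notMem fun z hz =>
      hy (mem_cycleVerts_of_mem_cycleEdges (mem_nbrs.1 hz) (by simp)))]
    exact zero_le_two

/-- Walking along the cycle from the position `0`, only the steps outside `T` are free. -/
lemma card_cycles_le_of_last_notMem {f : Fin (m + 3) → V} (hf : Function.Injective f)
    {T : Finset (Fin (m + 3))} (h0 : 0 ∈ T) (hlast : Fin.last (m + 2) ∉ T) :
    ({b | ∀ j ∈ T, cycleEdge b j ∈ cycleEdges f} : Finset (Fin (m + 3) ↪ V)).card ≤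
      (m + 3) * (2 ^ T.card * Fintype.card V ^ (m + 2 - T.card)) := by
  have card_steps : ({i | i.castSucc ∈ T} : Finset (Fin (m + 2))).card = T.card := by
    refine Finset.card_bij (fun i _ => i.castSucc) (fun i hi => (Finset.mem_filter.1 hi).2)
      (fun i _ j _ h => Fin.castSucc_injective _ h) fun j hj => ?_
    obtain ⟨i, rfl⟩ := Fin.exists_castSucc_eq.2 (ne_of_mem_of_not_mem hj hlast)
    exact ⟨i, by simpa using hj, rfl⟩
  have card_free : ({i | i.castSucc ∉ T} : Finset (Fin (m + 2))).card = m + 2 - T.card := by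
    have := Finset.card_filter_add_card_filter_not (s := (Finset.univ : Finset (Fin (m + 2))))
      fun i => i.castSucc ∈ T
    rw [card_steps, Finset.card_univ, Fintype.card_fin] at this
    lia
  have walks := card_walks_le (cycleVerts f)
    (fun i : Fin (m + 2) => if i.castSucc ∈ T then nbrs (cycleEdges f) else fun _ => Finset.univ)
    (d := fun i => if i.castSucc ∈ T then 2 else Fintype.card V) fun i y => by
      split_ifs
      exacts [card_nbrs_cycleEdges_le_two hf y, le_rfl]
  have card_verts : (cycleVerts f).card = m + 3 := by
    rw [cycleVerts, Finset.card_image_of_injective _ hf, Finset.card_univ, Fintype.card_fin]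
  rw [Finset.prod_ite, Finset.prod_const, Finset.prod_const, card_steps, card_free,
    card_verts] at walks
  refine (Finset.card_le_card_of_injOn (fun b : Fin (m + 3) ↪ V => (b : Fin (m + 3) → V))
    (fun b hb => ?_) DFunLike.coe_injective.injOn).trans walks
  simp only [Finset.coe_filter, Finset.mem_univ, true_and, Set.mem_ofPred_eq] at hb ⊢
  refine ⟨mem_cycleVerts_of_mem_cycleEdges (hb 0 h0) (by simp [cycleEdge]), fun i => ?_⟩
  split_ifs with hi
  · simpa only [mem_nbrs, cycleEdge, Fin.coeSucc_eq_succ] using hb _ hi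
  · exact Finset.mem_univ _

lemma card_cycles_le {f : Fin (m + 3) → V} (hf : Function.Injective f) {T : Finset (Fin (m + 3))}
    (hT : T.Nonempty) (hT' : T ≠ Finset.univ) :
    ({b | ∀ j ∈ T, cycleEdge b j ∈ cycleEdges f} : Finset (Fin (m + 3) ↪ V)).card ≤
      (m + 3) * (2 ^ T.card * Fintype.card V ^ (m + 2 - T.card)) := by
  obtain ⟨r, hr, hr'⟩ : ∃ r, r ∉ T ∧ r + 1 ∈ T := by
    by_contra! hc
    obtain ⟨j, hj⟩ : ∃ j, j ∉ T := by simpa [Finset.eq_univ_iff_forall] using hT'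
    obtain ⟨i, hi⟩ := hT
    exact forall_fin_of_add_one (P := (· ∉ T)) hj hc i hi
  let rotate := Equiv.addRight (r + 1)
  have mem_map (j : Fin (m + 3)) : j ∈ T.map rotate.symm.toEmbedding ↔ j + (r + 1) ∈ T := by
    rw [Finset.mem_map_equiv]
    rfl
  have last_add : Fin.last (m + 2) + (r + 1) = r := by
    rw [add_comm r 1, ← add_assoc, Fin.last_add_one, zero_add]
  have rotated := card_cycles_le_of_last_notMem hf (T := T.map rotate.symm.toEmbedding)
    (by rwa [mem_map, zero_add]) (by rwa [mem_map, last_add])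
  rw [Finset.card_map] at rotated
  refine (Finset.card_le_card_of_injOn (rotate.toEmbedding.trans ·) (fun b hb => ?_)
    fun b _ b' _ hbb' => ?_).trans rotated
  · simp only [Finset.coe_filter, Finset.mem_univ, true_and, Set.mem_ofPred_eq, mem_map] at hb ⊢
    intro j hj
    have := hb _ hj
    rwa [cycleEdge, add_right_comm] at this
  · ext j
    simpa [rotate] using DFunLike.congr_fun hbb' (rotate.symm j)

end Counting

section MixedSum

variable {V : Type*} [Fintype V] {m : ℕ}

/-- The part of the normalized cycle sum of `x + y` in which the positions in `S` carry the weights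
`x` and the other ones the weights `y`. -/
noncomputable def mixedSum (S : Finset (Fin (m + 3))) (x y : Sym2 V → ℝ) : ℝ :=
  (√(Fintype.card V))⁻¹ ^ (m + 3) * ∑ a : Fin (m + 3) ↪ V,
    (∏ j ∈ S, x (cycleEdge a j)) * ∏ j ∈ Sᶜ, y (cycleEdge a j)

lemma mixedSum_univ (x y : Sym2 V → ℝ) :
    mixedSum (Finset.univ : Finset (Fin (m + 3))) x y = cycleSum m x := by
  simp [mixedSum, cycleSum, cycleProd]

lemma mixedSum_empty (x y : Sym2 V → ℝ) :
    mixedSum (∅ : Finset (Fin (m + 3))) x y = cycleSum m y := by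
  simp [mixedSum, cycleSum, cycleProd]

lemma cycleSum_add (x y : Sym2 V → ℝ) :
    cycleSum m (x + y) = ∑ S : Finset (Fin (m + 3)), mixedSum S x y := by
  simp only [cycleSum, mixedSum, cycleProd, Pi.add_apply, Finset.prod_add, Finset.powerset_univ,
    ← Finset.compl_eq_univ_sdiff, ← Finset.mul_sum]
  rw [Finset.sum_comm]

variable (m) in
/-- The sets of positions for which both kinds of weights occur. -/
def properPositions : Finset (Finset (Fin (m + 3))) := {S | S.Nonempty ∧ S ≠ Finset.univ}

lemma card_properPositions_le : (properPositions m).card ≤ 2 ^ (m + 3) := by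
  simpa using Finset.card_le_univ (properPositions m)

lemma cycleSum_add_sub_sub (x y : Sym2 V → ℝ) :
    cycleSum m (x + y) - cycleSum m x - cycleSum m y =
      ∑ S ∈ properPositions m, mixedSum S x y := by
  have compl_eq : (properPositions m)ᶜ = {∅, Finset.univ} := by
    ext S
    simp only [properPositions, Finset.mem_compl, Finset.mem_filter, Finset.mem_univ, true_and,
      Finset.mem_insert, Finset.mem_singleton, not_and_or, not_not,
      Finset.not_nonempty_iff_eq_empty]
  rw [cycleSum_add, ← Finset.sum_add_sum_compl (properPositions m), compl_eq,
    Finset.sum_pair Finset.univ_nonempty.ne_empty.symm, mixedSum_univ, mixedSum_empty]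
  ring

end MixedSum

section Signal

variable {V Ω : Type*} [Fintype V] [MeasurableSpace Ω] [Finite Ω] [MeasurableSingletonClass Ω]
  {P : Measure Ω} {X : Sym2 V → Ω → ℝ} {y : Sym2 V → ℝ} {ρ ε Θ : ℝ} {m : ℕ}

namespace IsNoise

lemma integral_mixedSum_sq (h : IsNoise X P ρ ε) (S : Finset (Fin (m + 3))) (y : Sym2 V → ℝ) :
    ∫ ω, mixedSum S (X · ω) y ^ 2 ∂P = (Fintype.card V : ℝ)⁻¹ ^ (m + 3) *
      ∑ a : Fin (m + 3) ↪ V, ∑ b : Fin (m + 3) ↪ V,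
        (∏ j ∈ Sᶜ, y (cycleEdge a j)) * (∏ j ∈ Sᶜ, y (cycleEdge b j)) *
          ∫ ω, (∏ j ∈ S, X (cycleEdge a j) ω) * ∏ j ∈ S, X (cycleEdge b j) ω ∂P := by
  have := h.isProbabilityMeasure
  simp only [mixedSum, mul_pow, integral_const_mul,
    pow_right_comm _ (m + 3) 2, inv_pow _ 2, Real.sq_sqrt (Nat.cast_nonneg (Fintype.card V))]
  congr 1
  simp only [sq, Finset.sum_mul_sum]
  rw [integral_finsetSum _ fun _ _ => .of_finite]
  refine Finset.sum_congr rfl fun a _ => ?_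
  rw [integral_finsetSum _ fun _ _ => .of_finite]
  refine Finset.sum_congr rfl fun b _ => ?_
  rw [← integral_const_mul]
  exact integral_congr_ae (.of_forall fun ω => by ring)

omit [Fintype V] in
lemma abs_integral_prod_positions_le [DecidableEq V] (h : IsNoise X P ρ ε) (a b : Fin (m + 3) ↪ V)
    (S : Finset (Fin (m + 3))) :
    |∫ ω, (∏ j ∈ S, X (cycleEdge a j) ω) * ∏ j ∈ S, X (cycleEdge b j) ω ∂P| ≤
      if ∀ j ∈ S, cycleEdge b j ∈ cycleEdges a then 2 ^ S.card else 0 := by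
  have prod_eq (c : Fin (m + 3) ↪ V) (ω : Ω) :
      ∏ j ∈ S, X (cycleEdge c j) ω = ∏ e ∈ S.image (cycleEdge c), X e ω :=
    (Finset.prod_image (f := fun e => X e ω) (cycleEdge_injective c.injective).injOn).symm
  simp only [prod_eq]
  by_cases hab : S.image (cycleEdge a) = S.image (cycleEdge b)
  · have hmem : ∀ j ∈ S, cycleEdge b j ∈ cycleEdges a := fun j hj =>
      Finset.image_subset_image (Finset.subset_univ S)
        (hab ▸ Finset.mem_image_of_mem (cycleEdge b) hj)
    simp only [if_pos hmem, ← hab, ← sq]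
    rw [h.integral_prod_sq, Finset.abs_prod]
    refine (Finset.prod_le_prod (fun _ _ => abs_nonneg _)
      fun e _ => h.abs_integral_sq_le e).trans_eq ?_
    rw [Finset.prod_const,
      Finset.card_image_of_injective S (cycleEdge_injective a.injective)]
  · rw [h.integral_prod_mul_prod_eq_zero hab, abs_zero]
    positivity

lemma sum_abs_integral_prod_positions_le (h : IsNoise X P ρ ε) (a : Fin (m + 3) ↪ V)
    {S : Finset (Fin (m + 3))} (hS : S ∈ properPositions m) :
    ∑ b : Fin (m + 3) ↪ V,
        |∫ ω, (∏ j ∈ S, X (cycleEdge a j) ω) * ∏ j ∈ S, X (cycleEdge b j) ω ∂P| ≤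
      (m + 3 : ℕ) * (4 ^ S.card * (Fintype.card V : ℝ) ^ (m + 2 - S.card)) := by
  classical
  obtain ⟨hS, hS'⟩ := (Finset.mem_filter.1 hS).2
  have count : ((({b | ∀ j ∈ S, cycleEdge b j ∈ cycleEdges a} : Finset (Fin (m + 3) ↪ V)).card : ℕ)
      : ℝ) ≤ (m + 3 : ℕ) * (2 ^ S.card * (Fintype.card V : ℝ) ^ (m + 2 - S.card)) := by
    exact_mod_cast card_cycles_le a.injective hS hS'
  calc _ ≤ ∑ b : Fin (m + 3) ↪ V,
        if ∀ j ∈ S, cycleEdge b j ∈ cycleEdges a then (2 : ℝ) ^ S.card else 0 :=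
        Finset.sum_le_sum fun b _ => h.abs_integral_prod_positions_le a b S
    _ = (({b | ∀ j ∈ S, cycleEdge b j ∈ cycleEdges a} : Finset (Fin (m + 3) ↪ V)).card : ℕ) *
        2 ^ S.card := by
        rw [← Finset.sum_filter, Finset.sum_const, nsmul_eq_mul]
    _ ≤ (m + 3 : ℕ) * (2 ^ S.card * (Fintype.card V : ℝ) ^ (m + 2 - S.card)) * 2 ^ S.card := by
        gcongr
    _ = _ := by
        rw [show (4 : ℝ) = 2 * 2 by norm_num, mul_pow]
        ring

lemma sum_mixed_terms_le [Nonempty V] (h : IsNoise X P ρ ε) (hΘ : 1 ≤ Θ)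
    (hy : ∀ e, |y e| ≤ Θ / √(Fintype.card V)) {S : Finset (Fin (m + 3))}
    (hS : S ∈ properPositions m) (a : Fin (m + 3) ↪ V) :
    ∑ b : Fin (m + 3) ↪ V, (∏ j ∈ Sᶜ, y (cycleEdge a j)) * (∏ j ∈ Sᶜ, y (cycleEdge b j)) *
        ∫ ω, (∏ j ∈ S, X (cycleEdge a j) ω) * ∏ j ∈ S, X (cycleEdge b j) ω ∂P ≤
      (Θ ^ (m + 3)) ^ 2 * ((m + 3 : ℕ) * 4 ^ (m + 3)) / Fintype.card V := by
  have hn : (0 : ℝ) < Fintype.card V := by exact_mod_cast Fintype.card_pos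
  obtain ⟨d, hd⟩ : ∃ d, m + 3 = S.card + (d + 1) := by
    have := Finset.card_lt_card (Finset.ssubset_univ_iff.2 (Finset.mem_filter.1 hS).2.2)
    rw [Finset.card_univ, Fintype.card_fin] at this
    exact ⟨m + 2 - S.card, by lia⟩
  have prod_y_le (b : Fin (m + 3) ↪ V) :
      |∏ j ∈ Sᶜ, y (cycleEdge b j)| ≤ (Θ / √(Fintype.card V)) ^ (d + 1) := by
    rw [Finset.abs_prod]
    refine (Finset.prod_le_prod (fun _ _ => abs_nonneg _) fun j _ => hy _).trans_eq ?_
    rw [Finset.prod_const, Finset.card_compl, Fintype.card_fin]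
    congr 1
    lia
  calc _ ≤ ∑ b : Fin (m + 3) ↪ V, (Θ ^ 2 / Fintype.card V) ^ (d + 1) *
        |∫ ω, (∏ j ∈ S, X (cycleEdge a j) ω) * ∏ j ∈ S, X (cycleEdge b j) ω ∂P| := by
        refine Finset.sum_le_sum fun b _ => (le_abs_self _).trans ?_
        rw [abs_mul, abs_mul, ← Real.sq_sqrt hn.le, ← div_pow, sq (Θ / _), mul_pow]
        gcongr
        exacts [prod_y_le a, prod_y_le b]
    _ ≤ (Θ ^ 2 / Fintype.card V) ^ (d + 1) *
        ((m + 3 : ℕ) * (4 ^ S.card * (Fintype.card V : ℝ) ^ d)) := by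
        rw [← Finset.mul_sum]
        have := h.sum_abs_integral_prod_positions_le a hS
        rw [show m + 2 - S.card = d by lia] at this
        gcongr
    _ = Θ ^ ((d + 1) * 2) * ((m + 3 : ℕ) * 4 ^ S.card) / Fintype.card V := by
        rw [div_pow, ← pow_mul, mul_comm 2, pow_succ (Fintype.card V : ℝ)]
        field_simp
    _ ≤ _ := by
        have signal_le : Θ ^ ((d + 1) * 2) ≤ Θ ^ ((m + 3) * 2) := pow_le_pow_right₀ hΘ (by lia)
        have four_pow_le : (4 : ℝ) ^ S.card ≤ 4 ^ (m + 3) :=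
          pow_le_pow_right₀ (by norm_num) (by lia)
        rw [← pow_mul]
        gcongr

lemma integral_mixedSum_sq_le [Nonempty V] (h : IsNoise X P ρ ε) (hΘ : 1 ≤ Θ)
    (hy : ∀ e, |y e| ≤ Θ / √(Fintype.card V)) {S : Finset (Fin (m + 3))}
    (hS : S ∈ properPositions m) :
    ∫ ω, mixedSum S (X · ω) y ^ 2 ∂P ≤
      (Θ ^ (m + 3)) ^ 2 * ((m + 3 : ℕ) * 4 ^ (m + 3)) / Fintype.card V := by
  have card_le : (Fintype.card (Fin (m + 3) ↪ V) : ℝ) ≤ (Fintype.card V : ℝ) ^ (m + 3) := by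
    rw [Fintype.card_embedding_eq, Fintype.card_fin]
    exact_mod_cast Nat.descFactorial_le_pow _ _
  rw [h.integral_mixedSum_sq, inv_pow, inv_mul_le_iff₀ (by positivity)]
  refine (Finset.sum_le_sum fun a _ => h.sum_mixed_terms_le hΘ hy hS a).trans ?_
  rw [Finset.sum_const, Finset.card_univ, nsmul_eq_mul]
  gcongr

lemma integral_sum_mixedSum_sq_le [Nonempty V] (h : IsNoise X P ρ ε) (hΘ : 1 ≤ Θ)
    (hy : ∀ e, |y e| ≤ Θ / √(Fintype.card V)) :
    ∫ ω, (∑ S ∈ properPositions m, mixedSum S (X · ω) y) ^ 2 ∂P ≤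
      (Θ ^ (m + 3)) ^ 2 * ((m + 3 : ℕ) * 16 ^ (m + 3)) / Fintype.card V := by
  have := h.isProbabilityMeasure
  have card_le : ((properPositions m).card : ℝ) ≤ 2 ^ (m + 3) := by
    exact_mod_cast card_properPositions_le
  calc _ ≤ ∫ ω, (properPositions m).card * ∑ S ∈ properPositions m, mixedSum S (X · ω) y ^ 2 ∂P :=
        integral_mono .of_finite .of_finite fun ω => sq_sum_le_card_mul_sum_sq
    _ = (properPositions m).card *
        ∑ S ∈ properPositions m, ∫ ω, mixedSum S (X · ω) y ^ 2 ∂P := by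
        rw [integral_const_mul, integral_finsetSum _ fun _ _ => .of_finite]
    _ ≤ 2 ^ (m + 3) * (2 ^ (m + 3) *
        ((Θ ^ (m + 3)) ^ 2 * ((m + 3 : ℕ) * 4 ^ (m + 3)) / Fintype.card V)) := by
        have sum_le := Finset.sum_le_sum fun S hS => h.integral_mixedSum_sq_le (m := m) hΘ hy hS
        rw [Finset.sum_const, nsmul_eq_mul] at sum_le
        gcongr
        refine sum_le.trans ?_
        gcongr
    _ = _ := by
        rw [show (16 : ℝ) = 2 * 2 * 4 by norm_num, mul_pow, mul_pow]
        ring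

end IsNoise

end Signal

section EdgeSign

variable {V : Type*} {m : ℕ}

/-- The product of the labels at the two ends of a pair: `1` if they agree, `-1` otherwise. -/
def edgeSign (τ : V → ℤˣ) (e : Sym2 V) : ℤˣ := (e.map τ).mul

@[simp]
lemma edgeSign_mk (τ : V → ℤˣ) (u v : V) : edgeSign τ s(u, v) = τ u * τ v := rfl

lemma prod_edgeSign_cycleEdge (τ : V → ℤˣ) (a : Fin (m + 3) → V) :
    ∏ j, edgeSign τ (cycleEdge a j) = 1 := by
  have prod_succ : ∏ j, τ (a (j + 1)) = ∏ j, τ (a j) :=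
    Equiv.prod_comp (Equiv.addRight (1 : Fin (m + 3))) fun j => τ (a j)
  simp only [cycleEdge, edgeSign_mk, Finset.prod_mul_distrib, prod_succ, Int.units_mul_self]

variable [Fintype V]

/-- The deterministic weights `θ / √|V|` with the sign of the labels; the normalization makes the
normalized cycle sum of length `k` close to `θ ^ k`. -/
noncomputable def signalWeight (θ : ℝ) (τ : V → ℤˣ) (e : Sym2 V) : ℝ :=
  θ / √(Fintype.card V) * ((edgeSign τ e : ℤ) : ℝ)

lemma abs_signalWeight (θ : ℝ) (τ : V → ℤˣ) (e : Sym2 V) :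
    |signalWeight θ τ e| = |θ| / √(Fintype.card V) := by
  rw [signalWeight, abs_mul, abs_unit_intCast, mul_one, abs_div, abs_of_nonneg (Real.sqrt_nonneg _)]

lemma cycleProd_signalWeight (θ : ℝ) (τ : V → ℤˣ) (a : Fin (m + 3) → V) :
    cycleProd a (signalWeight θ τ) = (θ / √(Fintype.card V)) ^ (m + 3) := by
  have prod_cast : ∏ j, ((edgeSign τ (cycleEdge a j) : ℤ) : ℝ) = 1 := by
    rw [← Int.cast_prod, ← Units.coe_prod, prod_edgeSign_cycleEdge, Units.val_one, Int.cast_one]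
  simp only [cycleProd, signalWeight]
  rw [Finset.prod_mul_distrib, prod_cast, Finset.prod_const, Finset.card_univ, Fintype.card_fin,
    mul_one]

lemma cycleSum_signalWeight (θ : ℝ) (τ : V → ℤˣ) :
    cycleSum m (signalWeight θ τ) = θ ^ (m + 3) *
      ((Fintype.card V).descFactorial (m + 3) / (Fintype.card V : ℝ) ^ (m + 3)) := by
  have inv_sqrt_pow : (√(Fintype.card V : ℝ))⁻¹ ^ (m + 3) * (√(Fintype.card V : ℝ))⁻¹ ^ (m + 3) =
      ((Fintype.card V : ℝ) ^ (m + 3))⁻¹ := by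
    rw [← mul_pow, ← mul_inv, Real.mul_self_sqrt (by positivity), inv_pow]
  simp only [cycleSum, cycleProd_signalWeight]
  rw [Finset.sum_const, Finset.card_univ, Fintype.card_embedding_eq, Fintype.card_fin,
    nsmul_eq_mul, div_eq_mul_inv, div_eq_mul_inv, ← inv_sqrt_pow, mul_pow]
  ring

lemma abs_cycleSum_signalWeight_sub_le [Nonempty V] {θ Θ : ℝ} (hθ : |θ| ≤ Θ) (hΘ : 1 ≤ Θ)
    (τ : V → ℤˣ) {M : ℕ} (hm : m + 3 ≤ M) :
    |cycleSum m (signalWeight θ τ) - θ ^ (m + 3)| ≤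
      Θ ^ M * ((M : ℝ) ^ 2 / Fintype.card V) := by
  set d : ℝ := (Fintype.card V).descFactorial (m + 3) / (Fintype.card V : ℝ) ^ (m + 3)
  have d_le_one : d ≤ 1 := div_le_one_of_le₀
    (by exact_mod_cast Nat.descFactorial_le_pow _ _) (by positivity)
  have le_d : 1 - ((m + 3 : ℕ) : ℝ) ^ 2 / Fintype.card V ≤ d :=
    one_sub_le_descFactorial_div _ Fintype.card_pos
  have abs_le : |d - 1| ≤ (M : ℝ) ^ 2 / Fintype.card V := by
    rw [abs_sub_comm, abs_of_nonneg (by linarith)]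
    calc 1 - d ≤ ((m + 3 : ℕ) : ℝ) ^ 2 / Fintype.card V := by linarith
      _ ≤ _ := by gcongr
  have pow_le : |θ| ^ (m + 3) ≤ Θ ^ M :=
    (pow_le_pow_left₀ (abs_nonneg _) hθ _).trans (pow_le_pow_right₀ hΘ hm)
  rw [cycleSum_signalWeight, ← mul_sub_one, abs_mul, abs_pow]
  exact mul_le_mul pow_le abs_le (abs_nonneg _) ((by positivity : 0 ≤ |θ| ^ (m + 3)).trans pow_le)

end EdgeSign

section CharacteristicFunction

lemma norm_cexp_I_mul_sub_cexp_I_mul_le (x y : ℝ) :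
    ‖Complex.exp (Complex.I * x) - Complex.exp (Complex.I * y)‖ ≤ |x - y| := by
  have exp_sub_exp : Complex.exp (Complex.I * x) - Complex.exp (Complex.I * y) =
      Complex.exp (Complex.I * y) * (Complex.exp (Complex.I * (x - y : ℝ)) - 1) := by
    rw [mul_sub_one, ← Complex.exp_add, ← mul_add, ← Complex.ofReal_add, add_sub_cancel]
  rw [exp_sub_exp, norm_mul, Complex.norm_exp_I_mul_ofReal, one_mul]
  exact Real.norm_exp_I_mul_ofReal_sub_one_le

variable (V : Type*) {ι : Type*} [Fintype V] [Fintype ι]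

/-- The bound for the distance between the characteristic function of the normalized cycle sums of
lengths at most `M` of noise variables and that of the standard Gaussian, at the point `t`. -/
noncomputable def noiseError (ρ ε : ℝ) (M : ℕ) (t : ι → ℝ) : ℝ :=
  2 * M * (∑ i, |t i|) ^ 2 * (√(2 * quadBound V ρ (4 * M)) + meanError V ε M) +
    3 * (M * (∑ i, t i ^ 2) * (Fintype.card ι * √(quadBound V ρ (4 * M)) *
      (1 + meanError V ε M + (∑ i, t i ^ 2) * Fintype.card ι)))

/-- The bound for the effect on the characteristic function at `t` of adding a signal of strength
at most `Θ` to the noise and subtracting the powers of the signal strength from the cycle sums. -/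
noncomputable def signalError (Θ : ℝ) (M : ℕ) (t : ι → ℝ) : ℝ :=
  (∑ i, |t i|) * (Θ ^ M * ((M : ℝ) ^ 2 / Fintype.card V) +
    √((Θ ^ M) ^ 2 * (M * 16 ^ M) / Fintype.card V))

end CharacteristicFunction

namespace IsNoise

variable {V Ω ι : Type*} [Fintype V] [Nonempty V] [MeasurableSpace Ω] [Finite Ω]
  [MeasurableSingletonClass Ω] [Fintype ι] {P : Measure Ω} {X : Sym2 V → Ω → ℝ} {ρ ε θ Θ : ℝ}
  {M : ℕ}

lemma integral_abs_cycleSum_add_signalWeight_sub_le (h : IsNoise X P ρ ε) (hθ : |θ| ≤ Θ)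
    (hΘ : 1 ≤ Θ) (τ : V → ℤˣ) {m : ℕ} (hm : m + 3 ≤ M) :
    ∫ ω, |cycleSum m ((X · ω) + signalWeight θ τ) - θ ^ (m + 3) - cycleSum m (X · ω)| ∂P ≤
      Θ ^ M * ((M : ℝ) ^ 2 / Fintype.card V) +
        √((Θ ^ M) ^ 2 * (M * 16 ^ M) / Fintype.card V) := by
  have := h.isProbabilityMeasure
  have weight_le (e : Sym2 V) : |signalWeight θ τ e| ≤ Θ / √(Fintype.card V) := by
    rw [abs_signalWeight]
    gcongr
  set mixed : Ω → ℝ := fun ω => ∑ S ∈ properPositions m, mixedSum S (X · ω) (signalWeight θ τ)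
  have integral_mixed_sq_le :
      ∫ ω, mixed ω ^ 2 ∂P ≤ (Θ ^ M) ^ 2 * (M * 16 ^ M) / Fintype.card V := by
    have signal_le : Θ ^ (m + 3) ≤ Θ ^ M := pow_le_pow_right₀ hΘ hm
    have sixteen_pow_le : (16 : ℝ) ^ (m + 3) ≤ 16 ^ M := pow_le_pow_right₀ (by norm_num) hm
    refine (h.integral_sum_mixedSum_sq_le hΘ weight_le).trans ?_
    gcongr
  calc _ ≤ ∫ ω, |cycleSum m (signalWeight θ τ) - θ ^ (m + 3)| + |mixed ω| ∂P := by
        refine integral_mono .of_finite .of_finite fun ω => le_trans (le_of_eq ?_) (abs_add_le _ _)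
        simp only [mixed]
        rw [← cycleSum_add_sub_sub]
        congr 1
        ring
    _ = |cycleSum m (signalWeight θ τ) - θ ^ (m + 3)| + ∫ ω, |mixed ω| ∂P := by
        rw [integral_add .of_finite .of_finite, integral_const, probReal_univ, one_smul]
    _ ≤ _ := add_le_add (abs_cycleSum_signalWeight_sub_le hθ hΘ τ hm)
        ((integral_abs_le_sqrt .of_discrete).trans (Real.sqrt_le_sqrt integral_mixed_sq_le))

lemma norm_integral_cexp_sub_integral_cexp_le (h : IsNoise X P ρ ε) (hθ : |θ| ≤ Θ) (hΘ : 1 ≤ Θ)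
    (τ : V → ℤˣ) {m : ι → ℕ} (hmM : ∀ i, m i + 3 ≤ M) (t : ι → ℝ) :
    ‖∫ ω, Complex.exp (Complex.I * (∑ i, gaussianCoeff t m i *
          (cycleSum (m i) ((X · ω) + signalWeight θ τ) - θ ^ (m i + 3)) : ℝ)) ∂P -
        ∫ ω, Complex.exp (Complex.I * cycleForm (gaussianCoeff t m) m (X · ω)) ∂P‖ ≤
      signalError V Θ M t := by
  have := h.isProbabilityMeasure
  rw [← integral_sub .of_finite .of_finite]
  calc _ ≤ ∫ ω, ∑ i, |t i| *
        |cycleSum (m i) ((X · ω) + signalWeight θ τ) - θ ^ (m i + 3) - cycleSum (m i) (X · ω)|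
          ∂P := by
        refine norm_integral_le_of_norm_le .of_finite (.of_forall fun ω =>
          (norm_cexp_I_mul_sub_cexp_I_mul_le _ _).trans ?_)
        rw [cycleForm, ← Finset.sum_sub_distrib]
        refine (Finset.abs_sum_le_sum_abs _ _).trans (Finset.sum_le_sum fun i _ => ?_)
        rw [← mul_sub, abs_mul]
        exact mul_le_mul_of_nonneg_right (abs_gaussianCoeff_le t m i) (abs_nonneg _)
    _ = ∑ i, |t i| * ∫ ω,
        |cycleSum (m i) ((X · ω) + signalWeight θ τ) - θ ^ (m i + 3) - cycleSum (m i) (X · ω)|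
          ∂P := by
        rw [integral_finsetSum _ fun _ _ => .of_finite]
        simp only [integral_const_mul]
    _ ≤ signalError V Θ M t := by
        rw [signalError, Finset.sum_mul]
        exact Finset.sum_le_sum fun i _ => mul_le_mul_of_nonneg_left
          (h.integral_abs_cycleSum_add_signalWeight_sub_le hθ hΘ τ (hmM i)) (abs_nonneg _)

theorem norm_integral_cexp_sub_gaussian_le (h : IsNoise X P ρ ε) (hθ : |θ| ≤ Θ) (hΘ : 1 ≤ Θ)
    (τ : V → ℤˣ) {m : ι → ℕ} (hm : Function.Injective m) (hmM : ∀ i, m i + 3 ≤ M)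
    (hN : 1 ≤ √(Fintype.card V) * ρ) (hMn : ((4 * M : ℕ) : ℝ) * 2 ^ (4 * M) ≤ √(Fintype.card V))
    (t : ι → ℝ) :
    ‖∫ ω, Complex.exp (Complex.I * (∑ i, gaussianCoeff t m i *
          (cycleSum (m i) ((X · ω) + signalWeight θ τ) - θ ^ (m i + 3)) : ℝ)) ∂P -
        Complex.exp (-(∑ i, t i ^ 2 : ℝ) / 2)‖ ≤
      signalError V Θ M t + noiseError V ρ ε M t :=
  (norm_sub_le_norm_sub_add_norm_sub _ _ _).trans (add_le_add
    (h.norm_integral_cexp_sub_integral_cexp_le hθ hΘ τ hmM t)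
    (h.norm_integral_cexp_cycleForm_sub_le hm hmM hN hMn t))

end IsNoise

/-! ### Asymptotics of the errors -/

section PowMul

variable {α : Type*} {f : Filter α} {M : α → ℕ} {x : α → ℝ}

lemma tendsto_pow_mul_zero (hx0 : ∀ᶠ n in f, 0 < x n) (hx : Tendsto x f (𝓝 0))
    (hM : (fun n => (M n : ℝ)) =o[f] fun n => Real.log (x n)) {D : ℝ} (hD : 1 ≤ D) :
    Tendsto (fun n => D ^ M n * x n) f (𝓝 0) := by
  have log_nonneg := Real.log_nonneg hD
  have sqrt_tendsto : Tendsto (fun n => √(x n)) f (𝓝 0) := by simpa using hx.sqrt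
  have bound_pos : (0 : ℝ) < 1 / (2 * (Real.log D + 1)) := by positivity
  refine squeeze_zero' ?_ ?_ sqrt_tendsto
  · filter_upwards [hx0] with n hn
    positivity
  filter_upwards [hx0, hx.eventually_lt_const one_pos, hM.bound bound_pos] with n hn hn1 hMn
  have log_neg : Real.log (x n) < 0 := Real.log_neg hn hn1
  rw [Real.norm_of_nonneg (Nat.cast_nonneg _), Real.norm_of_nonpos log_neg.le] at hMn
  have mul_log_le : M n * Real.log D ≤ -Real.log (x n) / 2 := by
    calc M n * Real.log D
        ≤ (1 / (2 * (Real.log D + 1)) * -Real.log (x n)) * (Real.log D + 1) :=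
          mul_le_mul hMn (by linarith) log_nonneg (mul_nonneg bound_pos.le (by linarith))
      _ = -Real.log (x n) / 2 := by field_simp
  rw [← Real.log_le_log_iff (by positivity) (by positivity), Real.log_mul (by positivity) hn.ne',
    Real.log_pow, Real.log_sqrt hn.le]
  linarith

lemma tendsto_natCast_pow_mul_pow_mul_zero (hx0 : ∀ᶠ n in f, 0 < x n) (hx : Tendsto x f (𝓝 0))
    (hM : (fun n => (M n : ℝ)) =o[f] fun n => Real.log (x n)) (j : ℕ) {D : ℝ} (hD : 1 ≤ D) :
    Tendsto (fun n => (M n : ℝ) ^ j * D ^ M n * x n) f (𝓝 0) := by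
  have natCast_pow_le (k : ℕ) : (k : ℝ) ^ j ≤ (2 ^ j) ^ k := by
    rw [pow_right_comm]
    exact pow_le_pow_left₀ (Nat.cast_nonneg _) (by exact_mod_cast Nat.lt_two_pow_self.le) _
  refine squeeze_zero' ?_ ?_ (tendsto_pow_mul_zero hx0 hx hM (D := 2 ^ j * D) ?_)
  · filter_upwards [hx0] with n hn
    positivity
  · filter_upwards [hx0] with n hn
    rw [mul_pow]
    gcongr
    exact natCast_pow_le _
  · exact one_le_mul_of_one_le_of_one_le (one_le_pow₀ one_le_two) hD

end PowMul

section Errors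

variable {ι : Type*} [Fintype ι] {ρ : ℕ → ℝ} {M : ℕ → ℕ} {D Θ : ℝ}

lemma tendsto_natCast_pow_mul_pow_mul_inv_zero (hρ : ∀ᶠ n in atTop, 0 < ρ n)
    (hx : Tendsto (fun n : ℕ => (√n * ρ n)⁻¹) atTop (𝓝 0))
    (hM : (fun n => (M n : ℝ)) =o[atTop] fun n : ℕ => Real.log (√n * ρ n)⁻¹) (j : ℕ)
    (hD : 1 ≤ D) :
    Tendsto (fun n => (M n : ℝ) ^ j * D ^ M n * (√n * ρ n)⁻¹) atTop (𝓝 0) := by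
  refine tendsto_natCast_pow_mul_pow_mul_zero ?_ hx hM j hD
  filter_upwards [hρ, eventually_gt_atTop 0] with n hn hn0
  positivity

lemma tendsto_natCast_pow_mul_pow_div_zero (hρ : ∀ᶠ n in atTop, ρ n ∈ Set.Ioc 0 1)
    (hx : Tendsto (fun n : ℕ => (√n * ρ n)⁻¹) atTop (𝓝 0))
    (hM : (fun n => (M n : ℝ)) =o[atTop] fun n : ℕ => Real.log (√n * ρ n)⁻¹) (j : ℕ)
    (hD : 1 ≤ D) :
    Tendsto (fun n : ℕ => (M n : ℝ) ^ j * D ^ M n / n) atTop (𝓝 0) := by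
  refine squeeze_zero' (.of_forall fun n => by positivity) ?_
    (tendsto_natCast_pow_mul_pow_mul_inv_zero (hρ.mono fun _ h => h.1) hx hM j hD)
  filter_upwards [hρ, eventually_ge_atTop 1] with n ⟨hρ0, hρ1⟩ hn
  have one_le : (1 : ℝ) ≤ n := by exact_mod_cast hn
  have sqrt_mul_le : √n * ρ n ≤ n := (mul_le_of_le_one_right (Real.sqrt_nonneg _) hρ1).trans
    (Real.sqrt_le_self_iff.2 (.inr one_le))
  rw [div_eq_mul_inv]
  gcongr

lemma tendsto_natCast_pow_mul_quadBound (hρ : ∀ᶠ n in atTop, 0 < ρ n)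
    (hx : Tendsto (fun n : ℕ => (√n * ρ n)⁻¹) atTop (𝓝 0))
    (hM : (fun n => (M n : ℝ)) =o[atTop] fun n : ℕ => Real.log (√n * ρ n)⁻¹) (j : ℕ) :
    Tendsto (fun n => (M n : ℝ) ^ j * quadBound (Fin n) (ρ n) (4 * M n)) atTop (𝓝 0) := by
  have tendsto_zero := (tendsto_natCast_pow_mul_pow_mul_inv_zero hρ hx hM (j + 4)
    (D := 12 ^ 4) (by norm_num)).const_mul 256
  rw [mul_zero] at tendsto_zero
  refine tendsto_zero.congr fun n => ?_
  rw [quadBound, Fintype.card_fin, pow_mul, pow_add]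
  push_cast
  ring

lemma tendsto_natCast_pow_mul_meanError (hρ : ∀ᶠ n in atTop, ρ n ∈ Set.Ioc 0 1)
    (hx : Tendsto (fun n : ℕ => (√n * ρ n)⁻¹) atTop (𝓝 0))
    (hM : (fun n => (M n : ℝ)) =o[atTop] fun n : ℕ => Real.log (√n * ρ n)⁻¹) (j : ℕ) (Θ : ℝ) :
    Tendsto (fun n : ℕ => (M n : ℝ) ^ j * meanError (Fin n) (Θ * (√n * ρ n)⁻¹) (M n)) atTop
      (𝓝 0) := by
  have tendsto_zero := ((tendsto_natCast_pow_mul_pow_mul_inv_zero (hρ.mono fun _ h => h.1) hx hM j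
    one_le_two).const_mul Θ).add (tendsto_natCast_pow_mul_pow_div_zero hρ hx hM (j + 2) le_rfl)
  rw [mul_zero, zero_add] at tendsto_zero
  refine tendsto_zero.congr fun n => ?_
  rw [meanError, Fintype.card_fin, one_pow, pow_add]
  ring

lemma tendsto_noiseError (hρ : ∀ᶠ n in atTop, ρ n ∈ Set.Ioc 0 1)
    (hx : Tendsto (fun n : ℕ => (√n * ρ n)⁻¹) atTop (𝓝 0))
    (hM : (fun n => (M n : ℝ)) =o[atTop] fun n : ℕ => Real.log (√n * ρ n)⁻¹) (Θ : ℝ)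
    (t : ι → ℝ) :
    Tendsto (fun n : ℕ => noiseError (Fin n) (ρ n) (Θ * (√n * ρ n)⁻¹) (M n) t) atTop (𝓝 0) := by
  have natCast_mul_sqrt (k : ℕ) (y : ℝ) : (k : ℝ) * √y = √((k : ℝ) ^ 2 * y) := by
    rw [Real.sqrt_mul (by positivity), Real.sqrt_sq (by positivity)]
  have sqrt_quad : Tendsto (fun n => (M n : ℝ) * √(quadBound (Fin n) (ρ n) (4 * M n))) atTop
      (𝓝 0) := by
    simp only [natCast_mul_sqrt]
    simpa using (tendsto_natCast_pow_mul_quadBound (hρ.mono fun _ h => h.1) hx hM 2).sqrt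
  have mean := tendsto_natCast_pow_mul_meanError hρ hx hM 0 Θ
  have mul_mean := tendsto_natCast_pow_mul_meanError hρ hx hM 1 Θ
  simp only [pow_zero, one_mul, pow_one] at mean mul_mean
  have noise := (((sqrt_quad.const_mul √2).add mul_mean).const_mul (2 * (∑ i, |t i|) ^ 2)).add
    ((sqrt_quad.const_mul (3 * ((∑ i, t i ^ 2) * Fintype.card ι))).mul
      ((mean.const_add 1).add_const ((∑ i, t i ^ 2) * Fintype.card ι)))
  simp only [mul_zero, zero_mul, add_zero] at noise
  refine noise.congr fun n => ?_
  rw [noiseError, Real.sqrt_mul zero_le_two]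
  ring

lemma tendsto_signalError (hρ : ∀ᶠ n in atTop, ρ n ∈ Set.Ioc 0 1)
    (hx : Tendsto (fun n : ℕ => (√n * ρ n)⁻¹) atTop (𝓝 0))
    (hM : (fun n => (M n : ℝ)) =o[atTop] fun n : ℕ => Real.log (√n * ρ n)⁻¹)
    (hΘ : 1 ≤ Θ) (t : ι → ℝ) :
    Tendsto (fun n : ℕ => signalError (Fin n) Θ (M n) t) atTop (𝓝 0) := by
  have mean := tendsto_natCast_pow_mul_pow_div_zero hρ hx hM 2 hΘ
  have mixed := (tendsto_natCast_pow_mul_pow_div_zero hρ hx hM 1 (D := Θ ^ 2 * 16)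
    (by nlinarith)).sqrt
  have error := (mean.add mixed).const_mul (∑ i, |t i|)
  simp only [Real.sqrt_zero, add_zero, mul_zero] at error
  refine error.congr fun n => ?_
  rw [signalError, Fintype.card_fin, mul_pow, pow_right_comm Θ 2, pow_one]
  ring_nf

end Errors

/-! ### The stochastic block model -/

section Law

instance {V : Type*} [Countable V] : MeasurableSingletonClass (SimpleGraph V) where
  measurableSet_singleton G := by
    have preimage_eq : ({G} : Set (SimpleGraph V)) = SimpleGraph.edgeSet ⁻¹' {G.edgeSet} :=
      Set.ext fun _ => SimpleGraph.edgeSet_inj.symm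
    rw [preimage_eq]
    exact SimpleGraph.measurable_edgeSet (measurableSet_singleton _)

instance : MeasurableSingletonClass ℤˣ where
  measurableSet_singleton u := by
    have preimage_eq : ({u} : Set ℤˣ) = Units.val ⁻¹' {(u : ℤ)} := Set.ext fun _ => Units.ext_iff
    rw [preimage_eq]
    exact ⟨_, MeasurableSet.of_discrete, rfl⟩

variable {V : Type*} (p q : I) (τ : V → ℤˣ)

lemma edgeProb_eq (e : Sym2 V) :
    (edgeProb p q τ e : ℝ) = avgProb p q + ((p : ℝ) - q) / 2 * ((edgeSign τ e : ℤ) : ℝ) := by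
  induction e with | h x y => ?_
  simp only [edgeProb, avgProb, Sym2.lift_mk, edgeSign_mk]
  rcases Int.units_eq_one_or (τ x) with hx | hx <;>
    rcases Int.units_eq_one_or (τ y) with hy | hy <;> simp [hx, hy] <;> ring

open Classical in
/-- The indicator of a proposition, as a real number. -/
noncomputable def propInd (b : Prop) : ℝ := if b then 1 else 0

@[simp]
lemma propInd_true : propInd True = 1 := if_pos trivial

@[simp]
lemma propInd_false : propInd False = 0 := if_neg not_false

lemma propInd_mem_Icc (b : Prop) : propInd b ∈ Set.Icc 0 1 := by
  by_cases hb : b <;> simp [hb]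

lemma edgeInd_fromEdgeSet {x y : V} (h : x ≠ y) (ω : Sym2 V → Prop) :
    edgeInd (SimpleGraph.fromEdgeSet {e | ω e}) x y = propInd (ω s(x, y)) := by
  have adj_iff : (SimpleGraph.fromEdgeSet {e | ω e}).Adj x y ↔ ω s(x, y) := by
    rw [SimpleGraph.fromEdgeSet_adj]
    exact and_iff_left h
  exact congrArg propInd (propext adj_iff)

variable [Fintype V]

/-- The law of the outcomes of the tosses for all pairs of vertices, given the labels `τ`. -/
noncomputable def tossLaw : Measure (Sym2 V → Prop) :=
  Measure.pi fun e => bernoulliMeasure True False (edgeProb p q τ e)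

lemma integral_tossLaw_apply (f : Prop → ℝ) (e : Sym2 V) :
    ∫ ω, f (ω e) ∂tossLaw p q τ =
      edgeProb p q τ e * f True + (1 - edgeProb p q τ e) * f False := by
  have eval := measurePreserving_eval
    (fun e : Sym2 V => bernoulliMeasure True False (edgeProb p q τ e)) e
  rw [tossLaw, ← integral_map (f := f) eval.measurable.aemeasurable .of_discrete, eval.map_eq,
    integral_bernoulliMeasure]
  simp

lemma integral_graphLaw {F : Type*} [NormedAddCommGroup F] [NormedSpace ℝ F]
    (f : SimpleGraph V → F) :
    ∫ G, f G ∂graphLaw p q τ = ∫ ω, f (SimpleGraph.fromEdgeSet {e | ω e}) ∂tossLaw p q τ :=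
  integral_map (SimpleGraph.measurable_fromEdgeSet.comp
    MeasurableEquiv.setOfPred.measurable).aemeasurable .of_discrete

lemma integral_edgeInd_graphLaw {x y : V} (h : x ≠ y) :
    ∫ G, edgeInd G x y ∂graphLaw p q τ = edgeProb p q τ s(x, y) := by
  simp only [integral_graphLaw, edgeInd_fromEdgeSet h]
  simp [integral_tossLaw_apply]

lemma integral_sbm {F : Type*} [NormedAddCommGroup F] [NormedSpace ℝ F] (n : ℕ)
    (f : LabelledGraph n → F) :
    ∫ ω, f ω ∂sbm n p q = ((2 : ℝ) ^ n)⁻¹ • ∑ τ, ∫ G, f (τ, G) ∂graphLaw p q τ := by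
  rw [sbm, integral_smul_measure, integral_finsetSum_measure fun _ _ => .of_finite]
  congr 1
  · simp
  · refine Finset.sum_congr rfl fun τ _ => ?_
    rw [Measure.dirac_prod, integral_map (by fun_prop) .of_discrete]

end Law

section AverageConnectionProbability

variable (p q : I)

lemma sum_edgeSign_mk {V : Type*} [Fintype V] [DecidableEq V] {x y : V} (h : x ≠ y) :
    ∑ τ : V → ℤˣ, ((edgeSign τ s(x, y) : ℤ) : ℝ) = 0 := by
  have flip := Equiv.sum_comp (Equiv.mulLeft (Pi.mulSingle x (-1) : V → ℤˣ))
    fun τ => ((edgeSign τ s(x, y) : ℤ) : ℝ)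
  simp only [Equiv.coe_mulLeft, edgeSign_mk, Pi.mul_apply, Pi.mulSingle_eq_same,
    Pi.mulSingle_eq_of_ne h.symm, one_mul, neg_mul, Units.val_neg, Int.cast_neg,
    Finset.sum_neg_distrib] at flip
  exact neg_eq_self.1 flip

lemma integral_edgeInd_sbm {n : ℕ} {x y : Fin n} (h : x ≠ y) :
    ∫ ω, edgeInd ω.2 x y ∂sbm n p q = avgProb p q := by
  simp only [integral_sbm, integral_edgeInd_graphLaw p q _ h, edgeProb_eq]
  rw [Finset.sum_add_distrib, ← Finset.mul_sum, sum_edgeSign_mk h, mul_zero, add_zero,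
    Finset.sum_const, Finset.card_univ]
  simp [Fintype.card_units_int]

lemma avgConnProb_sbm {n : ℕ} (hn : 2 ≤ n) : avgConnProb (sbm n p q) = avgProb p q := by
  have two_le : (2 : ℝ) ≤ n := by exact_mod_cast hn
  have ne_zero : (n : ℝ) ≠ 0 := by linarith
  have sub_one_ne_zero : (n : ℝ) - 1 ≠ 0 := by linarith
  rw [avgConnProb, Finset.sum_congr rfl fun i _ => Finset.sum_congr rfl fun j hj =>
    integral_edgeInd_sbm p q (Finset.ne_of_mem_erase hj).symm]
  simp only [Finset.sum_const, Finset.card_erase_of_mem (Finset.mem_univ _), Finset.card_univ,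
    Fintype.card_fin, nsmul_eq_mul, Nat.cast_sub (by lia : 1 ≤ n), Nat.cast_one]
  field_simp

end AverageConnectionProbability

section EdgeNoise

/-- The standard deviation of the indicator of an edge of probability `avgProb p q`. -/
noncomputable def edgeDev (p q : I) : ℝ := √((avgProb p q : ℝ) * (1 - avgProb p q))

lemma edgeDev_sq (p q : I) : edgeDev p q ^ 2 = (avgProb p q : ℝ) * (1 - avgProb p q) :=
  Real.sq_sqrt (mul_nonneg (avgProb p q).2.1 (sub_nonneg.2 (avgProb p q).2.2))

lemma edgeDev_le_one (p q : I) : edgeDev p q ≤ 1 :=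
  Real.sqrt_le_one.2 (mul_le_one₀ (avgProb p q).2.2 (sub_nonneg.2 (avgProb p q).2.2)
    (sub_le_self _ (avgProb p q).2.1))

/-- The strength of the signal in the stochastic block model: `cycleMean n p q k` is its `k`-th
power. -/
noncomputable def signalStrength (n : ℕ) (p q : I) : ℝ := ((p : ℝ) - q) / 2 * √n / edgeDev p q

variable {V : Type*} (p q : I) (τ : V → ℤˣ)

/-- The outcome of the toss for the pair `e`, centered and divided by `edgeDev p q`. -/
noncomputable def edgeNoise (e : Sym2 V) (ω : Sym2 V → Prop) : ℝ :=
  (propInd (ω e) - edgeProb p q τ e) / edgeDev p q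

variable {p q} {ε : ℝ}

lemma abs_edgeNoise_le (e : Sym2 V) (ω : Sym2 V → Prop) :
    |edgeNoise p q τ e ω| ≤ (edgeDev p q)⁻¹ := by
  have dev_nonneg : 0 ≤ edgeDev p q := Real.sqrt_nonneg _
  rw [edgeNoise, abs_div, abs_of_nonneg dev_nonneg, div_eq_mul_inv]
  exact mul_le_of_le_one_left (by positivity)
    (Real.dist_le_of_mem_Icc_01 (propInd_mem_Icc _) (edgeProb p q τ e).2)

variable [Fintype V]

lemma iIndepFun_edgeNoise : iIndepFun (edgeNoise p q τ) (tossLaw p q τ) :=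
  iIndepFun_pi (X := fun e (b : Prop) => (propInd b - edgeProb p q τ e) / edgeDev p q)
    fun _ => Measurable.of_discrete.aemeasurable

lemma integral_edgeNoise (e : Sym2 V) : ∫ ω, edgeNoise p q τ e ω ∂tossLaw p q τ = 0 := by
  simp only [edgeNoise]
  rw [integral_tossLaw_apply p q τ fun b => (propInd b - edgeProb p q τ e) / edgeDev p q,
    propInd_true, propInd_false]
  ring

lemma integral_edgeNoise_sq_sub_one (hdev : 0 < edgeDev p q) (e : Sym2 V) :
    ∫ ω, edgeNoise p q τ e ω ^ 2 ∂tossLaw p q τ - 1 = ((p : ℝ) - q) / 2 *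
      ((edgeSign τ e : ℤ) : ℝ) * (1 - avgProb p q - edgeProb p q τ e) / edgeDev p q ^ 2 := by
  have mul_edgeSign : ((p : ℝ) - q) / 2 * ((edgeSign τ e : ℤ) : ℝ) =
      edgeProb p q τ e - avgProb p q := by
    rw [edgeProb_eq]
    ring
  simp only [edgeNoise]
  rw [integral_tossLaw_apply p q τ fun b => ((propInd b - edgeProb p q τ e) / edgeDev p q) ^ 2,
    propInd_true, propInd_false, mul_edgeSign]
  field_simp
  rw [edgeDev_sq]
  ring

lemma abs_integral_edgeNoise_sq_sub_one_le (hdev : 0 < edgeDev p q) (e : Sym2 V) :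
    |∫ ω, edgeNoise p q τ e ω ^ 2 ∂tossLaw p q τ - 1| ≤
      |((p : ℝ) - q) / 2| / edgeDev p q ^ 2 := by
  have abs_le_one : |1 - (avgProb p q : ℝ) - edgeProb p q τ e| ≤ 1 := by
    have avg := (avgProb p q).2
    have edge := (edgeProb p q τ e).2
    rw [abs_le]
    constructor <;> linarith [avg.1, avg.2, edge.1, edge.2]
  rw [integral_edgeNoise_sq_sub_one τ hdev, abs_div, abs_mul, abs_mul, abs_unit_intCast, mul_one,
    abs_of_pos (pow_pos hdev 2)]
  gcongr
  exact mul_le_of_le_one_right (abs_nonneg _) abs_le_one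

lemma isNoise_edgeNoise (hdev : 0 < edgeDev p q) (hε : |((p : ℝ) - q) / 2| / edgeDev p q ^ 2 ≤ ε)
    (hε1 : ε ≤ 1) : IsNoise (edgeNoise p q τ) (tossLaw p q τ) (edgeDev p q) ε where
  indep := iIndepFun_edgeNoise τ
  integral_eq_zero := integral_edgeNoise τ
  abs_apply_le := abs_edgeNoise_le τ
  abs_integral_sq_sub_one_le e := (abs_integral_edgeNoise_sq_sub_one_le τ hdev e).trans hε
  pos := hdev
  le_one := edgeDev_le_one p q
  eps_le_one := hε1

lemma edgeInd_fromEdgeSet_sub_avgProb {n : ℕ} (hdev : 0 < edgeDev p q) (τ : Fin n → ℤˣ)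
    {x y : Fin n} (h : x ≠ y) (ω : Sym2 (Fin n) → Prop) :
    edgeInd (SimpleGraph.fromEdgeSet {e | ω e}) x y - avgProb p q =
      edgeDev p q *
        (edgeNoise p q τ s(x, y) ω + signalWeight (signalStrength n p q) τ s(x, y)) := by
  have sqrt_pos : 0 < √(n : ℝ) := Real.sqrt_pos.2 (by exact_mod_cast x.pos)
  rw [edgeInd_fromEdgeSet h, edgeNoise, edgeProb_eq, signalWeight, signalStrength, Fintype.card_fin]
  field_simp
  ring

lemma signedCycleCount_fromEdgeSet {n : ℕ} (hdev : 0 < edgeDev p q) (τ : Fin n → ℤˣ) (m : ℕ)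
    (ω : Sym2 (Fin n) → Prop) :
    signedCycleCount (avgProb p q) (m + 3) (SimpleGraph.fromEdgeSet {e | ω e}) =
      cycleSum m ((edgeNoise p q τ · ω) + signalWeight (signalStrength n p q) τ) := by
  have scaling : (1 / √(n * (avgProb p q : ℝ) * (1 - avgProb p q))) * edgeDev p q = (√n)⁻¹ := by
    rw [mul_assoc, Real.sqrt_mul (Nat.cast_nonneg _), ← edgeDev, one_div, mul_inv,
      inv_mul_cancel_right₀ hdev.ne']
  have edge (a : Fin (m + 3) ↪ Fin n) (j : Fin (m + 3)) :=
    edgeInd_fromEdgeSet_sub_avgProb hdev τ (x := a j) (y := a (j + 1))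
      (a.injective.ne (left_ne_add.2 one_ne_zero)) ω
  simp only [signedCycleCount, cycleSum, finRotate_apply, edge, Finset.prod_mul_distrib,
    Finset.prod_const, Finset.card_univ, Fintype.card_fin]
  rw [← Finset.mul_sum, ← mul_assoc, ← mul_pow, scaling]
  rfl

end EdgeNoise

section CycleMean

variable (n : ℕ) (p q : I)

lemma coe_avgProb : (avgProb p q : ℝ) = ((p : ℝ) + q) / 2 := rfl

@[simp]
lemma avgProb_self : avgProb p p = p := Subtype.ext (add_self_div_two _)

@[simp]
lemma signal_self : signal n p p = 0 := by simp [signal]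

lemma signal_eq : signal n p q = n * ((p : ℝ) - q) ^ 2 / ((p : ℝ) + q) := by
  rcases n.eq_zero_or_pos with rfl | hn
  · simp [signal]
  · rw [signal, ← mul_sub, ← mul_add, mul_pow, sq (n : ℝ), mul_assoc,
      mul_div_mul_left _ _ (by positivity)]

lemma signalStrength_sq :
    signalStrength n p q ^ 2 = signal n p q / (2 * (1 - (avgProb p q : ℝ))) := by
  rw [signalStrength, div_pow, mul_pow, Real.sq_sqrt (Nat.cast_nonneg _), edgeDev_sq, signal_eq,
    div_div, coe_avgProb]
  generalize (p : ℝ) + q = s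
  field_simp

lemma sign_mul_abs (x : ℝ) : Real.sign x * |x| = x := by
  rcases lt_trichotomy x 0 with hx | rfl | hx
  · rw [Real.sign_of_neg hx, abs_of_neg hx, neg_one_mul, neg_neg]
  · simp
  · rw [Real.sign_of_pos hx, abs_of_pos hx, one_mul]

lemma cycleMean_eq (k : ℕ) : cycleMean n p q k = signalStrength n p q ^ k := by
  have dev_nonneg : 0 ≤ edgeDev p q := Real.sqrt_nonneg _
  rw [cycleMean, ← signalStrength_sq, Real.sqrt_sq_eq_abs, signalStrength, abs_div, abs_mul,
    abs_of_nonneg (Real.sqrt_nonneg _), abs_of_nonneg dev_nonneg, abs_div, abs_two]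
  conv_rhs => rw [← sign_mul_abs ((p : ℝ) - q)]
  ring

variable {n p q} {δ C : ℝ}

lemma abs_signalStrength_le (hδ : 0 < δ) (hp : (avgProb p q : ℝ) ≤ 1 - δ)
    (hC : |signal n p q| ≤ C) : |signalStrength n p q| ≤ 1 + C / (2 * δ) := by
  have C_nonneg : 0 ≤ C := (abs_nonneg _).trans hC
  have bound_nonneg : 0 ≤ C / (2 * δ) := by positivity
  have sq_le : signalStrength n p q ^ 2 ≤ C / (2 * δ) := by
    rw [signalStrength_sq]
    exact div_le_div₀ C_nonneg ((le_abs_self _).trans hC) (by positivity) (by linarith)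
  exact abs_le_of_sq_le_sq (by nlinarith) (by linarith)

lemma abs_div_edgeDev_sq_eq (hn : 0 < n) :
    |((p : ℝ) - q) / 2| / edgeDev p q ^ 2 = |signalStrength n p q| * (√n * edgeDev p q)⁻¹ := by
  have sqrt_pos : 0 < √(n : ℝ) := Real.sqrt_pos.2 (by exact_mod_cast hn)
  have dev_nonneg : 0 ≤ edgeDev p q := Real.sqrt_nonneg _
  rw [signalStrength, abs_div _ (edgeDev p q), abs_mul, abs_of_pos sqrt_pos,
    abs_of_nonneg dev_nonneg]
  field_simp

end CycleMean

section NormalizedCycles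

variable {ι : Type*} (n : ℕ) (p q : I) (k : ι → ℕ)

/-- The vector of the signed cycles of lengths `k i` in the stochastic block model, centered at
`cycleMean n p q (k i)` and divided by `√(2 * k i)`. -/
noncomputable def normalizedCycles (ω : LabelledGraph n) : EuclideanSpace ℝ ι :=
  WithLp.toLp 2 fun i =>
    (signedCycle (sbm n p q) (k i) ω - cycleMean n p q (k i)) / √(2 * (k i : ℝ))

lemma normalizedCycles_self : normalizedCycles n p p k = fun ω =>
    WithLp.toLp 2 fun i => signedCycle (sbm n p p) (k i) ω / √(2 * (k i : ℝ)) := by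
  refine funext fun ω => congrArg (WithLp.toLp 2) (funext fun i => ?_)
  rcases eq_or_ne (k i) 0 with hk | hk <;> simp [cycleMean, hk]

variable [Fintype ι] {n p q} {m : ι → ℕ}

lemma charFun_map_normalizedCycles (hn : 2 ≤ n) (hdev : 0 < edgeDev p q)
    (t : EuclideanSpace ℝ ι) :
    charFun ((sbm n p q).map (normalizedCycles n p q (m · + 3))) t =
      ((2 : ℝ) ^ n)⁻¹ • ∑ τ : Fin n → ℤˣ, ∫ ω, Complex.exp (Complex.I *
        (∑ i, gaussianCoeff t m i * (cycleSum (m i) ((edgeNoise p q τ · ω) +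
          signalWeight (signalStrength n p q) τ) - signalStrength n p q ^ (m i + 3)) : ℝ))
        ∂tossLaw p q τ := by
  rw [charFun_apply, integral_map Measurable.of_discrete.aemeasurable
    (Measurable.aestronglyMeasurable (by fun_prop)), integral_sbm]
  simp only [integral_graphLaw]
  have inner_eq (τ : Fin n → ℤˣ) (ω : Sym2 (Fin n) → Prop) :
      inner ℝ (normalizedCycles n p q (m · + 3) (τ, SimpleGraph.fromEdgeSet {e | ω e})) t =
        ∑ i, gaussianCoeff t m i * (cycleSum (m i) ((edgeNoise p q τ · ω) +
          signalWeight (signalStrength n p q) τ) - signalStrength n p q ^ (m i + 3)) := by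
    rw [PiLp.inner_apply]
    refine Finset.sum_congr rfl fun i _ => ?_
    simp only [normalizedCycles, signedCycle, avgConnProb_sbm p q hn, cycleMean_eq,
      RCLike.inner_apply, conj_trivial, gaussianCoeff]
    rw [signedCycleCount_fromEdgeSet hdev]
    ring
  simp only [inner_eq, mul_comm _ Complex.I]

lemma norm_average_sub_le (f : (Fin n → ℤˣ) → ℂ) {z : ℂ} {E : ℝ} (h : ∀ τ, ‖f τ - z‖ ≤ E) :
    ‖((2 : ℝ) ^ n)⁻¹ • ∑ τ, f τ - z‖ ≤ E := by
  rw [← mem_closedBall_iff_norm, Finset.smul_sum]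
  refine (convex_closedBall z E).sum_mem (fun _ _ => by positivity) ?_ fun τ _ =>
    mem_closedBall_iff_norm.2 (h τ)
  simp [Fintype.card_units_int]

lemma charFun_stdGaussian_euclideanSpace (t : EuclideanSpace ℝ ι) :
    charFun (stdGaussian (EuclideanSpace ℝ ι)) t = Complex.exp (-(∑ i, t i ^ 2 : ℝ) / 2) := by
  simp [charFun_stdGaussian, ← Complex.ofReal_pow, EuclideanSpace.norm_sq_eq]

variable {k} {Θ : ℝ} {M : ℕ}

lemma norm_charFun_normalizedCycles_sub_le (hn : 2 ≤ n) (hdev : 0 < edgeDev p q) (hΘ : 1 ≤ Θ)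
    (hθ : |signalStrength n p q| ≤ Θ) (hε : Θ * (√n * edgeDev p q)⁻¹ ≤ 1)
    (hk : Function.Injective k) (hk3 : ∀ i, 3 ≤ k i) (hkM : ∀ i, k i ≤ M)
    (hMn : ((4 * M : ℕ) : ℝ) * 2 ^ (4 * M) ≤ √n) (t : EuclideanSpace ℝ ι) :
    ‖charFun ((sbm n p q).map (normalizedCycles n p q k)) t -
        charFun (stdGaussian (EuclideanSpace ℝ ι)) t‖ ≤
      signalError (Fin n) Θ M t +
        noiseError (Fin n) (edgeDev p q) (Θ * (√n * edgeDev p q)⁻¹) M t := by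
  obtain ⟨m, rfl⟩ : ∃ m : ι → ℕ, k = (m · + 3) :=
    ⟨(k · - 3), funext fun i => (Nat.sub_add_cancel (hk3 i)).symm⟩
  have : Nonempty (Fin n) := ⟨⟨0, by lia⟩⟩
  have sqrt_pos : 0 < √(n : ℝ) := Real.sqrt_pos.2 (by exact_mod_cast (by lia : 0 < n))
  have one_le : 1 ≤ √n * edgeDev p q := by
    rw [← div_eq_mul_inv, div_le_one (by positivity)] at hε
    exact hΘ.trans hε
  have noise (τ : Fin n → ℤˣ) : IsNoise (edgeNoise p q τ) (tossLaw p q τ) (edgeDev p q)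
      (Θ * (√n * edgeDev p q)⁻¹) := by
    refine isNoise_edgeNoise τ hdev ?_ hε
    rw [abs_div_edgeDev_sq_eq (n := n) (by lia)]
    gcongr
  rw [charFun_map_normalizedCycles hn hdev, charFun_stdGaussian_euclideanSpace]
  exact norm_average_sub_le _ fun τ => (noise τ).norm_integral_cexp_sub_gaussian_le hθ hΘ τ
    (fun i j hij => hk (congrArg (· + 3) hij)) hkM (by simpa using one_le) (by simpa using hMn) t

end NormalizedCycles

section Asymptotics

variable {p q : ℕ → I} {δ : ℝ}

lemma eventually_edgeDev_pos (hδ : 0 < δ)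
    (hp : ∀ᶠ n in atTop, (avgProb (p n) (q n) : ℝ) ≤ 1 - δ)
    (hpn : Tendsto (fun n : ℕ => (avgProb (p n) (q n) : ℝ) * n) atTop atTop) :
    ∀ᶠ n in atTop, 0 < edgeDev (p n) (q n) := by
  filter_upwards [hp, hpn.eventually_gt_atTop 0] with n hpn hn
  exact Real.sqrt_pos.2 (mul_pos (pos_of_mul_pos_left hn (Nat.cast_nonneg n)) (by linarith))

lemma mul_avgProb_mul_le_sq {p q : I} (n : ℕ) (hp : (avgProb p q : ℝ) ≤ 1 - δ) :
    δ * (avgProb p q * n) ≤ (√n * edgeDev p q) ^ 2 := by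
  have avg_mul_nonneg : 0 ≤ (avgProb p q : ℝ) * n := mul_nonneg (avgProb p q).2.1 n.cast_nonneg
  rw [mul_pow, Real.sq_sqrt n.cast_nonneg, edgeDev_sq]
  calc δ * (avgProb p q * n) ≤ (1 - avgProb p q) * (avgProb p q * n) := by gcongr; linarith
    _ = _ := by ring

lemma tendsto_inv_sqrt_mul_edgeDev (hδ : 0 < δ)
    (hp : ∀ᶠ n in atTop, (avgProb (p n) (q n) : ℝ) ≤ 1 - δ)
    (hpn : Tendsto (fun n : ℕ => (avgProb (p n) (q n) : ℝ) * n) atTop atTop) :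
    Tendsto (fun n : ℕ => (√n * edgeDev (p n) (q n))⁻¹) atTop (𝓝 0) := by
  have sq_tendsto : Tendsto (fun n : ℕ => (√n * edgeDev (p n) (q n)) ^ 2) atTop atTop :=
    tendsto_atTop_mono' _ (hp.mono fun n => mul_avgProb_mul_le_sq n) (hpn.const_mul_atTop hδ)
  refine ((Real.tendsto_sqrt_atTop.comp sq_tendsto).congr fun n => ?_).inv_tendsto_atTop
  exact Real.sqrt_sq (mul_nonneg (Real.sqrt_nonneg _) (Real.sqrt_nonneg _))

lemma isBigO_log_inv_sqrt_mul_edgeDev (hδ : 0 < δ)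
    (hp : ∀ᶠ n in atTop, (avgProb (p n) (q n) : ℝ) ≤ 1 - δ)
    (hpn : Tendsto (fun n : ℕ => (avgProb (p n) (q n) : ℝ) * n) atTop atTop) :
    (fun n : ℕ => Real.log (avgProb (p n) (q n) * n)) =O[atTop]
      fun n : ℕ => Real.log (√n * edgeDev (p n) (q n))⁻¹ := by
  refine IsBigO.of_bound 4 ?_
  filter_upwards [hp, hpn.eventually_gt_atTop 1,
    (Real.tendsto_log_atTop.comp hpn).eventually_ge_atTop (-2 * Real.log δ)]
    with n hpn one_lt log_ge
  have log_pos : 0 < Real.log (avgProb (p n) (q n) * n) := Real.log_pos one_lt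
  have log_add_le : Real.log δ + Real.log (avgProb (p n) (q n) * n) ≤
      2 * Real.log (√n * edgeDev (p n) (q n)) := by
    rw [← Real.log_mul hδ.ne' (by positivity)]
    refine (Real.log_le_log (by positivity) (mul_avgProb_mul_le_sq n hpn)).trans_eq ?_
    rw [Real.log_pow, Nat.cast_two]
  rw [Real.log_inv, norm_neg, Real.norm_of_nonneg log_pos.le, Real.norm_eq_abs]
  simp only [Function.comp_apply] at log_ge
  linarith [le_abs_self (Real.log (√n * edgeDev (p n) (q n)))]

lemma eventually_natCast_mul_pow_le_sqrt {ρ : ℕ → ℝ} {M : ℕ → ℕ}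
    (hρ : ∀ᶠ n in atTop, ρ n ∈ Set.Ioc 0 1)
    (hx : Tendsto (fun n : ℕ => (√n * ρ n)⁻¹) atTop (𝓝 0))
    (hM : (fun n => (M n : ℝ)) =o[atTop] fun n : ℕ => Real.log (√n * ρ n)⁻¹) :
    ∀ᶠ n in atTop, ((4 * M n : ℕ) : ℝ) * 2 ^ (4 * M n) ≤ √n := by
  have small := (tendsto_natCast_pow_mul_pow_mul_inv_zero (hρ.mono fun _ h => h.1) hx hM 1
    (D := 16) (by norm_num)).eventually_le_const (by norm_num : (0 : ℝ) < 1 / 4)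
  filter_upwards [small, hρ, eventually_gt_atTop 0] with n hn ⟨hρ0, hρ1⟩ hn0
  rw [← div_eq_mul_inv, div_le_iff₀ (by positivity), pow_one] at hn
  calc ((4 * M n : ℕ) : ℝ) * 2 ^ (4 * M n) = 4 * (M n * 16 ^ M n) := by
        rw [pow_mul]
        push_cast
        ring
    _ ≤ √n * ρ n := by linarith
    _ ≤ √n := mul_le_of_le_one_right (Real.sqrt_nonneg _) hρ1

lemma isBigO_min_left {α : Type*} {f : Filter α} {u v : α → ℝ} (hu : ∀ᶠ n in f, 0 ≤ u n)
    (hv : ∀ᶠ n in f, 0 ≤ v n) : (fun n => min (u n) (v n)) =O[f] u := by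
  refine IsBigO.of_bound 1 ?_
  filter_upwards [hu, hv] with n hun hvn
  rw [Real.norm_of_nonneg (le_min hun hvn), Real.norm_of_nonneg hun, one_mul]
  exact min_le_left _ _

lemma tendsto_avgProb_mul_atTop
    (h : Tendsto (fun n : ℕ => (n : ℝ) * ((p n : ℝ) + q n)) atTop atTop) :
    Tendsto (fun n : ℕ => (avgProb (p n) (q n) : ℝ) * n) atTop atTop := by
  refine (h.atTop_div_const two_pos).congr fun n => ?_
  rw [coe_avgProb]
  ring

lemma tendsto_mul_add_atTop (h : Tendsto (fun n : ℕ => (n : ℝ) * p n) atTop atTop) :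
    Tendsto (fun n : ℕ => (n : ℝ) * ((p n : ℝ) + q n)) atTop atTop :=
  tendsto_atTop_mono (fun n => mul_le_mul_of_nonneg_left
    (le_add_of_nonneg_right (q n).2.1) n.cast_nonneg) h

end Asymptotics

end SignedCycles

open SignedCycles in
theorem mainTheorem5_general {ι : Type*} [Fintype ι] (p q : ℕ → unitInterval) (k : ℕ → ι → ℕ)
    (hp : ∃ δ : ℝ, 0 < δ ∧ ∀ᶠ n in atTop, (avgProb (p n) (q n) : ℝ) ≤ 1 - δ)
    (hpn : Tendsto (fun n : ℕ => (avgProb (p n) (q n) : ℝ) * n) atTop atTop)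
    (hsignal : (fun n => signal n (p n) (q n)) =O[atTop] fun _ => (1 : ℝ))
    (hk3 : ∀ᶠ n in atTop, ∀ i, 3 ≤ k n i) (hkinj : ∀ᶠ n in atTop, Function.Injective (k n))
    (hk : ∀ i, (fun n => (k n i : ℝ)) =o[atTop]
      fun n : ℕ => Real.log ((avgProb (p n) (q n) : ℝ) * n)) :
    TendstoInDistribution (fun n => normalizedCycles n (p n) (q n) (k n)) atTop
      (id : EuclideanSpace ℝ ι → EuclideanSpace ℝ ι) (fun n => sbm n (p n) (q n))
      (stdGaussian (EuclideanSpace ℝ ι)) := by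
  obtain ⟨δ, hδ, hp⟩ := hp
  obtain ⟨C, hC, hsignal⟩ := hsignal.exists_nonneg
  set ρ : ℕ → ℝ := fun n => edgeDev (p n) (q n)
  set M : ℕ → ℕ := fun n => ∑ i, k n i
  set Θ : ℝ := 1 + C / (2 * δ)
  have hΘ : 1 ≤ Θ := le_add_of_nonneg_right (by positivity)
  have hρ : ∀ᶠ n in atTop, ρ n ∈ Set.Ioc 0 1 :=
    (eventually_edgeDev_pos hδ hp hpn).mono fun n hn =>
      ⟨hn, edgeDev_le_one _ _⟩
  have hx : Tendsto (fun n : ℕ => (√n * ρ n)⁻¹) atTop (𝓝 0) :=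
    tendsto_inv_sqrt_mul_edgeDev hδ hp hpn
  have hM : (fun n => (M n : ℝ)) =o[atTop] fun n : ℕ => Real.log (√n * ρ n)⁻¹ := by
    simp only [M, Nat.cast_sum]
    exact (IsLittleO.fun_sum fun i _ => hk i).trans_isBigO
      (isBigO_log_inv_sqrt_mul_edgeDev hδ hp hpn)
  have hε : ∀ᶠ n : ℕ in atTop, Θ * (√n * ρ n)⁻¹ ≤ 1 :=
    (hx.const_mul Θ).eventually_le_const (by simp)
  refine ⟨fun n => Measurable.of_discrete.aemeasurable, by fun_prop,
    ProbabilityMeasure.tendsto_of_tendsto_charFun fun t => ?_⟩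
  simp only [ProbabilityMeasure.coe_mk, Measure.map_id]
  rw [tendsto_iff_norm_sub_tendsto_zero]
  have error_tendsto := (tendsto_signalError hρ hx hM hΘ t).add
    (tendsto_noiseError hρ hx hM Θ t)
  rw [add_zero] at error_tendsto
  refine squeeze_zero' (.of_forall fun n => norm_nonneg _) ?_ error_tendsto
  filter_upwards [hp, hρ, hε, eventually_natCast_mul_pow_le_sqrt hρ hx hM, hk3, hkinj,
    hsignal.bound, eventually_ge_atTop 2] with n hp hρ hε hMn hk3 hkinj hsignal hn
  exact norm_charFun_normalizedCycles_sub_le hn hρ.1 hΘ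
    (abs_signalStrength_le hδ hp (by simpa using hsignal)) hε hkinj hk3
    (fun i => Finset.single_le_sum (fun _ _ => Nat.zero_le _) (Finset.mem_univ i)) hMn t

theorem mainTheorem5 (p q : ℕ → unitInterval) (l : ℕ) (k : ℕ → Fin l → ℕ)
    (hp1 : ∃ δ : ℝ, 0 < δ ∧ ∀ᶠ n in atTop, (SignedCycles.avgProb (p n) (q n) : ℝ) ≤ 1 - δ)
    (hk3 : ∀ᶠ n in atTop, ∀ i, 3 ≤ k n i)
    (hkmono : ∀ᶠ n in atTop, StrictMono (k n)) :
    -- the Erdős–Rényi case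
    ((Tendsto (fun n : ℕ => (n : ℝ) * ((p n : ℝ) + q n)) atTop atTop →
      (∀ i, (fun n => (k n i : ℝ)) =o[atTop]
        fun n : ℕ => Real.log ((SignedCycles.avgProb (p n) (q n) : ℝ) * n)) →
      TendstoInDistribution
        (fun (n : ℕ) (ω : SignedCycles.LabelledGraph n) =>
          (WithLp.toLp 2 fun i : Fin l =>
            SignedCycles.signedCycle
              (SignedCycles.sbm n (SignedCycles.avgProb (p n) (q n))
                (SignedCycles.avgProb (p n) (q n))) (k n i) ω / √(2 * (k n i : ℝ)) :
            EuclideanSpace ℝ (Fin l)))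
        atTop (id : EuclideanSpace ℝ (Fin l) → EuclideanSpace ℝ (Fin l))
        (fun n => SignedCycles.sbm n (SignedCycles.avgProb (p n) (q n))
          (SignedCycles.avgProb (p n) (q n)))
        (stdGaussian (EuclideanSpace ℝ (Fin l))))) ∧
    -- the stochastic block model
    ((Tendsto (fun n : ℕ => (n : ℝ) * (p n : ℝ)) atTop atTop →
      (fun n => SignedCycles.signal n (p n) (q n)) =Θ[atTop] (fun _ => (1 : ℝ)) →
      (∀ i, (fun n => (k n i : ℝ)) =o[atTop]
        fun n : ℕ => min (Real.log ((SignedCycles.avgProb (p n) (q n) : ℝ) * n))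
          (√(Real.log n))) →
      TendstoInDistribution
        (fun (n : ℕ) (ω : SignedCycles.LabelledGraph n) =>
          (WithLp.toLp 2 fun i : Fin l =>
            (SignedCycles.signedCycle (SignedCycles.sbm n (p n) (q n)) (k n i) ω -
              SignedCycles.cycleMean n (p n) (q n) (k n i)) / √(2 * (k n i : ℝ)) :
            EuclideanSpace ℝ (Fin l)))
        atTop (id : EuclideanSpace ℝ (Fin l) → EuclideanSpace ℝ (Fin l))
        (fun n => SignedCycles.sbm n (p n) (q n))
        (stdGaussian (EuclideanSpace ℝ (Fin l))))) := by
  have hkinj : ∀ᶠ n in atTop, Function.Injective (k n) := hkmono.mono fun n h => h.injective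
  constructor
  · intro hpq hk
    have hpn := SignedCycles.tendsto_avgProb_mul_atTop hpq
    have normal := mainTheorem5_general (fun n => SignedCycles.avgProb (p n) (q n))
      (fun n => SignedCycles.avgProb (p n) (q n)) k
    simp only [SignedCycles.avgProb_self, SignedCycles.signal_self] at normal
    simpa only [SignedCycles.normalizedCycles_self] using
      normal hp1 hpn (isBigO_zero _ _) hk3 hkinj hk
  · intro hp hsignal hk
    have hpn :=
      SignedCycles.tendsto_avgProb_mul_atTop (SignedCycles.tendsto_mul_add_atTop (q := q) hp)
    have log_nonneg := (Real.tendsto_log_atTop.comp hpn).eventually_ge_atTop 0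
    exact mainTheorem5_general p q k hp1 hpn hsignal.isBigO hk3 hkinj fun i =>
      (hk i).trans_isBigO
        (SignedCycles.isBigO_min_left log_nonneg (.of_forall fun n => Real.sqrt_nonneg _))
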